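/- Let $X$ be a relatively compact (i.e. totally bounded) metric space, $m$ a finite Radon measure on $X$ with full support, and let $(\mathcal E_A,V_{1/2})$ be a Dirichlet form on the real Hilbert space $L^2(X)=L^2(X,m)$: a densely defined, symmetric, non-negative, closed and Markovian bilinear form. Assume that the embedding $V_{1/2}\hookrightarrow L^2(X)$ is compact and that $V_{1/2}\hookrightarrow L^{2q_A}(X)$ continuously for some $q_A>1$. Let $A$ be the associated non-negative self-adjoint operator ($u\in D(A)$ and $Au=w$ iff $u\in V_{1/2}$ and $\mathcal E_A(u,v)=(w,v)$ for all $v\in V_{1/2}$), and assume that its smallest eigenvalue $\lambda_1$ is positive. Then $L^2(X)$ has an (at most countable) orthonormal basis $(\varphi_n)$ of eigenfunctions, $A\varphi_n=\lambda_n\varphi_n$. Fix any such basis. For $s\ge 0$ let $V_s=D(A^s)=\{h\in L^2(X):\sum_n\lambda_n^{2s}|(h,\varphi_n)|^2<\infty\}$ with norm $\|h\|_{V_s}=\big(\sum_n\lambda_n^{2s}|(h,\varphi_n)|^2\big)^{1/2}$, and let $V_{-s}=(V_s)^*$ with the dual norm, $L^2(X)$ being embedded in $V_{-s}$ by $h\mapsto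 (h,\cdot)$. Let $E_{a,b}(z)=\sum_{k\ge0}z^k/\Gamma(ak+b)$. Let $1<\alpha<2$, $\gamma=1/\alpha$, $1\le p<\frac1{2-\alpha}$ and $\frac1p+\frac1q=1$ ($q=\infty$ if $p=1$). For $T>0$, $u_0\in V_\gamma$, $u_1\in L^2(X)$ and $f\in C([0,T];V_{-\gamma})\cap L^q((0,T);L^2(X))$ consider $$\mathbb D_t^\alpha u+Au=f\ \text{ on }(0,T),\qquad u(0)=u_0,\quad \partial_tu(0)=u_1,\tag{1}$$ where $\mathbb D_t^\alpha u(t)=\frac1{\Gamma(2-\alpha)}\,\partial_t^2\int_0^t(t-s)^{1-\alpha}\big(u(s)-u(0)-s\,\partial_tu(0)\big)\,ds$, with $\partial_t^2$ taken in $V_{-\gamma}$. A weak solution of (1) is a function $u\in C([0,T];V_\gamma)\cap C^1([0,T];L^2(X))$ with $\mathbb D_t^\alpha u\in C([0,T];V_{-\gamma})$ such that $u(0)=u_0$, $\partial_tu(0)=u_1$; $\|u(t)-u_0\|_{V_\sigma}\to0$ and $\|\partial_tu(t)-u_1\|_{V_{-\beta}}\to0$ as $t\to0^+$ for some $0\le\sigma<\gamma$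 and some $0<\beta\le1-\gamma$; and, for every $\varphi\in V_\gamma$ and a.e. $t\in(0,T)$, $$\langle\mathbb D_t^\alpha u(t),\varphi\rangle_{V_{-\gamma},V_\gamma}+\mathcal E_A(u(t),\varphi)=(f(t),\varphi).$$ Then there is a constant $C>0$, independent of $T,u_0,u_1,f$, such that for all such $T,u_0,u_1,f$ problem (1) has a unique weak solution $u$ on $[0,T]$; it is given for $t\in[0,T]$ by $$u(t)=\sum_n(u_0,\varphi_n)E_{\alpha,1}(-\lambda_nt^\alpha)\varphi_n+\sum_n(u_1,\varphi_n)\,tE_{\alpha,2}(-\lambda_nt^\alpha)\varphi_n+\sum_n\Big(\int_0^t(f(\tau),\varphi_n)(t-\tau)^{\alpha-1}E_{\alpha,\alpha}(-\lambda_n(t-\tau)^\alpha)\,d\tau\Big)\varphi_n,$$ each of the three series converging in $V_\gamma$; and for all $t\in[0,T]$ $$\|u(t)\|_{V_\gamma}+\|\partial_tu(t)\|_{L^2(X)}\le C\Big(\|u_0\|_{V_\gamma}+\|u_1\|_{L^2(X)}+t^{\frac1p+\alpha-2}\|f\|_{L^q((0,T);L^2(X))}\Big),$$ $$\|\mathbb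 D_t^\alpha u(t)\|_{V_{-\gamma}}\le C\Big(\|u_0\|_{V_\gamma}+t^{2-\alpha}\|u_1\|_{L^2(X)}+t^{\frac1p}\|f\|_{L^q((0,T);L^2(X))}+\|f\|_{C([0,T];V_{-\gamma})}\Big).$$ -/

import Mathlib

open MeasureTheory Filter Topology
open scoped ENNReal ContDiff

noncomputable section

namespace FracWave

universe u v

/-- The real Hilbert space `L²(X, m)`. -/
abbrev L2 {X : Type u} [MeasurableSpace X] (m : Measure X) : Type u := Lp ℝ 2 m

/-- A Dirichlet form `(𝓔, V_{1/2})` on `L²(X, m)`: a densely defined, symmetric, non-negative,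
closed, Markovian bilinear form. -/
structure DirichletForm {X : Type u} [MeasurableSpace X] (m : Measure X) where
  /-- the form domain `V_{1/2}` -/
  dom : Submodule ℝ (L2 m)
  form : dom →ₗ[ℝ] dom →ₗ[ℝ] ℝ
  dense_dom : Dense (dom : Set (L2 m))
  symm : ∀ a b : dom, form a b = form b a
  nonneg : ∀ a : dom, 0 ≤ form a a
  closed : ∀ r : ℝ, 0 < r → ∀ a : ℕ → dom,
    Tendsto (fun k : ℕ × ℕ => form (a k.1 - a k.2) (a k.1 - a k.2) +
      r * inner ℝ (a k.1 - a k.2) (a k.1 - a k.2)) atTop (𝓝 0) →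
    ∃ b : dom, Tendsto (fun n => form (a n - b) (a n - b) +
      r * inner ℝ (a n - b) (a n - b)) atTop (𝓝 0)
  markov : ∀ ε : ℝ, 0 < ε → ∃ ψ : ℝ → ℝ, ContDiff ℝ ∞ ψ ∧
    (∀ t ∈ Set.Icc (0 : ℝ) 1, ψ t = t) ∧
    (∀ t, -ε ≤ ψ t ∧ ψ t ≤ 1 + ε) ∧
    (∀ τ t, τ < t → 0 ≤ ψ t - ψ τ ∧ ψ t - ψ τ ≤ t - τ) ∧
    ∀ a : dom, ∃ b : dom, ((b : L2 m) : X → ℝ) =ᵐ[m] (fun x => ψ (((a : L2 m) : X → ℝ) x)) ∧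
      form b b ≤ form a a

namespace DirichletForm

variable {X : Type u} [MeasurableSpace X] {m : Measure X}

/-- The squared norm `𝓔(a,a) + (a,a)` of the Hilbert space `V_{1/2}`. -/
def normSq (𝓔 : DirichletForm m) (a : 𝓔.dom) : ℝ :=
  𝓔.form a a + inner ℝ (a : L2 m) (a : L2 m)

/-- The embedding of `V_{1/2}` into `L²(X)` is compact. -/
def CompactEmbedding (𝓔 : DirichletForm m) : Prop :=
  IsCompact (closure {h : L2 m | ∃ a : 𝓔.dom, (a : L2 m) = h ∧ 𝓔.normSq a ≤ 1})

/-- `V_{1/2}` embeds continuously into `L^{2 q_A}(X)` for some real `q_A > 1`. -/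
def SobolevEmbedding (𝓔 : DirichletForm m) : Prop :=
  ∃ qA : ℝ, 1 < qA ∧ ∃ C : ℝ, 0 < C ∧ ∀ a : 𝓔.dom,
    eLpNorm ((a : L2 m) : X → ℝ) (ENNReal.ofReal (2 * qA)) m ≤
      ENNReal.ofReal (C * Real.sqrt (𝓔.normSq a))

/-- The graph of the self-adjoint operator `A` associated with the form:
`a ∈ D(A)` and `A a = w`. -/
def OperatorGraph (𝓔 : DirichletForm m) (a w : L2 m) : Prop :=
  ∃ ha : a ∈ 𝓔.dom, ∀ b : 𝓔.dom, 𝓔.form ⟨a, ha⟩ b = inner ℝ w (b : L2 m)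

/-- The set of eigenvalues of `A`. -/
def eigenvalues (𝓔 : DirichletForm m) : Set ℝ :=
  {μ | ∃ a : L2 m, a ≠ 0 ∧ 𝓔.OperatorGraph a (μ • a)}

/-- The smallest eigenvalue `λ₁` of `A`. -/
def firstEigenvalue (𝓔 : DirichletForm m) : ℝ := sInf 𝓔.eigenvalues

theorem eigenvalue_nonneg (𝓔 : DirichletForm m) {μ : ℝ} (h : μ ∈ 𝓔.eigenvalues) : 0 ≤ μ := by
  obtain ⟨a, ha, hd, hw⟩ := h
  have h1 := hw ⟨a, hd⟩
  have h2 := 𝓔.nonneg ⟨a, hd⟩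
  rw [h1, real_inner_smul_left] at h2
  have h3 : 0 < inner ℝ a a := real_inner_self_pos.2 ha
  exact nonneg_of_mul_nonneg_left h2 h3

theorem firstEigenvalue_le (𝓔 : DirichletForm m) {μ : ℝ} (h : μ ∈ 𝓔.eigenvalues) :
    𝓔.firstEigenvalue ≤ μ :=
  csInf_le ⟨0, fun _ hx => 𝓔.eigenvalue_nonneg hx⟩ h

/-- An orthonormal basis `(φ_i)` of `L²(X)` of eigenfunctions, `A φ_i = λ_i φ_i`. -/
structure EigenSystem (𝓔 : DirichletForm m) (ι : Type v) where
  φ : HilbertBasis ι ℝ (L2 m)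
  lam : ι → ℝ
  eig : ∀ i, 𝓔.OperatorGraph (φ i) (lam i • φ i)

end DirichletForm

/-- The Mittag-Leffler function `E_{a,b}` on the real line. -/
def mittagLeffler (a b z : ℝ) : ℝ := ∑' n : ℕ, z ^ n / Real.Gamma (a * n + b)

namespace DirichletForm.EigenSystem

variable {X : Type u} [MeasurableSpace X] {m : Measure X} {𝓔 : DirichletForm m} {ι : Type v}

theorem lam_mem (S : 𝓔.EigenSystem ι) (i : ι) : S.lam i ∈ 𝓔.eigenvalues :=
  ⟨S.φ i, S.φ.orthonormal.ne_zero i, S.eig i⟩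

theorem le_lam (S : 𝓔.EigenSystem ι) (i : ι) : 𝓔.firstEigenvalue ≤ S.lam i :=
  𝓔.firstEigenvalue_le (S.lam_mem i)

theorem lam_pos [hF : Fact (0 < 𝓔.firstEigenvalue)] (S : 𝓔.EigenSystem ι) (i : ι) :
    0 < S.lam i := hF.out.trans_le (S.le_lam i)

/-- `V_s = D(A^s)` for `s ≥ 0`: the `h ∈ L²(X)` with `∑ |λ_i^s (h, φ_i)|² < ∞`. -/
def V (S : 𝓔.EigenSystem ι) (s : ℝ) : Submodule ℝ (L2 m) where
  carrier := {h | Memℓp (fun i => S.lam i ^ s * inner ℝ (S.φ i) h) 2}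
  add_mem' := by
    intro a b ha hb
    have e : (fun i => S.lam i ^ s * inner ℝ (S.φ i) (a + b)) =
        (fun i => S.lam i ^ s * inner ℝ (S.φ i) a) + fun i => S.lam i ^ s * inner ℝ (S.φ i) b := by
      funext i
      simp only [Pi.add_apply, inner_add_right, mul_add]
    change Memℓp _ 2
    rw [e]
    exact Memℓp.add ha hb
  zero_mem' := by
    have e : (fun i => S.lam i ^ s * inner ℝ (S.φ i) (0 : L2 m)) = 0 := by
      funext i
      simp only [inner_zero_right, mul_zero, Pi.zero_apply]
    change Memℓp _ 2
    rw [e]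
    exact zero_memℓp
  smul_mem' := by
    intro c a ha
    have e : (fun i => S.lam i ^ s * inner ℝ (S.φ i) (c • a)) =
        c • (fun i => S.lam i ^ s * inner ℝ (S.φ i) a) := by
      funext i
      simp only [Pi.smul_apply, smul_eq_mul, real_inner_smul_right]
      ring
    change Memℓp _ 2
    rw [e]
    exact Memℓp.const_smul (𝕜 := ℝ) ha c

/-- The space `V_s` as a type of its own, to carry the norm of `D(A^s)` rather than that
of `L²(X)`. -/
def Space (S : 𝓔.EigenSystem ι) (s : ℝ) : Type u := S.V s

instance (S : 𝓔.EigenSystem ι) (s : ℝ) : AddCommGroup (S.Space s) :=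
  inferInstanceAs (AddCommGroup (S.V s))

instance (S : 𝓔.EigenSystem ι) (s : ℝ) : Module ℝ (S.Space s) :=
  inferInstanceAs (Module ℝ (S.V s))

/-- The inclusion of `V_s` in `L²(X)`. -/
def toL2 (S : 𝓔.EigenSystem ι) {s : ℝ} : S.Space s →ₗ[ℝ] L2 m := (S.V s).subtype

theorem toL2_mem (S : 𝓔.EigenSystem ι) {s : ℝ} (h : S.Space s) : S.toL2 h ∈ S.V s :=
  Subtype.property (p := (· ∈ S.V s)) h

theorem toL2_injective (S : 𝓔.EigenSystem ι) {s : ℝ} :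
    Function.Injective (S.toL2 (s := s)) := Subtype.val_injective

/-- The sequence `(λ_i^s (h, φ_i))_i` in `ℓ²`. -/
def coord (S : 𝓔.EigenSystem ι) (s : ℝ) : S.Space s →ₗ[ℝ] lp (fun _ : ι => ℝ) 2 where
  toFun h := ⟨fun i => S.lam i ^ s * inner ℝ (S.φ i) (S.toL2 h), S.toL2_mem h⟩
  map_add' a b := by
    ext i
    simp only [map_add, inner_add_right, mul_add, lp.coeFn_add, Pi.add_apply]
  map_smul' c a := by
    ext i
    simp only [map_smul, real_inner_smul_right, RingHom.id_apply, lp.coeFn_smul, Pi.smul_apply,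
      smul_eq_mul]
    ring

theorem coord_apply (S : 𝓔.EigenSystem ι) {s : ℝ} (h : S.Space s) (i : ι) :
    S.coord s h i = S.lam i ^ s * inner ℝ (S.φ i) (S.toL2 h) := rfl

theorem eq_zero_of_inner (S : 𝓔.EigenSystem ι) {h : L2 m}
    (hh : ∀ i, inner ℝ (S.φ i) h = 0) : h = 0 := by
  apply S.φ.repr.injective
  ext i
  simp [S.φ.repr_apply_apply, hh i]

theorem basis_mem (S : 𝓔.EigenSystem ι) (s : ℝ) (i : ι) : S.φ i ∈ S.V s := by
  classical
  have h2 : (0 : ℝ) < (2 : ℝ≥0∞).toReal := by norm_num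
  change Memℓp _ 2
  rw [memℓp_gen_iff h2]
  refine summable_of_ne_finset_zero (s := {i}) fun j hj => ?_
  have hij : j ≠ i := by simpa using hj
  simp [S.φ.orthonormal.2 hij]

/-- The eigenfunction `φ_i` as an element of `V_s`. -/
def basisVec (S : 𝓔.EigenSystem ι) (s : ℝ) (i : ι) : S.Space s := ⟨S.φ i, S.basis_mem s i⟩

variable [hF : Fact (0 < 𝓔.firstEigenvalue)]

theorem coord_injective (S : 𝓔.EigenSystem ι) (s : ℝ) : Function.Injective (S.coord s) := by
  rw [← LinearMap.ker_eq_bot, LinearMap.ker_eq_bot']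
  intro h hh
  apply S.toL2_injective
  rw [map_zero]
  apply S.eq_zero_of_inner
  intro i
  have h1 : S.coord s h i = 0 := by rw [hh]; rfl
  rw [coord_apply] at h1
  exact (mul_eq_zero.1 h1).resolve_left (Real.rpow_pos_of_pos (S.lam_pos i) s).ne'

/-- The norm of `V_s = D(A^s)`: `‖h‖ = (∑ |λ_i^s (h, φ_i)|²)^{1/2}`. -/
instance (S : 𝓔.EigenSystem ι) (s : ℝ) : NormedAddCommGroup (S.Space s) :=
  NormedAddCommGroup.induced (S.Space s) (lp (fun _ : ι => ℝ) 2) (S.coord s)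
    (S.coord_injective s)

instance (S : 𝓔.EigenSystem ι) (s : ℝ) : NormedSpace ℝ (S.Space s) :=
  NormedSpace.induced ℝ (S.Space s) (lp (fun _ : ι => ℝ) 2) (S.coord s)

theorem norm_def (S : 𝓔.EigenSystem ι) {s : ℝ} (h : S.Space s) : ‖h‖ = ‖S.coord s h‖ := rfl

/-- The dual space `V_{-s} = (V_s)^*` with the dual norm. -/
abbrev Dual (S : 𝓔.EigenSystem ι) (s : ℝ) : Type u := StrongDual ℝ (S.Space s)

theorem norm_toL2_le (S : 𝓔.EigenSystem ι) {s : ℝ} (hs : 0 ≤ s) (h : S.Space s) :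
    ‖S.toL2 h‖ ≤ (𝓔.firstEigenvalue ^ s)⁻¹ * ‖h‖ := by
  have hc : 0 < 𝓔.firstEigenvalue ^ s := Real.rpow_pos_of_pos hF.out s
  have key : ‖𝓔.firstEigenvalue ^ s • S.φ.repr (S.toL2 h)‖ ≤ ‖S.coord s h‖ := by
    apply lp.norm_mono (by norm_num)
    intro i
    rw [coord_apply, lp.coeFn_smul, Pi.smul_apply, S.φ.repr_apply_apply, norm_smul, norm_mul]
    gcongr
    rw [Real.norm_of_nonneg hc.le, Real.norm_of_nonneg (Real.rpow_nonneg (S.lam_pos i).le s)]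
    exact Real.rpow_le_rpow hF.out.le (S.le_lam i) hs
  rw [norm_smul, S.φ.repr.norm_map, Real.norm_of_nonneg hc.le, ← norm_def] at key
  rw [inv_mul_eq_div, le_div_iff₀ hc]
  linarith

/-- The embedding of `L²(X)` in `V_{-s}`, `s ≥ 0`, of the Gelfand triple:
`h ↦ (v ↦ (h, v)_{L²})`. -/
def toDual (S : 𝓔.EigenSystem ι) {s : ℝ} (hs : 0 ≤ s) : L2 m →L[ℝ] S.Dual s :=
  ((ContinuousLinearMap.compL ℝ (S.Space s) (L2 m) ℝ).flip
    (S.toL2.mkContinuous _ (S.norm_toL2_le hs))).comp (innerSL ℝ)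

theorem toDual_apply (S : 𝓔.EigenSystem ι) {s : ℝ} (hs : 0 ≤ s) (h : L2 m) (w : S.Space s) :
    S.toDual hs h w = inner ℝ h (S.toL2 w) := rfl

theorem V_anti (S : 𝓔.EigenSystem ι) {σ s : ℝ} (hσ : σ ≤ s) : S.V s ≤ S.V σ := by
  intro h hh
  have h2 : (0 : ℝ) < (2 : ℝ≥0∞).toReal := by norm_num
  change Memℓp _ 2 at hh
  change Memℓp _ 2
  have hh' := Memℓp.const_smul (𝕜 := ℝ) hh (𝓔.firstEigenvalue ^ (σ - s))
  rw [memℓp_gen_iff h2] at hh' ⊢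
  refine Summable.of_nonneg_of_le (fun i => by positivity) (fun i => ?_) hh'
  have hl := S.lam_pos i
  have e : S.lam i ^ σ = S.lam i ^ (σ - s) * S.lam i ^ s := by
    rw [← Real.rpow_add hl]; ring_nf
  rw [e, mul_assoc]
  simp only [Pi.smul_apply, smul_eq_mul]
  rw [norm_mul, norm_mul (𝓔.firstEigenvalue ^ (σ - s))]
  have h3 : ‖S.lam i ^ (σ - s)‖ ≤ ‖𝓔.firstEigenvalue ^ (σ - s)‖ := by
    rw [Real.norm_of_nonneg (Real.rpow_nonneg hl.le _),
      Real.norm_of_nonneg (Real.rpow_nonneg hF.out.le _)]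
    exact Real.rpow_le_rpow_of_nonpos hF.out (S.le_lam i) (by linarith)
  gcongr

/-- The inclusion of `V_s` in `V_σ` for `σ ≤ s`. -/
def incl (S : 𝓔.EigenSystem ι) {σ s : ℝ} (hσ : σ ≤ s) : S.Space s →ₗ[ℝ] S.Space σ :=
  Submodule.inclusion (S.V_anti hσ)

/-- The function `t ↦ (1/Γ(2-α)) ∫_0^t (t-s)^{1-α} (w(s) - w(0) - s w'(0)) ds` with values in
`L²(X)`, for `w : [0,T] → L²(X)`. -/
def caputoPotential (α T : ℝ) (w : ℝ → L2 m) (t : ℝ) : L2 m :=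
  (1 / Real.Gamma (2 - α)) • ∫ s in (0 : ℝ)..t,
    (t - s) ^ (1 - α) • (w s - w 0 - s • derivWithin w (Set.Icc 0 T) 0)

/-- The Caputo derivative of order `α ∈ (1,2)` of `w : [0,T] → L²(X)`, with values in `V_{-s}`:
`D_t^α w(t) = (1/Γ(2-α)) ∂_t² ∫_0^t (t-s)^{1-α} (w(s) - w(0) - s w'(0)) ds`, the derivative being
taken in `V_{-s}`. -/
def caputoDeriv (S : 𝓔.EigenSystem ι) {s : ℝ} (hs : 0 ≤ s) (α T : ℝ) (w : ℝ → L2 m) :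
    ℝ → S.Dual s :=
  iteratedDerivWithin 2 (fun t => S.toDual hs (caputoPotential α T w t)) (Set.Icc 0 T)

/-- `f ∈ C([0,T]; V_{-s}) ∩ L^q((0,T); L²(X))`. The continuous representative in `V_{-s}` is `F`;
for almost every `t` its value is the element `f t` of `L²(X)`. -/
structure IsSource (S : 𝓔.EigenSystem ι) {s : ℝ} (hs : 0 ≤ s) (T : ℝ) (q : ℝ≥0∞)
    (F : ℝ → S.Dual s) (f : ℝ → L2 m) : Prop where
  continuousOn : ContinuousOn F (Set.Icc 0 T)
  memLp : MemLp f q (volume.restrict (Set.Ioo 0 T))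
  ae_eq : ∀ᵐ t ∂volume.restrict (Set.Ioo 0 T), F t = S.toDual hs (f t)

theorem order_nonneg {α : ℝ} (hα : 1 < α) : 0 ≤ 1 / α := by positivity

/-- Weak solutions on `(0,T)` of `D_t^α u + A u = f`, `u(0) = u₀`, `∂_t u(0) = u₁`, where
`γ = 1/α`; only the values of `u` on `[0,T]` matter. -/
structure IsWeakSolution (S : 𝓔.EigenSystem ι) {α : ℝ} (hα : 1 < α) (T : ℝ)
    (u₀ : S.Space (1 / α)) (u₁ : L2 m) (f : ℝ → L2 m) (u : ℝ → S.Space (1 / α)) : Prop where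
  /-- `u ∈ C([0,T]; V_γ)` -/
  continuousOn : ContinuousOn u (Set.Icc 0 T)
  /-- `u ∈ C¹([0,T]; L²(X))` -/
  contDiffOn : ContDiffOn ℝ 1 (fun t => S.toL2 (u t)) (Set.Icc 0 T)
  /-- `D_t^α u ∈ C([0,T]; V_{-γ})` -/
  caputo : ContDiffOn ℝ 2 (fun t => S.toDual (order_nonneg hα)
    (caputoPotential α T (fun t => S.toL2 (u t)) t)) (Set.Icc 0 T)
  initial : u 0 = u₀
  initial_deriv : derivWithin (fun t => S.toL2 (u t)) (Set.Icc 0 T) 0 = u₁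
  initial_lim : ∃ (σ : ℝ) (_ : 0 ≤ σ) (hσ : σ < 1 / α),
    Tendsto (fun t => ‖S.incl hσ.le (u t - u₀)‖) (𝓝[>] 0) (𝓝 0)
  initial_deriv_lim : ∃ (β : ℝ) (hβ : 0 < β) (_ : β ≤ 1 - 1 / α),
    Tendsto (fun t => ‖S.toDual hβ.le
      (derivWithin (fun t => S.toL2 (u t)) (Set.Icc 0 T) t - u₁)‖) (𝓝[>] 0) (𝓝 0)
  variational : ∀ w : S.Space (1 / α), ∀ᵐ t ∂volume.restrict (Set.Ioo 0 T),
    ∃ (hu : S.toL2 (u t) ∈ 𝓔.dom) (hw : S.toL2 w ∈ 𝓔.dom),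
      S.caputoDeriv (order_nonneg hα) α T (fun t => S.toL2 (u t)) t w
        + 𝓔.form ⟨S.toL2 (u t), hu⟩ ⟨S.toL2 w, hw⟩ = inner ℝ (f t) (S.toL2 w)

end DirichletForm.EigenSystem

end FracWave

end

noncomputable section

namespace FracWave

/-! Expansion in eigenfunctions of A splits the problem into scalar equations `D^α y + λ y = F`,
solved by Mittag-Leffler functions. The work lies in bounds uniform in λ and in reassembling the
modes in V_γ, L² and V_{-γ}.

Eigenbasis. Closedness makes the form domain a Hilbert space. With J its embedding in L², the
operator J J* is (A+1)⁻¹: compact, self-adjoint and injective. The spectral theorem gives the basis,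
and Parseval in the form domain writes the form as a series (`hasSum_form`).

Scalar equation. Put K_β(t) = t^{β-1} E_{α,β}(-λ t^α) (`mlKernel`) and let g_a be the kernel of the
fractional integral of order a. The Neumann series K_β = Σ (-λ)^n g_{αn+β} yields g_δ * K_β =
K_{δ+β} and K_β = g_β - λ K_{α+β}. These two identities and associativity of convolution give the
equation for each mode (`conv_caputo_modeSol`) and its uniqueness (`eq_zero_of_conv_caputo`).

Decay. The analytic input is |E_{α,β}(-x)| ≤ C/(1+x) for x ≥ 0. Hankel's formula for 1/Γ, summed
over the series, represents E_{α,β}(-z) by a contour integral. The half-angle θ of the contour may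
be taken in (π/2, π/α), because α < 2; then the integrand has no pole in the strip, and the contour
can be pushed to the origin. Interpolation gives λ^σ |K_β(t)| ≤ C t^{β-1-ασ} for 0 ≤ σ ≤ 1
(`exists_mlKernel_bound`).

Source term. For γ = 1/α both source kernels, for u in V_γ and for ∂_t u in L², are O(t^{α-2}), a
function in L^p near 0 because p < 1/(2-α). Minkowski's and Hölder's inequalities bound the ℓ² norm
of the convolutions (`sum_sq_conv_le`). Applied to spectral tails of f, the same estimate gives
uniform convergence in t, hence continuity.

Return to the weak problem. The equation is checked in twice integrated form against every
eigenfunction; its right side is the double integral of a continuous V_{-γ}-valued function, so the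
Caputo derivative exists and is F - Au. Conversely, the C¹ regularity of a weak solution removes the
boundary terms at 0, so each of its coefficients satisfies the same scalar identity and must be the
corresponding mode. -/

/-! ### Hankel's contour integral for the reciprocal Gamma function -/

theorem integrableOn_exp_neg_exp_Ioi {c : ℝ} (hc : c < 0) (a ρ : ℝ) :
    IntegrableOn (fun x : ℝ => Real.exp (Real.exp x * c + a * x)) (Set.Ioi ρ) := by
  -- The double exponential beats every exponential: e^y ≥ y^n/n! at y = -c e^x bounds the integrand
  -- by a multiple of e^{(a-n)x}, integrable since n > a.
  obtain ⟨n, hn⟩ := exists_nat_gt a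
  have h1 : IntegrableOn (fun x : ℝ => (n.factorial / (-c) ^ n) * Real.exp ((a - n) * x))
      (Set.Ioi ρ) := (integrableOn_exp_mul_Ioi (by linarith) ρ).const_mul _
  refine h1.mono' (by fun_prop) (Eventually.of_forall fun x => ?_)
  rw [Real.norm_of_nonneg (Real.exp_pos _).le]
  have h2 := Real.pow_div_factorial_le_exp (x := Real.exp x * (-c))
    (mul_nonneg (Real.exp_pos x).le (by linarith)) n
  have hf : (0 : ℝ) < n.factorial := by positivity
  have hcn : 0 < (-c) ^ n := pow_pos (by linarith) n
  have h3 : Real.exp (Real.exp x * c) ≤ n.factorial / (-c) ^ n * Real.exp (-(n * x)) := by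
    rw [show Real.exp x * c = -(Real.exp x * (-c)) by ring, Real.exp_neg, Real.exp_neg]
    rw [inv_le_comm₀ (Real.exp_pos _) (by positivity)]
    refine le_trans (le_of_eq ?_) h2
    rw [mul_pow, ← Real.exp_nat_mul]
    field_simp
  calc Real.exp (Real.exp x * c + a * x) = Real.exp (Real.exp x * c) * Real.exp (a * x) :=
        Real.exp_add _ _
    _ ≤ (n.factorial / (-c) ^ n * Real.exp (-(n * x))) * Real.exp (a * x) := by gcongr
    _ = _ := by rw [mul_assoc, ← Real.exp_add]; ring_nf

theorem integrable_exp_neg_exp {c : ℝ} (hc : c < 0) {a : ℝ} (ha : 0 < a) :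
    Integrable (fun x : ℝ => Real.exp (Real.exp x * c + a * x)) := by
  rw [← integrableOn_univ, ← Set.Iic_union_Ioi (a := (0 : ℝ))]
  refine IntegrableOn.union ?_ (integrableOn_exp_neg_exp_Ioi hc a 0)
  refine (integrableOn_exp_mul_Iic ha 0).mono' (by fun_prop) (Eventually.of_forall fun x => ?_)
  rw [Real.norm_of_nonneg (Real.exp_pos _).le]
  exact Real.exp_le_exp.2 (by nlinarith [Real.exp_pos x])

theorem tendsto_exp_neg_exp_atTop {c : ℝ} (hc : c < 0) (a : ℝ) :
    Tendsto (fun x : ℝ => Real.exp (Real.exp x * c + a * x)) atTop (𝓝 0) := by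
  rw [Real.tendsto_exp_comp_nhds_zero]
  have h1 : Tendsto (fun x : ℝ => Real.exp x / x ^ 1) atTop atTop := Real.tendsto_exp_div_pow_atTop 1
  have h2 : Tendsto (fun x : ℝ => x * (Real.exp x / x ^ 1 * c + a)) atTop atBot :=
    tendsto_id.atTop_mul_atBot₀ (tendsto_atBot_add_const_right _ _ (h1.atTop_mul_const_of_neg hc))
  refine h2.congr' ?_
  filter_upwards [eventually_gt_atTop 0] with x hx
  field_simp

theorem tendsto_exp_exp_atBot (c : ℝ) {a : ℝ} (ha : 0 < a) :
    Tendsto (fun x : ℝ => Real.exp (Real.exp x * c + a * x)) atBot (𝓝 0) := by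
  rw [Real.tendsto_exp_comp_nhds_zero]
  have h1 : Tendsto (fun x : ℝ => Real.exp x * c) atBot (𝓝 (0 * c)) :=
    Real.tendsto_exp_atBot.mul_const c
  exact h1.add_atBot (tendsto_id.const_mul_atBot ha)

/-- The Hankel contour integral in the logarithmic variable, for the contour made of the two
half-lines `Im ζ = ± θ`, `Re ζ > ρ` and the segment of `Re ζ = ρ` between them. -/
def hankel (θ ρ : ℝ) (G : ℂ → ℂ) : ℂ :=
  (∫ x in Set.Ioi ρ, G (x + θ * Complex.I)) - (∫ x in Set.Ioi ρ, G (x + (-θ : ℝ) * Complex.I)) +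
    Complex.I * ∫ y in (-θ)..θ, G (ρ + y * Complex.I)

/-- Cauchy's theorem on the rectangle between the two vertical segments; the half-lines differ by
its horizontal sides. -/
theorem hankel_eq_of_le {θ ρ₁ ρ₂ : ℝ} (hρ : ρ₁ ≤ ρ₂) {G : ℂ → ℂ} (hθ : 0 ≤ θ)
    (hG : ∀ ζ : ℂ, |ζ.im| ≤ θ → DifferentiableAt ℂ G ζ)
    (h₁ : IntegrableOn (fun x : ℝ => G (x + θ * Complex.I)) (Set.Ioi ρ₁))
    (h₂ : IntegrableOn (fun x : ℝ => G (x + (-θ : ℝ) * Complex.I)) (Set.Ioi ρ₁)) :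
    hankel θ ρ₁ G = hankel θ ρ₂ G := by
  have key := Complex.integral_boundary_rect_eq_zero_of_differentiableOn G
    (ρ₁ + (-θ : ℝ) * Complex.I) (ρ₂ + θ * Complex.I) (fun ζ hζ => by
      refine (hG ζ ?_).differentiableWithinAt
      have := hζ.2
      simp only [Set.mem_preimage] at this
      have h3 : -θ ≤ θ := by linarith
      simp [Set.uIcc_of_le h3] at this
      exact abs_le.2 this)
  simp only [Complex.add_re, Complex.ofReal_re, Complex.mul_re, Complex.I_re, mul_zero,
    Complex.ofReal_im, Complex.I_im, mul_one, sub_self, add_zero, Complex.add_im, Complex.mul_im,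
    zero_add, smul_eq_mul] at key
  have e₁ := intervalIntegral.integral_Ioi_sub_Ioi h₁ hρ
  have e₂ := intervalIntegral.integral_Ioi_sub_Ioi h₂ hρ
  rw [hankel, hankel]
  linear_combination e₁ - e₂ - key

/-- The three primitives cancel at the corners ρ ± iθ, and the ends at infinity contribute nothing.
-/
theorem hankel_deriv_eq_zero {θ ρ : ℝ} {G H : ℂ → ℂ} (hH : ∀ ζ, HasDerivAt H (G ζ) ζ)
    (hGc : Continuous G)
    (h₁ : IntegrableOn (fun x : ℝ => G (x + θ * Complex.I)) (Set.Ioi ρ))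
    (h₂ : IntegrableOn (fun x : ℝ => G (x + (-θ : ℝ) * Complex.I)) (Set.Ioi ρ))
    (t₁ : Tendsto (fun x : ℝ => H (x + θ * Complex.I)) atTop (𝓝 0))
    (t₂ : Tendsto (fun x : ℝ => H (x + (-θ : ℝ) * Complex.I)) atTop (𝓝 0)) :
    hankel θ ρ G = 0 := by
  have d : ∀ (y x : ℝ), HasDerivAt (fun x : ℝ => H (x + y * Complex.I)) (G (x + y * Complex.I)) x := by
    intro y x
    have h := (hH (x + y * Complex.I)).comp (x : ℂ)
      ((hasDerivAt_id (x : ℂ)).add_const (y * Complex.I))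
    simpa using h.comp_ofReal
  have d' : ∀ (y : ℝ), HasDerivAt (fun y : ℝ => H (ρ + y * Complex.I))
      (Complex.I * G (ρ + y * Complex.I)) y := by
    intro y
    have h := (hH (ρ + y * Complex.I)).comp (y : ℂ)
      (((hasDerivAt_id (y : ℂ)).mul_const Complex.I).const_add (ρ : ℂ))
    simpa [mul_comm] using h.comp_ofReal
  have e₁ := integral_Ioi_of_hasDerivAt_of_tendsto' (fun x _ => d θ x) h₁ t₁
  have e₂ := integral_Ioi_of_hasDerivAt_of_tendsto' (fun x _ => d (-θ) x) h₂ t₂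
  have e₃ := intervalIntegral.integral_eq_sub_of_hasDerivAt (a := -θ) (b := θ) (fun y _ => d' y)
    (Continuous.intervalIntegrable (by fun_prop) _ _)
  rw [intervalIntegral.integral_const_mul] at e₃
  rw [hankel, e₁, e₂, e₃]
  ring

/-- The integrand `exp(s) s^{-β} ds` in the variable `ζ = log s`. -/
def hankelExp (β : ℝ) (ζ : ℂ) : ℂ := Complex.exp (Complex.exp ζ + (1 - β : ℝ) * ζ)

theorem norm_hankelExp (β x y : ℝ) :
    ‖hankelExp β (x + y * Complex.I)‖ = Real.exp (Real.exp x * Real.cos y + (1 - β) * x) := by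
  rw [hankelExp, Complex.norm_exp]
  simp [Complex.exp_re]

theorem continuous_hankelExp (β : ℝ) : Continuous (hankelExp β) := by
  unfold hankelExp; fun_prop

theorem differentiable_hankelExp (β : ℝ) : Differentiable ℂ (hankelExp β) := by
  unfold hankelExp; fun_prop

theorem cos_neg_of_hankel {θ : ℝ} (h₁ : Real.pi / 2 < θ) (h₂ : θ < Real.pi) : Real.cos θ < 0 :=
  Real.cos_neg_of_pi_div_two_lt_of_lt h₁ (by linarith [Real.pi_pos])

theorem integrableOn_hankelExp {y : ℝ} (hy : Real.cos y < 0) (β ρ : ℝ) :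
    IntegrableOn (fun x : ℝ => hankelExp β (x + y * Complex.I)) (Set.Ioi ρ) := by
  refine (integrableOn_exp_neg_exp_Ioi hy (1 - β) ρ).mono' ?_
    (Eventually.of_forall fun x => (norm_hankelExp β x y).le)
  exact (Continuous.aestronglyMeasurable (by have := continuous_hankelExp β; fun_prop))

/-- Integration by parts: the derivative of `hankelExp (β + 1)` is `hankelExp β - β * hankelExp (β +
1)`, and a derivative integrates to zero. This is the functional equation of 1/Γ. -/
theorem hankel_hankelExp_recurrence {θ : ℝ} (hθ : Real.cos θ < 0) (β ρ : ℝ) :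
    hankel θ ρ (hankelExp β) = β * hankel θ ρ (hankelExp (β + 1)) := by
  have hθ' : Real.cos (-θ) < 0 := by rwa [Real.cos_neg]
  have h := hankel_deriv_eq_zero (θ := θ) (ρ := ρ) (H := hankelExp (β + 1))
    (G := fun ζ => hankelExp β ζ - β * hankelExp (β + 1) ζ) (fun ζ => by
      have h1 : HasDerivAt (hankelExp (β + 1)) (Complex.exp (Complex.exp ζ + (1 - (β + 1) : ℝ) * ζ) *
          (Complex.exp ζ + (1 - (β + 1) : ℝ) * 1)) ζ :=
        ((Complex.hasDerivAt_exp ζ).add ((hasDerivAt_id ζ).const_mul _)).cexp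
      convert h1 using 1
      rw [hankelExp, hankelExp, mul_add, ← Complex.exp_add]
      push_cast
      ring_nf)
    (by have := continuous_hankelExp β; have := continuous_hankelExp (β + 1); fun_prop)
    ((integrableOn_hankelExp hθ _ _).sub ((integrableOn_hankelExp hθ _ _).const_mul _))
    ((integrableOn_hankelExp hθ' _ _).sub ((integrableOn_hankelExp hθ' _ _).const_mul _))
    (by
      rw [tendsto_zero_iff_norm_tendsto_zero]
      simp_rw [norm_hankelExp]
      exact tendsto_exp_neg_exp_atTop hθ _)
    (by
      rw [tendsto_zero_iff_norm_tendsto_zero]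
      simp_rw [norm_hankelExp]
      exact tendsto_exp_neg_exp_atTop hθ' _)
  rw [hankel, integral_sub (integrableOn_hankelExp hθ _ _)
    ((integrableOn_hankelExp hθ _ _).const_mul _), integral_sub (integrableOn_hankelExp hθ' _ _)
    ((integrableOn_hankelExp hθ' _ _).const_mul _), intervalIntegral.integral_sub
    (Continuous.intervalIntegrable (by have := continuous_hankelExp β; fun_prop) _ _)
    (Continuous.intervalIntegrable (by have := continuous_hankelExp (β + 1); fun_prop) _ _),
    integral_const_mul, integral_const_mul, intervalIntegral.integral_const_mul] at h
  rw [hankel, hankel]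
  linear_combination h

theorem norm_exp_neg_exp_add (a x y : ℝ) :
    ‖Complex.exp (-Complex.exp (x + y * Complex.I) + a * (x + y * Complex.I))‖ =
      Real.exp (Real.exp x * (-Real.cos y) + a * x) := by
  rw [Complex.norm_exp]
  simp [Complex.exp_re]

theorem integral_exp_neg_exp_eq_Gamma {a : ℝ} (ha : 0 < a) :
    ∫ x : ℝ, Complex.exp (-Complex.exp (x : ℂ) + a * x) = Real.Gamma a := by
  have h1 : ∀ x : ℝ, Complex.exp (-Complex.exp (x : ℂ) + a * x) =
      ((Real.exp (-Real.exp x + a * x) : ℝ) : ℂ) := fun x => by push_cast; rfl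
  simp_rw [h1]
  rw [integral_complex_ofReal, Real.Gamma_eq_integral ha]
  congr 1
  have h2 := integral_image_eq_integral_abs_deriv_smul (s := Set.univ) MeasurableSet.univ
    (fun x _ => (Real.hasDerivAt_exp x).hasDerivWithinAt) Real.exp_injective.injOn
    (fun x => Real.exp (-x) * x ^ (a - 1))
  rw [Set.image_univ, Real.range_exp, setIntegral_univ] at h2
  rw [h2]
  refine integral_congr_ae (Eventually.of_forall fun x => ?_)
  simp only [smul_eq_mul, abs_of_pos (Real.exp_pos x)]
  rw [← Real.exp_mul, ← Real.exp_add, ← Real.exp_add]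
  ring_nf

/-- Shifting the line by iψ is rotating the ray of Euler's integral. For |ψ| < π/2 the cosine stays
at least cos ψ > 0 between the two lines, so the vertical sides of the rectangle vanish at both
ends. -/
theorem integral_exp_neg_exp_rotate {a ψ : ℝ} (ha : 0 < a) (hψ : |ψ| < Real.pi / 2) :
    ∫ x : ℝ, Complex.exp (-Complex.exp (x + ψ * Complex.I) + a * (x + ψ * Complex.I)) =
      Real.Gamma a := by
  set g : ℂ → ℂ := fun ζ => Complex.exp (-Complex.exp ζ + a * ζ) with hg
  have hgc : Continuous g := by rw [hg]; fun_prop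
  have hgd : Differentiable ℂ g := by rw [hg]; fun_prop
  have hcos : ∀ y : ℝ, |y| ≤ |ψ| → Real.cos ψ ≤ Real.cos y := fun y hy => by
    rw [← Real.cos_abs ψ, ← Real.cos_abs y]
    exact Real.cos_le_cos_of_nonneg_of_le_pi (abs_nonneg _) (by linarith [Real.pi_pos]) hy
  have hcosp : 0 < Real.cos ψ := Real.cos_pos_of_mem_Ioo (abs_lt.1 hψ)
  have hinteg : ∀ y : ℝ, |y| ≤ |ψ| → Integrable (fun x : ℝ => g (x + y * Complex.I)) := fun y hy =>
    (integrable_exp_neg_exp (by linarith [hcos y hy] : -Real.cos y < 0) ha).mono'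
      (Continuous.aestronglyMeasurable (by fun_prop))
      (Eventually.of_forall fun x => (norm_exp_neg_exp_add a x y).le)
  have hv : ∀ x : ℝ, ‖Complex.I * ∫ y in (0 : ℝ)..ψ, g (x + y * Complex.I)‖ ≤
      Real.exp (Real.exp x * (-Real.cos ψ) + a * x) * |ψ| := fun x => by
    rw [norm_mul, Complex.norm_I, one_mul]
    have := intervalIntegral.norm_integral_le_of_norm_le_const (a := 0) (b := ψ)
      (f := fun y : ℝ => g (x + y * Complex.I))
      (C := Real.exp (Real.exp x * (-Real.cos ψ) + a * x)) (fun y hy => by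
        rw [hg, norm_exp_neg_exp_add]
        have h0 : |y| ≤ |ψ| := by
          rcases le_total 0 ψ with h | h
          · rw [Set.uIoc_of_le h] at hy
            rw [abs_of_pos hy.1, abs_of_nonneg h]; exact hy.2
          · rw [Set.uIoc_of_ge h] at hy
            rw [abs_of_nonpos hy.2, abs_of_nonpos h]; linarith [hy.1]
        have := hcos y h0
        gcongr)
    simpa using this
  have hv₁ : Tendsto (fun x : ℝ => Complex.I * ∫ y in (0 : ℝ)..ψ, g (x + y * Complex.I)) atTop
      (𝓝 0) := by
    refine squeeze_zero_norm hv ?_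
    simpa using (tendsto_exp_neg_exp_atTop (by linarith : -Real.cos ψ < 0) a).mul_const |ψ|
  have hv₂ : Tendsto (fun x : ℝ => Complex.I * ∫ y in (0 : ℝ)..ψ, g (x + y * Complex.I)) atBot
      (𝓝 0) := by
    refine squeeze_zero_norm hv ?_
    simpa using (tendsto_exp_exp_atBot (-Real.cos ψ) ha).mul_const |ψ|
  have hr : ∀ N : ℝ, (∫ x in (-N)..N, g (x + (0 : ℝ) * Complex.I)) -
      (∫ x in (-N)..N, g (x + ψ * Complex.I)) +
      Complex.I * (∫ y in (0 : ℝ)..ψ, g (N + y * Complex.I)) -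
      Complex.I * (∫ y in (0 : ℝ)..ψ, g ((-N : ℝ) + y * Complex.I)) = 0 := fun N => by
    have := Complex.integral_boundary_rect_eq_zero_of_differentiableOn g
      (((-N : ℝ) : ℂ) + (0 : ℝ) * Complex.I) (N + ψ * Complex.I) hgd.differentiableOn
    simpa only [Complex.add_re, Complex.ofReal_re, Complex.mul_re, Complex.I_re, mul_zero,
      Complex.ofReal_im, Complex.I_im, mul_one, sub_self, add_zero, Complex.add_im, Complex.mul_im,
      zero_add, smul_eq_mul] using this
  have l₁ := intervalIntegral_tendsto_integral (hinteg 0 (by simp)) tendsto_neg_atTop_atBot tendsto_id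
  have l₂ := intervalIntegral_tendsto_integral (hinteg ψ le_rfl) tendsto_neg_atTop_atBot tendsto_id
  have l := ((l₁.sub l₂).add hv₁).sub (hv₂.comp tendsto_neg_atTop_atBot)
  have l' := tendsto_nhds_unique (l.congr (fun N => by simpa using hr N)) tendsto_const_nhds
  have e := integral_exp_neg_exp_eq_Gamma ha
  have e' : ∫ x : ℝ, g (x + (0 : ℝ) * Complex.I) = Real.Gamma a := by
    rw [← e]; simp [hg]
  rw [e'] at l'
  change ∫ x : ℝ, g (x + ψ * Complex.I) = _
  linear_combination -l'

/-- A shift by n with e^{in} = -1 turns exp(e^ζ) into exp(-e^ζ), at the price of a phase. With n =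
±π each half-line becomes a rotated Euler integral for Γ(1-β). -/
theorem hankelExp_eq_rotate (β x θ ψ : ℝ) {n : ℂ} (hn : (θ : ℂ) = ψ + n)
    (h : Complex.exp (n * Complex.I) = -1) :
    hankelExp β (x + θ * Complex.I) = Complex.exp ((1 - β : ℝ) * (n * Complex.I)) *
      Complex.exp (-Complex.exp (x + ψ * Complex.I) + (1 - β : ℝ) * (x + ψ * Complex.I)) := by
  rw [hankelExp, ← Complex.exp_add, hn]
  congr 1
  rw [show (x : ℂ) + (ψ + n) * Complex.I = (x + ψ * Complex.I) + n * Complex.I by ring,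
    Complex.exp_add (x + ψ * Complex.I), h]
  ring

/-- The integral does not depend on ρ, so ρ may tend to -∞. As 1-β > 0, the segment disappears and
the half-lines become full lines, each a phase e^{±iπ(1-β)} times Γ(1-β). The phases differ by 2i
sin(πβ), and the reflection formula concludes. -/
theorem hankel_hankelExp_of_lt_one {θ β : ℝ} (h₁ : Real.pi / 2 < θ) (h₂ : θ < Real.pi) (hβ : β < 1)
    (hβ0 : 0 < β) (ρ : ℝ) :
    hankel θ ρ (hankelExp β) = 2 * Real.pi * Complex.I * ((Real.Gamma β)⁻¹ : ℝ) := by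
  have ha : 0 < 1 - β := by linarith
  have hθ : Real.cos θ < 0 := cos_neg_of_hankel h₁ h₂
  have hθ' : Real.cos (-θ) < 0 := by rwa [Real.cos_neg]
  have hinteg : ∀ y : ℝ, Real.cos y < 0 → Integrable (fun x : ℝ => hankelExp β (x + y * Complex.I)) :=
    fun y hy => (integrable_exp_neg_exp hy ha).mono'
      (Continuous.aestronglyMeasurable (by have := continuous_hankelExp β; fun_prop))
      (Eventually.of_forall fun x => (norm_hankelExp β x y).le)
  have hconst : ∀ ρ' : ℝ, hankel θ ρ' (hankelExp β) = hankel θ ρ (hankelExp β) := by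
    have : ∀ ρ₁ ρ₂ : ℝ, ρ₁ ≤ ρ₂ → hankel θ ρ₁ (hankelExp β) = hankel θ ρ₂ (hankelExp β) :=
      fun ρ₁ ρ₂ h => hankel_eq_of_le h (by linarith [Real.pi_pos])
        (fun ζ _ => differentiable_hankelExp β ζ) (integrableOn_hankelExp hθ _ _)
        (integrableOn_hankelExp hθ' _ _)
    intro ρ'
    rcases le_total ρ' ρ with h | h
    · exact this _ _ h
    · exact (this _ _ h).symm
  have hlim : ∀ y : ℝ, Real.cos y < 0 → Tendsto (fun ρ' : ℝ => ∫ x in Set.Ioi ρ',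
      hankelExp β (x + y * Complex.I)) atBot (𝓝 (∫ x : ℝ, hankelExp β (x + y * Complex.I))) :=
    fun y hy => (aecover_Ioi (μ := volume) (tendsto_id (x := atBot) (α := ℝ))).integral_tendsto_of_countably_generated
      (hinteg y hy)
  have hseg : Tendsto (fun ρ' : ℝ => Complex.I * ∫ y in (-θ)..θ, hankelExp β (ρ' + y * Complex.I))
      atBot (𝓝 0) := by
    refine squeeze_zero_norm (a := fun ρ' : ℝ => Real.exp (Real.exp ρ' * 1 + (1 - β) * ρ') * |θ - -θ|)
      (fun ρ' => ?_) ?_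
    · rw [norm_mul, Complex.norm_I, one_mul]
      refine intervalIntegral.norm_integral_le_of_norm_le_const fun y _ => ?_
      rw [norm_hankelExp]
      have := Real.cos_le_one y
      gcongr
    · simpa using (tendsto_exp_exp_atBot 1 ha).mul_const |θ - -θ|
  have l := ((hlim θ hθ).sub (hlim (-θ) hθ')).add hseg
  have l' := tendsto_nhds_unique (tendsto_const_nhds.congr (fun ρ' => (hconst ρ').symm)) l
  rw [l', add_zero]
  have e₁ : ∀ x : ℝ, _ := fun x => hankelExp_eq_rotate β x θ (θ - Real.pi) (n := Real.pi)
    (by push_cast; ring) Complex.exp_pi_mul_I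
  have e₂ : ∀ x : ℝ, _ := fun x => hankelExp_eq_rotate β x (-θ) (Real.pi - θ) (n := -Real.pi)
    (by push_cast; ring) (by rw [neg_mul, Complex.exp_neg, Complex.exp_pi_mul_I]; norm_num)
  simp_rw [e₁, e₂]
  rw [integral_const_mul, integral_const_mul, integral_exp_neg_exp_rotate ha
    (by rw [abs_lt]; constructor <;> linarith), integral_exp_neg_exp_rotate ha
    (by rw [abs_lt]; constructor <;> linarith)]
  have hrefl := Real.Gamma_mul_Gamma_one_sub β
  have hG : Real.Gamma β ≠ 0 := (Real.Gamma_pos_of_pos hβ0).ne'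
  have hsin : Real.sin (Real.pi * β) ≠ 0 := (Real.sin_pos_of_pos_of_lt_pi
    (by have := Real.pi_pos; positivity) (by nlinarith [Real.pi_pos])).ne'
  have hsin2 : Complex.exp ((1 - β : ℝ) * (Real.pi * Complex.I)) -
      Complex.exp ((1 - β : ℝ) * (-Real.pi * Complex.I)) =
      2 * Complex.I * (Real.sin (Real.pi * β) : ℝ) := by
    have h3 : Real.sin (Real.pi * β) = Real.sin ((1 - β) * Real.pi) := by
      rw [← Real.sin_pi_sub]; ring_nf
    rw [h3, Complex.ofReal_sin, Complex.sin]
    rw [show ((1 - β : ℝ) : ℂ) * (-Real.pi * Complex.I) =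
      -(((1 - β) * Real.pi : ℝ) : ℂ) * Complex.I by push_cast; ring,
      show ((1 - β : ℝ) : ℂ) * (Real.pi * Complex.I) =
      (((1 - β) * Real.pi : ℝ) : ℂ) * Complex.I by push_cast; ring]
    have := Complex.I_sq
    linear_combination (Complex.exp (-(((1 - β) * Real.pi : ℝ) : ℂ) * Complex.I) -
      Complex.exp ((((1 - β) * Real.pi : ℝ) : ℂ) * Complex.I)) * (-this)
  rw [← sub_mul, hsin2]
  have h4 : Real.sin (Real.pi * β) * Real.Gamma (1 - β) = Real.pi * (Real.Gamma β)⁻¹ := by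
    rw [eq_div_iff hsin] at hrefl
    rw [eq_mul_inv_iff_mul_eq₀ hG]
    linear_combination hrefl
  have h5 : ((Real.sin (Real.pi * β) : ℝ) : ℂ) * (Real.Gamma (1 - β) : ℝ) =
      Real.pi * ((Real.Gamma β)⁻¹ : ℝ) := by exact_mod_cast h4
  linear_combination 2 * Complex.I * h5

/-- The limiting case, which the argument with Γ(1-β) does not reach: both sides are continuous in
β, and β tends to 1 from below. With ρ = 0 one has x > 0, so (1-β)x ≤ x gives an integrable majorant
for all β > 0. -/
theorem hankel_hankelExp_one {θ : ℝ} (h₁ : Real.pi / 2 < θ) (h₂ : θ < Real.pi) :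
    hankel θ 0 (hankelExp 1) = 2 * Real.pi * Complex.I := by
  have hθ : Real.cos θ < 0 := cos_neg_of_hankel h₁ h₂
  have hθ' : Real.cos (-θ) < 0 := by rwa [Real.cos_neg]
  have hc : Continuous (fun p : ℝ × ℂ => hankelExp p.1 p.2) := by unfold hankelExp; fun_prop
  have hh : ∀ y : ℝ, Real.cos y < 0 → ContinuousAt (fun β : ℝ => ∫ x in Set.Ioi (0 : ℝ),
      hankelExp β (x + y * Complex.I)) 1 := fun y hy => by
    refine continuousAt_of_dominated
      (bound := fun x : ℝ => Real.exp (Real.exp x * Real.cos y + 1 * x)) ?_ ?_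
      (integrableOn_exp_neg_exp_Ioi hy 1 0) ?_
    · exact Eventually.of_forall fun β => (integrableOn_hankelExp hy β 0).aestronglyMeasurable
    · filter_upwards [eventually_gt_nhds (zero_lt_one : (0 : ℝ) < 1)] with β hβ
      filter_upwards [self_mem_ae_restrict measurableSet_Ioi] with x hx
      rw [norm_hankelExp]
      have : (0 : ℝ) < x := hx
      gcongr
      linarith
    · exact Eventually.of_forall fun x => (hc.comp (Continuous.prodMk_left _)).continuousAt
  have hs : Continuous (fun β : ℝ => ∫ y in (-θ)..θ, hankelExp β ((0 : ℝ) + y * Complex.I)) :=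
    intervalIntegral.continuous_parametric_intervalIntegral_of_continuous'
      (by exact hc.comp (continuous_fst.prodMk (by fun_prop))) _ _
  have hcont : ContinuousAt (fun β : ℝ => hankel θ 0 (hankelExp β)) 1 :=
    ((hh θ hθ).sub (hh (-θ) hθ')).add (continuousAt_const.mul hs.continuousAt)
  have l₁ : Tendsto (fun β : ℝ => hankel θ 0 (hankelExp β)) (𝓝[<] 1)
    (𝓝 (hankel θ 0 (hankelExp 1))) := hcont.tendsto.mono_left nhdsWithin_le_nhds
  have hG : ContinuousAt (fun β : ℝ => 2 * Real.pi * Complex.I * ((Real.Gamma β)⁻¹ : ℝ)) 1 := by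
    have : ContinuousAt Real.Gamma 1 := (Real.differentiableAt_Gamma (fun m => by
      have : (0 : ℝ) ≤ m := m.cast_nonneg
      linarith)).continuousAt
    have h3 : ContinuousAt (fun β : ℝ => (Real.Gamma β)⁻¹) 1 := this.inv₀ (by simp)
    exact continuousAt_const.mul (Complex.continuous_ofReal.continuousAt.comp h3)
  have l₂ : Tendsto (fun β : ℝ => hankel θ 0 (hankelExp β)) (𝓝[<] 1)
      (𝓝 (2 * Real.pi * Complex.I * ((Real.Gamma 1)⁻¹ : ℝ))) := by
    refine (hG.tendsto.mono_left nhdsWithin_le_nhds).congr' ?_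
    filter_upwards [Ioo_mem_nhdsLT (zero_lt_one : (0 : ℝ) < 1)] with β hβ
    exact (hankel_hankelExp_of_lt_one h₁ h₂ hβ.2 hβ.1 0).symm
  simpa using tendsto_nhds_unique l₁ l₂

/-- Hankel's formula for the reciprocal of the Gamma function. -/
theorem hankel_hankelExp {θ β : ℝ} (h₁ : Real.pi / 2 < θ) (h₂ : θ < Real.pi) (hβ : 0 < β) (ρ : ℝ) :
    hankel θ ρ (hankelExp β) = 2 * Real.pi * Complex.I * ((Real.Gamma β)⁻¹ : ℝ) := by
  have hθ : Real.cos θ < 0 := cos_neg_of_hankel h₁ h₂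
  have hθ' : Real.cos (-θ) < 0 := by rwa [Real.cos_neg]
  -- Both sides satisfy the same recurrence in b, so the formula on (0,1] extends one unit at a
  -- time.
  have hind : ∀ n : ℕ, ∀ b : ℝ, 0 < b → b ≤ n + 1 →
      hankel θ 0 (hankelExp b) = 2 * Real.pi * Complex.I * ((Real.Gamma b)⁻¹ : ℝ) := by
    intro n
    induction n with
    | zero =>
      intro b hb hb1
      rcases eq_or_lt_of_le hb1 with h | h
      · rw [h]; simpa using hankel_hankelExp_one h₁ h₂
      · exact hankel_hankelExp_of_lt_one h₁ h₂ (by simpa using h) hb 0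
    | succ n ih =>
      intro b hb hb1
      rcases le_or_gt b 1 with h | h
      · exact ih b hb (by have : (0 : ℝ) ≤ n := n.cast_nonneg; linarith)
      · have hb' : 0 < b - 1 := by linarith
        have e := ih (b - 1) hb' (by push_cast at hb1; linarith)
        have r := hankel_hankelExp_recurrence hθ (b - 1) 0
        rw [sub_add_cancel] at r
        have g := Real.Gamma_add_one hb'.ne'
        rw [sub_add_cancel] at g
        have hne : ((b - 1 : ℝ) : ℂ) ≠ 0 := by exact_mod_cast hb'.ne'
        apply mul_left_cancel₀ hne
        rw [← r, e, g, mul_inv]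
        push_cast at hne ⊢
        field_simp
  have h0 : hankel θ 0 (hankelExp β) = _ := hind ⌈β⌉₊ β hβ (by linarith [Nat.le_ceil β])
  rw [← h0]
  have : ∀ ρ₁ ρ₂ : ℝ, ρ₁ ≤ ρ₂ → hankel θ ρ₁ (hankelExp β) = hankel θ ρ₂ (hankelExp β) :=
    fun ρ₁ ρ₂ h => hankel_eq_of_le h (by linarith [Real.pi_pos])
      (fun ζ _ => differentiable_hankelExp β ζ) (integrableOn_hankelExp hθ _ _)
      (integrableOn_hankelExp hθ' _ _)
  rcases le_total ρ 0 with h | h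
  · exact this _ _ h
  · exact (this _ _ h).symm

/-! ### The Mittag-Leffler series -/

/-- Restricting Euler's integral for Γ(x+1) to (R, ∞) gives Γ(x+1) ≥ R^x e^{-R}. As R is free, 1/Γ
decays faster than any geometric sequence. -/
theorem inv_Gamma_le {x R : ℝ} (hx : 0 < x) (hR : 0 < R) :
    (Real.Gamma x)⁻¹ ≤ x * (Real.exp R * R ^ (-x)) := by
  have h1 : R ^ x * Real.exp (-R) ≤ Real.Gamma (x + 1) := by
    rw [Real.Gamma_eq_integral (by linarith)]
    have hi : IntegrableOn (fun t : ℝ => Real.exp (-t) * t ^ (x + 1 - 1)) (Set.Ioi 0) :=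
      Real.GammaIntegral_convergent (by linarith)
    have h2 : ∫ t in Set.Ioi R, Real.exp (-t) * R ^ x ≤
        ∫ t in Set.Ioi R, Real.exp (-t) * t ^ (x + 1 - 1) := by
      refine setIntegral_mono_on ((integrableOn_exp_neg_Ioi R).mul_const _)
        (hi.mono_set (Set.Ioi_subset_Ioi hR.le)) measurableSet_Ioi fun t ht => ?_
      rw [add_sub_cancel_right]
      have : R ≤ t := le_of_lt ht
      gcongr
    have h3 : ∫ t in Set.Ioi R, Real.exp (-t) * t ^ (x + 1 - 1) ≤
        ∫ t in Set.Ioi (0 : ℝ), Real.exp (-t) * t ^ (x + 1 - 1) := by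
      refine setIntegral_mono_set hi ?_ (Set.Ioi_subset_Ioi hR.le).eventuallyLE
      filter_upwards [self_mem_ae_restrict measurableSet_Ioi] with t ht
      have : (0 : ℝ) < t := ht
      simp only [Pi.zero_apply]
      positivity
    rw [integral_mul_const, integral_exp_neg_Ioi] at h2
    linarith [mul_comm (R ^ x) (Real.exp (-R))]
  rw [Real.Gamma_add_one hx.ne'] at h1
  have hG := Real.Gamma_pos_of_pos hx
  rw [inv_le_iff_one_le_mul₀ hG]
  have h4 : (Real.exp R * R ^ (-x)) * (R ^ x * Real.exp (-R)) = 1 := by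
    rw [Real.rpow_neg hR.le, Real.exp_neg]
    have := (Real.rpow_pos_of_pos hR x).ne'
    field_simp
  calc 1 = (Real.exp R * R ^ (-x)) * (R ^ x * Real.exp (-R)) := h4.symm
    _ ≤ (Real.exp R * R ^ (-x)) * (x * Real.Gamma x) := by gcongr
    _ = _ := by ring

theorem summable_mittagLeffler_norm {a b : ℝ} (ha : 0 < a) (hb : 0 < b) (r : ℝ) :
    Summable fun n : ℕ => |r| ^ n * (Real.Gamma (a * n + b))⁻¹ := by
  -- R is chosen with R^a = M > |r|, so the terms are dominated by (a n + b) times a convergent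
  -- geometric sequence of ratio |r|/M.
  set M : ℝ := 2 * |r| + 1 with hM
  have hMpos : 0 < M := by positivity
  set R : ℝ := M ^ a⁻¹ with hRdef
  have hR : 0 < R := Real.rpow_pos_of_pos hMpos _
  have hRa : R ^ a = M := by
    rw [hRdef, ← Real.rpow_mul hMpos.le, inv_mul_cancel₀ ha.ne', Real.rpow_one]
  have hq : ‖|r| / M‖ < 1 := by
    rw [Real.norm_of_nonneg (by positivity), div_lt_one hMpos]
    have := abs_nonneg r
    linarith
  have s1 := (summable_geometric_of_norm_lt_one hq).mul_left (b * Real.exp R * R ^ (-b))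
  have s2 := (summable_pow_mul_geometric_of_norm_lt_one 1 hq).mul_left
    (a * Real.exp R * R ^ (-b))
  refine Summable.of_nonneg_of_le (fun n => ?_) (fun n => ?_) (s1.add s2)
  · have : 0 < a * n + b := by positivity
    have := Real.Gamma_pos_of_pos this
    positivity
  · have hp : 0 < a * n + b := by positivity
    have h1 := inv_Gamma_le hp hR
    have h2 : R ^ (-(a * n + b)) = (M ^ n)⁻¹ * R ^ (-b) := by
      rw [neg_add, Real.rpow_add hR, Real.rpow_neg hR.le, Real.rpow_mul hR.le, hRa,
        Real.rpow_natCast]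
    calc |r| ^ n * (Real.Gamma (a * n + b))⁻¹
        ≤ |r| ^ n * ((a * n + b) * (Real.exp R * R ^ (-(a * n + b)))) := by gcongr
      _ = _ := by rw [h2, div_pow]; field_simp; ring

theorem hasSum_mittagLeffler {a b : ℝ} (ha : 0 < a) (hb : 0 < b) (z : ℝ) :
    HasSum (fun n : ℕ => z ^ n / Real.Gamma (a * n + b)) (mittagLeffler a b z) := by
  refine Summable.hasSum ?_
  refine Summable.of_norm ((summable_mittagLeffler_norm ha hb z).congr fun n => ?_)
  have : 0 < a * n + b := by positivity
  rw [norm_div, norm_pow, Real.norm_eq_abs, Real.norm_of_nonneg (Real.Gamma_pos_of_pos this).le,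
    div_eq_mul_inv]

theorem abs_mittagLeffler_le {a b : ℝ} (ha : 0 < a) (hb : 0 < b) {z r : ℝ} (h : |z| ≤ r) :
    |mittagLeffler a b z| ≤ ∑' n : ℕ, r ^ n * (Real.Gamma (a * n + b))⁻¹ := by
  have hr : 0 ≤ r := (abs_nonneg z).trans h
  have s := summable_mittagLeffler_norm ha hb r
  rw [abs_of_nonneg hr] at s
  rw [← Real.norm_eq_abs]
  refine tsum_of_norm_bounded s.hasSum fun n => ?_
  have hp : 0 < a * n + b := by positivity
  have := Real.Gamma_pos_of_pos hp
  rw [norm_div, norm_pow, Real.norm_eq_abs, Real.norm_of_nonneg this.le, div_eq_mul_inv]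
  gcongr

theorem continuous_mittagLeffler {a b : ℝ} (ha : 0 < a) (hb : 0 < b) :
    Continuous (mittagLeffler a b) := by
  rw [continuous_iff_continuousAt]
  intro z
  have hc : ContinuousOn (mittagLeffler a b) (Metric.ball 0 (|z| + 1)) := by
    have s := summable_mittagLeffler_norm ha hb (|z| + 1)
    rw [abs_of_nonneg (by positivity)] at s
    refine continuousOn_tsum (fun n => by fun_prop) s fun n x hx => ?_
    have hp : 0 < a * n + b := by positivity
    have := Real.Gamma_pos_of_pos hp
    rw [norm_div, norm_pow, Real.norm_of_nonneg this.le, div_eq_mul_inv]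
    have : ‖x‖ ≤ |z| + 1 := by simpa using (mem_ball_zero_iff.1 hx).le
    gcongr
  exact hc.continuousAt (Metric.isOpen_ball.mem_nhds (by simp))

theorem mittagLeffler_zero (a b : ℝ) : mittagLeffler a b 0 = (Real.Gamma b)⁻¹ := by
  rw [mittagLeffler, tsum_eq_single 0 (fun n hn => by simp [hn])]
  simp

/-! ### Contour representation and decay of the Mittag-Leffler function -/

/-- The integrand of the contour integral for `E_{α,β}(-z)`, in the logarithmic variable. -/
def hankelML (α β z : ℝ) (ζ : ℂ) : ℂ := hankelExp β ζ / (1 + z * Complex.exp (-(α * ζ)))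

/-- Both bounds come from an imaginary part. Multiplied by e^{iαy} the denominator has imaginary
part sin(αy); unrotated it has -z e^{-αx} sin(αy). The first bound serves for integrability, the
second supplies the factor 1/z of the decay. -/
theorem sin_mul_le_norm {α z θ : ℝ} (hθ : 0 < Real.sin (α * θ)) (hz : 0 < z) (x : ℝ) {y : ℝ}
    (hy : y = θ ∨ y = -θ) :
    Real.sin (α * θ) ≤ ‖(1 : ℂ) + z * Complex.exp (-(α * (x + y * Complex.I)))‖ ∧
    z * Real.exp (-(α * x)) * Real.sin (α * θ) ≤
      ‖(1 : ℂ) + z * Complex.exp (-(α * (x + y * Complex.I)))‖ := by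
  have hs : |Real.sin (α * y)| = Real.sin (α * θ) := by
    rcases hy with rfl | rfl
    · exact abs_of_pos hθ
    · rw [mul_neg, Real.sin_neg, abs_neg, abs_of_pos hθ]
  set w : ℂ := (1 : ℂ) + z * Complex.exp (-(α * (x + y * Complex.I))) with hw
  constructor
  · have h1 : Complex.exp ((α * y : ℝ) * Complex.I) * w =
        Complex.exp ((α * y : ℝ) * Complex.I) + (z * Real.exp (-(α * x)) : ℝ) := by
      rw [hw, mul_add, mul_one, mul_left_comm, ← Complex.exp_add]
      push_cast
      ring_nf
    have h2 : (Complex.exp ((α * y : ℝ) * Complex.I) * w).im = Real.sin (α * y) := by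
      rw [h1, Complex.add_im, Complex.ofReal_im, add_zero, Complex.exp_ofReal_mul_I_im]
    have h3 := Complex.abs_im_le_norm (Complex.exp ((α * y : ℝ) * Complex.I) * w)
    rwa [h2, hs, norm_mul, Complex.norm_exp_ofReal_mul_I, one_mul] at h3
  · have h2 : w.im = -(z * Real.exp (-(α * x)) * Real.sin (α * y)) := by
      rw [hw]
      simp [Complex.exp_im]
      ring
    have h3 := Complex.abs_im_le_norm w
    rwa [h2, abs_neg, abs_mul, abs_of_pos (by positivity), hs] at h3

/-- A zero needs α Im ζ to be an odd multiple of π, while |α Im ζ| ≤ αθ < π: the strip contains no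
pole. -/
theorem hankelML_denom_ne_zero {α z θ : ℝ} (hα : 0 < α) (hθ : α * θ < Real.pi) (hz : 0 < z) {ζ : ℂ}
    (hζ : |ζ.im| ≤ θ) : (1 : ℂ) + z * Complex.exp (-(α * ζ)) ≠ 0 := by
  intro h
  have him := congrArg Complex.im h
  have hre := congrArg Complex.re h
  simp [Complex.exp_im, Complex.exp_re] at him hre
  have h2 : Real.sin (α * ζ.im) = 0 := by
    rcases him with h | h
    · exact absurd h hz.ne'
    · exact h
  have hab := abs_le.1 hζ
  have h3 : α * ζ.im = 0 := by
    rw [Real.sin_eq_zero_iff_of_lt_of_lt (by nlinarith) (by nlinarith)] at h2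
    exact h2
  rw [h3, Real.cos_zero] at hre
  have := mul_pos hz (Real.exp_pos (-(α * ζ.re)))
  linarith

theorem norm_hankelML_le {α β z θ : ℝ} (hθ : 0 < Real.sin (α * θ)) (hz : 0 < z) (x : ℝ) {y : ℝ}
    (hy : y = θ ∨ y = -θ) :
    ‖hankelML α β z (x + y * Complex.I)‖ ≤ (Real.sin (α * θ))⁻¹ *
        Real.exp (Real.exp x * Real.cos θ + (1 - β) * x) ∧
    ‖hankelML α β z (x + y * Complex.I)‖ ≤ (z * Real.sin (α * θ))⁻¹ *
        Real.exp (Real.exp x * Real.cos θ + (1 - β + α) * x) := by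
  obtain ⟨h1, h2⟩ := sin_mul_le_norm hθ hz x hy
  have hc : Real.cos y = Real.cos θ := by
    rcases hy with rfl | rfl
    · rfl
    · rw [Real.cos_neg]
  rw [hankelML, norm_div, norm_hankelExp, hc]
  constructor
  · rw [inv_mul_eq_div]
    gcongr
  · calc _ ≤ Real.exp (Real.exp x * Real.cos θ + (1 - β) * x) /
          (z * Real.exp (-(α * x)) * Real.sin (α * θ)) := by gcongr
      _ = _ := by
        rw [Real.exp_neg, show Real.exp x * Real.cos θ + (1 - β + α) * x =
          (Real.exp x * Real.cos θ + (1 - β) * x) + α * x by ring, Real.exp_add _ (α * x)]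
        field_simp

theorem measurable_hankelML (α β z y : ℝ) :
    Measurable fun x : ℝ => hankelML α β z (x + y * Complex.I) := by
  unfold hankelML
  have h1 : Continuous fun x : ℝ => hankelExp β (x + y * Complex.I) := by
    have := continuous_hankelExp β; fun_prop
  have h2 : Continuous fun x : ℝ => (1 : ℂ) + z * Complex.exp (-(α * (x + y * Complex.I))) := by
    fun_prop
  exact h1.measurable.div h2.measurable

theorem integrableOn_hankelML {α β z θ : ℝ} (hθ : 0 < Real.sin (α * θ)) (hc : Real.cos θ < 0)
    (hz : 0 < z) (ρ : ℝ) {y : ℝ} (hy : y = θ ∨ y = -θ) :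
    IntegrableOn (fun x : ℝ => hankelML α β z (x + y * Complex.I)) (Set.Ioi ρ) :=
  ((integrableOn_exp_neg_exp_Ioi hc (1 - β) ρ).const_mul _).mono'
    (measurable_hankelML α β z y).aestronglyMeasurable
    (Eventually.of_forall fun x => (norm_hankelML_le hθ hz x hy).1)

/-- Geometric series in -z e^{-αζ}; it converges only far enough to the right, hence the large ρ in
the termwise integrations. -/
theorem hasSum_hankelML {α β z : ℝ} {ζ : ℂ} (h : |z| * Real.exp (-(α * ζ.re)) < 1) :
    HasSum (fun n : ℕ => ((-z) ^ n : ℝ) * hankelExp (α * n + β) ζ) (hankelML α β z ζ) := by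
  have hn : ‖-(z * Complex.exp (-(α * ζ)))‖ < 1 := by
    rw [norm_neg, norm_mul, Complex.norm_exp]
    simpa using h
  have := (hasSum_geometric_of_norm_lt_one hn).mul_left (hankelExp β ζ)
  rw [sub_neg_eq_add, ← div_eq_mul_inv] at this
  refine this.congr_fun fun n => ?_
  rw [hankelExp, hankelExp, ← neg_mul, mul_pow, ← Complex.exp_nat_mul, mul_left_comm,
    ← Complex.exp_add]
  push_cast
  ring_nf

theorem norm_hankelExp_le_of_le {α β z θ ρ : ℝ} {x y : ℝ} (hα : 0 ≤ α) (hz : 0 ≤ z) (hx : ρ ≤ x)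
    (hy : Real.cos y ≤ Real.cos θ) (n : ℕ) :
    ‖((-z) ^ n : ℝ) * hankelExp (α * n + β) (x + y * Complex.I)‖ ≤
      (z * Real.exp (-(α * ρ))) ^ n * Real.exp (Real.exp x * Real.cos θ + (1 - β) * x) := by
  rw [norm_mul, norm_hankelExp, Complex.norm_real, norm_pow, norm_neg, Real.norm_of_nonneg hz,
    mul_pow, mul_assoc]
  gcongr
  rw [← Real.exp_nat_mul, ← Real.exp_add]
  apply Real.exp_le_exp.2
  have h1 : α * n * ρ ≤ α * n * x := by gcongr
  have h2 : Real.exp x * Real.cos y ≤ Real.exp x * Real.cos θ := by gcongr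
  nlinarith

theorem hasSum_integral_hankelML_Ioi {α β z ρ : ℝ} (hα : 0 ≤ α) (hz : 0 ≤ z)
    (h : z * Real.exp (-(α * ρ)) < 1) {y : ℝ} (hc : Real.cos y < 0) :
    HasSum (fun n : ℕ => ((-z) ^ n : ℝ) * ∫ x in Set.Ioi ρ, hankelExp (α * n + β) (x + y * Complex.I))
      (∫ x in Set.Ioi ρ, hankelML α β z (x + y * Complex.I)) := by
  have hI : ∀ n : ℕ, IntegrableOn (fun x : ℝ => ((-z) ^ n : ℝ) *
      hankelExp (α * n + β) (x + y * Complex.I)) (Set.Ioi ρ) := fun n =>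
    (integrableOn_hankelExp hc _ _).const_mul _
  have h0 := integrableOn_exp_neg_exp_Ioi hc (1 - β) ρ
  have hs : Summable fun n : ℕ => ∫ x in Set.Ioi ρ,
      ‖((-z) ^ n : ℝ) * hankelExp (α * n + β) (x + y * Complex.I)‖ := by
    refine Summable.of_nonneg_of_le (fun n => integral_nonneg fun x => norm_nonneg _) (fun n => ?_)
      ((summable_geometric_of_lt_one (by positivity) h).mul_right
        (∫ x in Set.Ioi ρ, Real.exp (Real.exp x * Real.cos y + (1 - β) * x)))
    rw [← integral_const_mul]
    refine setIntegral_mono_on (hI n).norm (h0.const_mul _) measurableSet_Ioi fun x hx => ?_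
    exact norm_hankelExp_le_of_le hα hz (le_of_lt hx) le_rfl n
  have key := hasSum_integral_of_summable_integral_norm hI hs
  simp_rw [integral_const_mul] at key
  have e : ∫ x in Set.Ioi ρ, ∑' n : ℕ, ((-z) ^ n : ℝ) * hankelExp (α * n + β) (x + y * Complex.I) =
      ∫ x in Set.Ioi ρ, hankelML α β z (x + y * Complex.I) := by
    refine setIntegral_congr_fun measurableSet_Ioi fun x hx => ?_
    refine (hasSum_hankelML ?_).tsum_eq
    rw [abs_of_nonneg hz]
    refine lt_of_le_of_lt ?_ h
    simp only [Complex.add_re, Complex.ofReal_re, Complex.mul_re, Complex.I_re, mul_zero,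
      Complex.ofReal_im, Complex.I_im, mul_one, sub_self, add_zero]
    have : ρ ≤ x := le_of_lt hx
    gcongr
  rwa [e] at key

theorem hasSum_integral_hankelML_segment {α β z θ ρ : ℝ} (hα : 0 ≤ α) (hz : 0 ≤ z)
    (h : z * Real.exp (-(α * ρ)) < 1) :
    HasSum (fun n : ℕ => ((-z) ^ n : ℝ) * ∫ y in (-θ)..θ, hankelExp (α * n + β) (ρ + y * Complex.I))
      (∫ y in (-θ)..θ, hankelML α β z (ρ + y * Complex.I)) := by
  simp_rw [← intervalIntegral.integral_const_mul]
  refine intervalIntegral.hasSum_integral_of_dominated_convergence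
    (fun n _ => (z * Real.exp (-(α * ρ))) ^ n * Real.exp (Real.exp ρ * Real.cos 0 + (1 - β) * ρ))
    (fun n => ?_) (fun n => Eventually.of_forall fun y _ => ?_)
    (Eventually.of_forall fun y _ => ?_) (by simp) (Eventually.of_forall fun y _ => ?_)
  · exact Continuous.aestronglyMeasurable (by have := continuous_hankelExp (α * n + β); fun_prop)
  · exact norm_hankelExp_le_of_le hα hz le_rfl (by simpa using Real.cos_le_one y) n
  · exact (summable_geometric_of_lt_one (by positivity) h).mul_right _
  · refine hasSum_hankelML ?_
    rw [abs_of_nonneg hz]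
    simpa using h

/-- For a large abscissa ρ' the geometric series is integrated term by term, and Hankel's formula
turns it into the Mittag-Leffler series. Since the strip is free of poles, Cauchy's theorem then
carries the identity back to any ρ. -/
theorem hankel_hankelML {α β z θ : ℝ} (hα : 0 < α) (hβ : 0 < β) (hz : 0 < z)
    (h₁ : Real.pi / 2 < θ) (h₂ : θ < Real.pi) (h₃ : α * θ < Real.pi) (ρ : ℝ) :
    hankel θ ρ (hankelML α β z) = 2 * Real.pi * Complex.I * (mittagLeffler α β (-z) : ℝ) := by
  have hc : Real.cos θ < 0 := cos_neg_of_hankel h₁ h₂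
  have hc' : Real.cos (-θ) < 0 := by rwa [Real.cos_neg]
  have hθ : 0 < θ := by linarith [Real.pi_pos]
  have hs : 0 < Real.sin (α * θ) := Real.sin_pos_of_pos_of_lt_pi (by positivity) h₃
  have hlim : Tendsto (fun ρ : ℝ => z * Real.exp (-(α * ρ))) atTop (𝓝 (z * 0)) := by
    refine Tendsto.const_mul z (Real.tendsto_exp_atBot.comp ?_)
    exact tendsto_neg_atTop_atBot.comp (tendsto_id.const_mul_atTop hα)
  rw [mul_zero] at hlim
  obtain ⟨ρ', hρ', hle⟩ := ((hlim.eventually_lt_const zero_lt_one).and (eventually_ge_atTop ρ)).exists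
  rw [hankel_eq_of_le (G := hankelML α β z) hle hθ.le (fun ζ hζ => ((differentiable_hankelExp β ζ).div (by fun_prop)
    (hankelML_denom_ne_zero hα h₃ hz hζ)))
    (integrableOn_hankelML hs hc hz ρ (Or.inl rfl)) (integrableOn_hankelML hs hc hz ρ (Or.inr rfl))]
  have k₁ := hasSum_integral_hankelML_Ioi (β := β) hα.le hz.le hρ' hc
  have k₂ := hasSum_integral_hankelML_Ioi (β := β) hα.le hz.le hρ' hc'
  have k₃ := hasSum_integral_hankelML_segment (θ := θ) (β := β) hα.le hz.le hρ'
  have k := (k₁.sub k₂).add (k₃.mul_left Complex.I)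
  have m : HasSum (fun n : ℕ => 2 * Real.pi * Complex.I *
      (((-z) ^ n / Real.Gamma (α * n + β) : ℝ) : ℂ))
      (2 * Real.pi * Complex.I * (mittagLeffler α β (-z) : ℝ)) :=
    (Complex.hasSum_ofReal.2 (hasSum_mittagLeffler hα hβ (-z))).mul_left _
  refine HasSum.unique (HasSum.congr_fun k fun n => ?_) m
  have hp : 0 < α * n + β := by positivity
  have hk := hankel_hankelExp h₁ h₂ hp ρ'
  rw [hankel] at hk
  rw [div_eq_mul_inv, Complex.ofReal_mul]
  linear_combination (-((-z) ^ n : ℝ) : ℂ) * hk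

/-- Decay of the Mittag-Leffler function `E_{α,β}` on the negative half-line for `1 < α < 2`. -/
theorem exists_mittagLeffler_bound {α β : ℝ} (hα : 1 < α) (hα2 : α < 2) (hβ : 0 < β)
    (hβα : β < α + 1) :
    ∃ C : ℝ, 0 < C ∧ ∀ x : ℝ, 0 ≤ x → |mittagLeffler α β (-x)| ≤ C / (1 + x) := by
  have hα0 : 0 < α := by linarith
  have hpi := Real.pi_pos
  -- θ > π/2 makes the integrand decay on the half-lines and αθ < π excludes poles; the two are
  -- compatible because α < 2.
  obtain ⟨θ, h₁, h₃⟩ : ∃ θ, Real.pi / 2 < θ ∧ θ < Real.pi / α :=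
    exists_between (by gcongr)
  have h₂ : θ < Real.pi := h₃.trans (by rw [div_lt_iff₀ hα0]; nlinarith)
  have h₃' : α * θ < Real.pi := by rw [lt_div_iff₀ hα0] at h₃; linarith
  have hc : Real.cos θ < 0 := cos_neg_of_hankel h₁ h₂
  have hθ : 0 < θ := by linarith
  have hs : 0 < Real.sin (α * θ) := Real.sin_pos_of_pos_of_lt_pi (by positivity) h₃'
  have hI := integrable_exp_neg_exp hc (by linarith : 0 < 1 - β + α)
  set M : ℝ := ∫ x : ℝ, Real.exp (Real.exp x * Real.cos θ + (1 - β + α) * x) with hM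
  have hM0 : 0 ≤ M := integral_nonneg fun x => (Real.exp_pos _).le
  -- Here ρ → -∞. The second bound on the denominator raises the exponent to 1-β+α, positive by
  -- `hβα`, so the half-lines are bounded by the full integral M and the segment vanishes.
  have big : ∀ z : ℝ, 0 < z → 2 * Real.pi * |mittagLeffler α β (-z)| ≤
      2 * ((z * Real.sin (α * θ))⁻¹ * M) := by
    intro z hz
    have hhor : ∀ (ρ y : ℝ), (y = θ ∨ y = -θ) → ‖∫ x in Set.Ioi ρ, hankelML α β z (x + y * Complex.I)‖ ≤
        (z * Real.sin (α * θ))⁻¹ * M := by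
      intro ρ y hy
      refine (norm_integral_le_of_norm_le (hI.integrableOn.const_mul _)
        (Eventually.of_forall fun x => (norm_hankelML_le hs hz x hy).2)).trans ?_
      rw [integral_const_mul]
      gcongr
      exact setIntegral_le_integral hI (Eventually.of_forall fun x => (Real.exp_pos _).le)
    have hseg : ∀ᶠ ρ : ℝ in atBot, ‖Complex.I * ∫ y in (-θ)..θ, hankelML α β z (ρ + y * Complex.I)‖ ≤
        (2 / z) * Real.exp (Real.exp ρ * 1 + (1 - β + α) * ρ) * |θ - -θ| := by
      have hl : Tendsto (fun ρ : ℝ => z * Real.exp (-(α * ρ))) atBot atTop := by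
        refine Tendsto.const_mul_atTop hz (Real.tendsto_exp_atTop.comp ?_)
        exact tendsto_neg_atBot_atTop.comp (tendsto_id.const_mul_atBot hα0)
      filter_upwards [hl.eventually_ge_atTop 2] with ρ hρ
      rw [norm_mul, Complex.norm_I, one_mul]
      refine intervalIntegral.norm_integral_le_of_norm_le_const fun y _ => ?_
      rw [hankelML, norm_div, norm_hankelExp]
      -- Once |w| ≥ 2, |1 + w| ≥ |w| - 1 ≥ |w|/2.
      have hd : z / 2 * Real.exp (-(α * ρ)) ≤
          ‖(1 : ℂ) + z * Complex.exp (-(α * (ρ + y * Complex.I)))‖ := by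
        have h5 := norm_sub_norm_le (z * Complex.exp (-(α * (ρ + y * Complex.I)))) (-1 : ℂ)
        have h6 : ‖z * Complex.exp (-(α * ((ρ : ℂ) + y * Complex.I)))‖ = z * Real.exp (-(α * ρ)) := by
          rw [norm_mul, Complex.norm_exp, Complex.norm_real, Real.norm_of_nonneg hz.le]
          simp
        rw [h6, norm_neg, norm_one, sub_neg_eq_add, add_comm _ (1 : ℂ)] at h5
        linarith
      calc _ ≤ Real.exp (Real.exp ρ * 1 + (1 - β) * ρ) / (z / 2 * Real.exp (-(α * ρ))) := by
            gcongr
            exact Real.cos_le_one y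
        _ = _ := by
          rw [Real.exp_neg, show Real.exp ρ * 1 + (1 - β + α) * ρ =
            (Real.exp ρ * 1 + (1 - β) * ρ) + α * ρ by ring, Real.exp_add _ (α * ρ)]
          field_simp
    have hlim : Tendsto (fun ρ : ℝ => (z * Real.sin (α * θ))⁻¹ * M + (z * Real.sin (α * θ))⁻¹ * M +
        (2 / z) * Real.exp (Real.exp ρ * 1 + (1 - β + α) * ρ) * |θ - -θ|) atBot
        (𝓝 ((z * Real.sin (α * θ))⁻¹ * M + (z * Real.sin (α * θ))⁻¹ * M +
          (2 / z) * 0 * |θ - -θ|)) :=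
      tendsto_const_nhds.add (((tendsto_exp_exp_atBot 1
        (by linarith : 0 < 1 - β + α)).const_mul _).mul_const _)
    have hle : ∀ᶠ ρ : ℝ in atBot, 2 * Real.pi * |mittagLeffler α β (-z)| ≤
        (z * Real.sin (α * θ))⁻¹ * M + (z * Real.sin (α * θ))⁻¹ * M +
        (2 / z) * Real.exp (Real.exp ρ * 1 + (1 - β + α) * ρ) * |θ - -θ| := by
      filter_upwards [hseg] with ρ hρ
      have e := congrArg norm (hankel_hankelML hα0 hβ hz h₁ h₂ h₃' ρ)
      have e2 : ‖2 * Real.pi * Complex.I * ((mittagLeffler α β (-z) : ℝ) : ℂ)‖ =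
          2 * Real.pi * |mittagLeffler α β (-z)| := by
        simp [abs_of_pos hpi]
      rw [e2] at e
      rw [← e, hankel]
      refine (norm_add_le _ _).trans (add_le_add ((norm_sub_le _ _).trans ?_) hρ)
      exact add_le_add (hhor ρ θ (Or.inl rfl)) (hhor ρ (-θ) (Or.inr rfl))
    have := ge_of_tendsto hlim hle
    linarith
  set N : ℝ := ∑' n : ℕ, (1 : ℝ) ^ n * (Real.Gamma (α * n + β))⁻¹ with hN
  have hN0 : 0 ≤ N := tsum_nonneg fun n => by
    have hp : 0 < α * n + β := by positivity
    have := Real.Gamma_pos_of_pos hp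
    positivity
  -- For x ≤ 1 the series bound N is used with 1 + x ≤ 2; for x ≥ 1 the contour bound with 1 + x ≤
  -- 2x. The last 1 only ensures positivity.
  refine ⟨2 * N + 2 * (M / Real.sin (α * θ)) + 1, by positivity, fun x hx => ?_⟩
  have hMs : 0 ≤ M / Real.sin (α * θ) := by positivity
  rw [le_div_iff₀ (by linarith)]
  rcases le_total x 1 with h | h
  · have h7 : |mittagLeffler α β (-x)| ≤ N :=
      abs_mittagLeffler_le hα0 hβ (by rw [abs_neg, abs_of_nonneg hx]; exact h)
    nlinarith [abs_nonneg (mittagLeffler α β (-x))]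
  · have hx0 : 0 < x := by linarith
    have h8 := big x hx0
    have h9 : |mittagLeffler α β (-x)| * x ≤ M / Real.sin (α * θ) := by
      have h10 : 2 * ((x * Real.sin (α * θ))⁻¹ * M) = 2 * (M / Real.sin (α * θ)) / x := by
        field_simp
      rw [h10, le_div_iff₀ hx0] at h8
      have : 1 ≤ Real.pi := by linarith [Real.pi_gt_three]
      nlinarith [mul_nonneg (abs_nonneg (mittagLeffler α β (-x))) hx0.le]
    nlinarith [abs_nonneg (mittagLeffler α β (-x))]

/-! ### Convolution on the half-line -/

/-- Convolution of functions on the half-line. -/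
def conv (a b : ℝ → ℝ) (t : ℝ) : ℝ := ∫ s in (0 : ℝ)..t, a (t - s) * b s

theorem conv_zero (a b : ℝ → ℝ) : conv a b 0 = 0 := by simp [conv]

theorem conv_comm (a b : ℝ → ℝ) (t : ℝ) : conv a b t = conv b a t := by
  have h := intervalIntegral.integral_comp_sub_left (a := 0) (b := t)
    (fun s => a (t - s) * b s) t
  rw [sub_self, sub_zero] at h
  rw [conv, conv, ← h]
  refine intervalIntegral.integral_congr fun s _ => ?_
  simp only [sub_sub_cancel]
  ring

theorem conv_congr {a a' b b' : ℝ → ℝ} {t : ℝ} (ht : 0 ≤ t) (ha : ∀ s ∈ Set.Ioo 0 t, a s = a' s)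
    (hb : ∀ s ∈ Set.Ioo 0 t, b s = b' s) : conv a b t = conv a' b' t := by
  rw [conv, conv, intervalIntegral.integral_of_le ht, intervalIntegral.integral_of_le ht,
    integral_Ioc_eq_integral_Ioo, integral_Ioc_eq_integral_Ioo]
  refine setIntegral_congr_fun measurableSet_Ioo fun s hs => ?_
  rw [hb s hs, ha (t - s) ⟨by linarith [hs.2], by linarith [hs.1]⟩]

theorem intervalIntegrable_comp_sub {a : ℝ → ℝ} {t : ℝ} (ht : 0 ≤ t)
    (ha : IntegrableOn a (Set.Ioc 0 t)) : IntervalIntegrable (fun s => a (t - s)) volume 0 t := by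
  have h : IntervalIntegrable a volume 0 t := (intervalIntegrable_iff_integrableOn_Ioc_of_le ht).2 ha
  simpa using (h.comp_sub_left t).symm

theorem intervalIntegrable_conv {a b : ℝ → ℝ} {t M : ℝ} (ht : 0 ≤ t)
    (ha : IntegrableOn a (Set.Ioc 0 t))
    (hb : AEStronglyMeasurable b (volume.restrict (Set.Ioc 0 t)))
    (hM : ∀ s ∈ Set.Ioc 0 t, |b s| ≤ M) :
    IntervalIntegrable (fun s => a (t - s) * b s) volume 0 t := by
  rw [intervalIntegrable_iff_integrableOn_Ioc_of_le ht]
  have h := (intervalIntegrable_iff_integrableOn_Ioc_of_le ht).1 (intervalIntegrable_comp_sub ht ha)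
  refine h.mul_bdd (c := M) hb ?_
  filter_upwards [self_mem_ae_restrict measurableSet_Ioc] with s hs using hM s hs

theorem intervalIntegrable_conv_of_continuousOn {a b : ℝ → ℝ} {t : ℝ} (ht : 0 ≤ t)
    (ha : IntegrableOn a (Set.Ioc 0 t)) (hb : ContinuousOn b (Set.Icc 0 t)) :
    IntervalIntegrable (fun s => a (t - s) * b s) volume 0 t := by
  obtain ⟨M, hM⟩ := isCompact_Icc.exists_bound_of_continuousOn hb
  exact intervalIntegrable_conv ht ha
    ((hb.mono Set.Ioc_subset_Icc_self).aestronglyMeasurable measurableSet_Ioc)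
    fun s hs => hM s (Set.Ioc_subset_Icc_self hs)

theorem conv_add {a b c : ℝ → ℝ} {t : ℝ}
    (hb : IntervalIntegrable (fun s => a (t - s) * b s) volume 0 t)
    (hc : IntervalIntegrable (fun s => a (t - s) * c s) volume 0 t) :
    conv a (fun s => b s + c s) t = conv a b t + conv a c t := by
  simp only [conv, mul_add]
  exact intervalIntegral.integral_add hb hc

theorem conv_sub {a b c : ℝ → ℝ} {t : ℝ}
    (hb : IntervalIntegrable (fun s => a (t - s) * b s) volume 0 t)
    (hc : IntervalIntegrable (fun s => a (t - s) * c s) volume 0 t) :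
    conv a (fun s => b s - c s) t = conv a b t - conv a c t := by
  simp only [conv, mul_sub]
  exact intervalIntegral.integral_sub hb hc

theorem conv_const_mul (a b : ℝ → ℝ) (c t : ℝ) :
    conv a (fun s => c * b s) t = c * conv a b t := by
  simp only [conv]
  rw [← intervalIntegral.integral_const_mul]
  refine intervalIntegral.integral_congr fun s _ => ?_
  ring

theorem integral_mul_sub_eq {A B : ℝ → ℝ} {t : ℝ} (ht : 0 ≤ t) (hA : ∀ s ≤ 0, A s = 0)
    (hB : ∀ s ≤ 0, B s = 0) : ∫ s, A s * B (t - s) = conv B A t := by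
  rw [conv, intervalIntegral.integral_of_le ht, ← integral_indicator measurableSet_Ioc]
  congr 1
  ext s
  by_cases hs : s ∈ Set.Ioc 0 t
  · rw [Set.indicator_of_mem hs, mul_comm]
  · rw [Set.indicator_of_notMem hs]
    rcases le_or_gt s 0 with h | h
    · rw [hA s h, zero_mul]
    · have : t < s := by
        by_contra h'
        exact hs ⟨h, not_lt.1 h'⟩
      rw [hB (t - s) (by linarith), mul_zero]

/-- Cutting all three functions off outside (0, t] reduces this to convolution on the line.
Boundedness of `c` makes the triple convolution exist at the given point t, not merely almost
everywhere. -/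
theorem conv_assoc {a b c : ℝ → ℝ} {t M : ℝ} (ht : 0 ≤ t) (ha : IntegrableOn a (Set.Ioc 0 t))
    (hb : IntegrableOn b (Set.Ioc 0 t))
    (hc : AEStronglyMeasurable c (volume.restrict (Set.Ioc 0 t)))
    (hM : ∀ s ∈ Set.Ioc 0 t, |c s| ≤ M) :
    conv a (conv b c) t = conv (conv a b) c t := by
  set f := (Set.Ioc 0 t).indicator a with hf
  set g := (Set.Ioc 0 t).indicator b with hg
  set k := (Set.Ioc 0 t).indicator c with hk
  have f0 : ∀ s ≤ 0, f s = 0 := fun s hs => Set.indicator_of_notMem (fun h => by linarith [h.1]) _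
  have g0 : ∀ s ≤ 0, g s = 0 := fun s hs => Set.indicator_of_notMem (fun h => by linarith [h.1]) _
  have k0 : ∀ s ≤ 0, k s = 0 := fun s hs => Set.indicator_of_notMem (fun h => by linarith [h.1]) _
  have hci : IntegrableOn c (Set.Ioc 0 t) :=
    Integrable.of_bound hc M (by
      filter_upwards [self_mem_ae_restrict measurableSet_Ioc] with s hs using hM s hs)
  have fi : Integrable f := (integrable_indicator_iff measurableSet_Ioc).2 ha
  have gi : Integrable g := (integrable_indicator_iff measurableSet_Ioc).2 hb
  have ki : Integrable k := (integrable_indicator_iff measurableSet_Ioc).2 hci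
  have kb : ∀ s, |k s| ≤ |M| := fun s => by
    by_cases hs : s ∈ Set.Ioc 0 t
    · rw [hk, Set.indicator_of_mem hs]; exact (hM s hs).trans (le_abs_self M)
    · rw [hk, Set.indicator_of_notMem hs, abs_zero]; exact abs_nonneg M
  have conv0 : ∀ A B : ℝ → ℝ, (∀ s ≤ 0, A s = 0) → (∀ s ≤ 0, B s = 0) → ∀ s ≤ 0,
      (∫ r, A r * B (s - r)) = 0 := fun A B hA hB s hs => by
    rw [← integral_zero ℝ ℝ]
    congr 1
    ext r
    rcases le_or_gt r 0 with h | h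
    · rw [hA r h, zero_mul]
    · rw [hB (s - r) (by linarith), mul_zero]
  have key := convolution_assoc (μ := volume) (ν := volume) (f := f) (g := g) (k := k)
    (ContinuousLinearMap.mul ℝ ℝ) (ContinuousLinearMap.mul ℝ ℝ) (ContinuousLinearMap.mul ℝ ℝ)
    (ContinuousLinearMap.mul ℝ ℝ) (fun x y z => mul_assoc x y z) (x₀ := t)
    fi.aestronglyMeasurable gi.aestronglyMeasurable ki.aestronglyMeasurable
    (fi.ae_convolution_exists _ gi) (gi.norm.ae_convolution_exists _ ki.norm) (by
      have hgk : Integrable (convolution (fun x => ‖g x‖) (fun x => ‖k x‖)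
          (ContinuousLinearMap.mul ℝ ℝ) volume) := gi.norm.integrable_convolution _ ki.norm
      have hbd : ∀ s, ‖convolution (fun x => ‖g x‖) (fun x => ‖k x‖)
          (ContinuousLinearMap.mul ℝ ℝ) volume s‖ ≤ (∫ r, ‖g r‖) * |M| := fun s => by
        rw [convolution]
        refine (norm_integral_le_of_norm_le (gi.norm.mul_const |M|)
          (Eventually.of_forall fun r => ?_)).trans (le_of_eq (integral_mul_const _ _))
        simp only [ContinuousLinearMap.mul_apply', norm_mul, norm_norm]
        gcongr
        exact kb _
      unfold ConvolutionExistsAt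
      simp only [ContinuousLinearMap.mul_apply']
      refine fi.norm.mul_bdd ?_ (Eventually.of_forall fun s => hbd (t - s))
      exact hgk.aestronglyMeasurable.comp_quasiMeasurePreserving
        (quasiMeasurePreserving_sub_left_of_right_invariant volume t))
  simp only [convolution, ContinuousLinearMap.mul_apply'] at key
  rw [integral_mul_sub_eq ht (A := fun s => ∫ r, f r * g (s - r)) (conv0 f g f0 g0) k0,
    integral_mul_sub_eq ht (B := fun s => ∫ r, g r * k (s - r)) f0 (conv0 g k g0 k0)] at key
  have e : ∀ A B : ℝ → ℝ, (∀ s ≤ 0, (Set.Ioc 0 t).indicator A s = 0) →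
      (∀ s ≤ 0, (Set.Ioc 0 t).indicator B s = 0) → ∀ s ∈ Set.Ioo 0 t,
      (∫ r, (Set.Ioc 0 t).indicator A r * (Set.Ioc 0 t).indicator B (s - r)) = conv A B s :=
    fun A B hA hB s hs => by
      rw [integral_mul_sub_eq hs.1.le hA hB, conv_comm]
      refine conv_congr hs.1.le (fun r hr => ?_) (fun r hr => ?_) <;>
      exact Set.indicator_of_mem (Set.mem_Ioc.2 ⟨hr.1, by linarith [hr.2, hs.2]⟩) _
  have hin : ∀ A : ℝ → ℝ, ∀ s ∈ Set.Ioo 0 t, (Set.Ioc 0 t).indicator A s = A s :=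
    fun A s hs => Set.indicator_of_mem (Set.mem_Ioc.2 ⟨hs.1, hs.2.le⟩) _
  rw [conv_congr ht (hin c) (e a b f0 g0), conv_congr ht (e b c g0 k0) (hin a)] at key
  rw [conv_comm a, conv_comm (conv a b), key]

/-! ### Fractional integration and Mittag-Leffler kernels -/

/-- The kernel of the fractional integral of order `a`. -/
def fracKernel (a t : ℝ) : ℝ := t ^ (a - 1) / Real.Gamma a

/-- The function `t^{β-1} E_{α,β}(-λ t^α)`. -/
def mlKernel (α lam β t : ℝ) : ℝ := t ^ (β - 1) * mittagLeffler α β (-lam * t ^ α)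

theorem integral_rpow_mul_rpow {a b t : ℝ} (ha : 0 < a) (hb : 0 < b) (ht : 0 < t) :
    ∫ s in (0 : ℝ)..t, (t - s) ^ (a - 1) * s ^ (b - 1) =
      t ^ (a + b - 1) * (Real.Gamma a * Real.Gamma b / Real.Gamma (a + b)) := by
  have h1 := Complex.betaIntegral_scaled (b : ℂ) (a : ℂ) ht
  rw [Complex.betaIntegral_eq_Gamma_mul_div _ _ (by simpa) (by simpa)] at h1
  have h2 : ∫ s in (0 : ℝ)..t, (s : ℂ) ^ ((b : ℂ) - 1) * ((t : ℂ) - s) ^ ((a : ℂ) - 1) =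
      ∫ s in (0 : ℝ)..t, (((t - s) ^ (a - 1) * s ^ (b - 1) : ℝ) : ℂ) := by
    refine intervalIntegral.integral_congr fun s hs => ?_
    rw [Set.uIcc_of_le ht.le] at hs
    rw [Complex.ofReal_mul, Complex.ofReal_cpow (by linarith [hs.2]), Complex.ofReal_cpow hs.1]
    push_cast
    ring
  rw [h2, intervalIntegral.integral_ofReal] at h1
  apply Complex.ofReal_injective
  rw [h1, Complex.Gamma_ofReal, Complex.Gamma_ofReal, ← Complex.ofReal_add, Complex.Gamma_ofReal]
  push_cast
  rw [Complex.ofReal_cpow ht.le]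
  push_cast
  rw [add_comm (b : ℂ) a, add_comm b a, mul_comm (Real.Gamma a : ℂ)]

theorem conv_fracKernel {a b t : ℝ} (ha : 0 < a) (hb : 0 < b) (ht : 0 < t) :
    conv (fracKernel a) (fracKernel b) t = fracKernel (a + b) t := by
  have hGa := (Real.Gamma_pos_of_pos ha).ne'
  have hGb := (Real.Gamma_pos_of_pos hb).ne'
  have h := integral_rpow_mul_rpow ha hb ht
  simp only [conv, fracKernel]
  rw [show (fun s => (t - s) ^ (a - 1) / Real.Gamma a * (s ^ (b - 1) / Real.Gamma b)) =
    fun s => (1 / (Real.Gamma a * Real.Gamma b)) * ((t - s) ^ (a - 1) * s ^ (b - 1)) by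
      ext s; field_simp, intervalIntegral.integral_const_mul, h]
  field_simp

theorem integrableOn_fracKernel {a : ℝ} (ha : 0 < a) (t : ℝ) :
    IntegrableOn (fracKernel a) (Set.Ioc 0 t) := by
  rcases le_total 0 t with h | h
  · exact ((intervalIntegrable_iff_integrableOn_Ioc_of_le h).1
      (intervalIntegral.intervalIntegrable_rpow' (by linarith))).div_const _
  · rw [Set.Ioc_eq_empty (by linarith)]; exact integrableOn_empty

theorem fracKernel_nonneg {a t : ℝ} (ha : 0 < a) (ht : 0 ≤ t) : 0 ≤ fracKernel a t := by
  have := Real.Gamma_pos_of_pos ha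
  unfold fracKernel
  positivity

theorem fracKernel_one (t : ℝ) : fracKernel 1 t = 1 := by simp [fracKernel]

theorem fracKernel_two (t : ℝ) : fracKernel 2 t = t := by
  norm_num [fracKernel]

/-- The Neumann series of the fractional equation. In this form fractional integration merely shifts
β, and splitting off the term n = 0 gives the recurrence. -/
theorem hasSum_mlKernel {α β t : ℝ} (hα : 0 < α) (hβ : 0 < β) (lam : ℝ) (ht : 0 < t) :
    HasSum (fun n : ℕ => (-lam) ^ n * fracKernel (α * n + β) t) (mlKernel α lam β t) := by
  refine ((hasSum_mittagLeffler hα hβ (-lam * t ^ α)).mul_left (t ^ (β - 1))).congr_fun fun n => ?_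
  rw [fracKernel, mul_pow, ← Real.rpow_natCast (t ^ α), ← Real.rpow_mul ht.le,
    show α * n + β - 1 = α * n + (β - 1) by ring, Real.rpow_add ht]
  ring

theorem mlKernel_recurrence {α β t : ℝ} (hα : 0 < α) (hβ : 0 < β) (lam : ℝ) (ht : 0 < t) :
    mlKernel α lam β t = fracKernel β t - lam * mlKernel α lam (α + β) t := by
  have h1 := (hasSum_mlKernel hα hβ lam ht)
  rw [← hasSum_nat_add_iff' 1] at h1
  have h2 := (hasSum_mlKernel hα (by positivity : 0 < α + β) lam ht).mul_left (-lam)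
  have h3 := h1.unique (h2.congr_fun fun n => by
    rw [pow_succ]
    push_cast
    rw [show α * (n + 1) + β = α * n + (α + β) by ring]
    ring)
  simp at h3
  linarith

theorem continuousOn_mlKernel {α β : ℝ} (hα : 0 < α) (hβ : 0 < β) (lam : ℝ) :
    ContinuousOn (mlKernel α lam β) (Set.Ioi 0) := by
  unfold mlKernel
  have hm := continuous_mittagLeffler hα hβ
  refine ContinuousOn.mul ?_ (hm.comp_continuousOn (continuousOn_const.mul ?_)) <;>
  exact fun s hs => (Real.continuousAt_rpow_const s _ (Or.inl (ne_of_gt hs))).continuousWithinAt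

theorem continuous_mlKernel {α β : ℝ} (hα : 0 < α) (hβ : 1 ≤ β) (lam : ℝ) :
    Continuous (mlKernel α lam β) := by
  unfold mlKernel
  have hm := continuous_mittagLeffler hα (by linarith : 0 < β)
  have h1 : Continuous fun t : ℝ => t ^ (β - 1) := Real.continuous_rpow_const (by linarith)
  have h2 : Continuous fun t : ℝ => t ^ α := Real.continuous_rpow_const (by linarith)
  fun_prop

theorem conv_fracKernel_mlKernel {α β δ t : ℝ} (hα : 0 < α) (hβ : 0 < β) (hδ : 0 < δ) (lam : ℝ)
    (ht : 0 < t) : conv (fracKernel δ) (mlKernel α lam β) t = mlKernel α lam (δ + β) t := by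
  have hn : ∀ n : ℕ, 0 < α * n + β := fun n => by positivity
  have hinteg : ∀ (c : ℝ) (n : ℕ), IntegrableOn (fun s => fracKernel δ (t - s) *
      (c * fracKernel (α * n + β) s)) (Set.Ioc 0 t) := by
    intro c n
    -- The integral of a non-integrable function is 0 by convention, so the nonzero Beta value
    -- already proves integrability.
    have hne : conv (fracKernel δ) (fracKernel (α * n + β)) t ≠ 0 := by
      rw [conv_fracKernel hδ (hn n) ht]
      have h1 : 0 < δ + (α * n + β) := add_pos hδ (hn n)
      have := Real.Gamma_pos_of_pos h1
      unfold fracKernel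
      positivity
    have := (intervalIntegrable_iff_integrableOn_Ioc_of_le ht.le).1
      (intervalIntegral.intervalIntegrable_of_integral_ne_zero hne)
    refine IntegrableOn.congr_fun (this.const_mul c) (fun s _ => ?_) measurableSet_Ioc
    ring
  have hval : ∀ (c : ℝ) (n : ℕ), ∫ s in Set.Ioc 0 t, fracKernel δ (t - s) *
      (c * fracKernel (α * n + β) s) = c * fracKernel (α * n + (δ + β)) t := by
    intro c n
    rw [← intervalIntegral.integral_of_le ht.le]
    have := conv_const_mul (fracKernel δ) (fracKernel (α * n + β)) c t
    rw [conv] at this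
    rw [this, conv_fracKernel hδ (hn n) ht]
    ring_nf
  -- The integrals of the norms are the terms of the same expansion with λ replaced by -|λ|.
  have hsum : Summable fun n : ℕ => ∫ s in Set.Ioc 0 t, ‖fracKernel δ (t - s) *
      ((-lam) ^ n * fracKernel (α * n + β) s)‖ := by
    have h1 : ∀ n : ℕ, ∫ s in Set.Ioc 0 t, ‖fracKernel δ (t - s) *
        ((-lam) ^ n * fracKernel (α * n + β) s)‖ =
        |lam| ^ n * fracKernel (α * n + (δ + β)) t := by
      intro n
      rw [← hval]
      refine setIntegral_congr_fun measurableSet_Ioc fun s hs => ?_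
      simp only [norm_mul, norm_pow, norm_neg]
      rw [Real.norm_of_nonneg (fracKernel_nonneg hδ (by linarith [hs.2])),
        Real.norm_of_nonneg (fracKernel_nonneg (hn n) hs.1.le), Real.norm_eq_abs]
    simp_rw [h1]
    have := (hasSum_mlKernel hα (by positivity : 0 < δ + β) (-|lam|) ht).summable
    simpa using this
  have key := hasSum_integral_of_summable_integral_norm (fun n => hinteg ((-lam) ^ n) n) hsum
  simp_rw [hval] at key
  rw [← key.unique (hasSum_mlKernel hα (by positivity : 0 < δ + β) lam ht), conv,
    intervalIntegral.integral_of_le ht.le]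
  refine setIntegral_congr_fun measurableSet_Ioc fun s hs => ?_
  exact ((hasSum_mlKernel hα hβ lam hs.1).mul_left _).tsum_eq.symm

theorem hasDerivWithinAt_integral_Icc {E : Type*} [NormedAddCommGroup E] [NormedSpace ℝ E]
    [CompleteSpace E] {g : ℝ → E} {T : ℝ} (hg : ContinuousOn g (Set.Icc 0 T)) {t : ℝ}
    (ht : t ∈ Set.Icc 0 T) :
    HasDerivWithinAt (fun r => ∫ s in (0 : ℝ)..r, g s) (g t) (Set.Icc 0 T) t := by
  have h0T : (0 : ℝ) ≤ T := ht.1.trans ht.2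
  -- Extending by the endpoint values makes the endpoints ordinary points of continuity.
  set G : ℝ → E := Set.IccExtend h0T ((Set.Icc 0 T).domRestrict g) with hG
  have hGc : Continuous G := (continuousOn_iff_continuous_domRestrict.1 hg).Icc_extend'
  have hGe : ∀ s ∈ Set.Icc 0 T, G s = g s := fun s hs => by
    rw [hG, Set.IccExtend_of_mem _ _ hs]; rfl
  have h1 : HasDerivWithinAt (fun r => ∫ s in (0 : ℝ)..r, G s) (G t) (Set.Icc 0 T) t :=
    (intervalIntegral.integral_hasDerivAt_right (hGc.intervalIntegrable _ _)
      (hGc.stronglyMeasurableAtFilter _ _) hGc.continuousAt).hasDerivWithinAt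
  rw [hGe t ht] at h1
  refine h1.congr (fun r hr => ?_) ?_
  · refine intervalIntegral.integral_congr fun s hs => ?_
    rw [Set.uIcc_of_le hr.1] at hs
    exact (hGe s ⟨hs.1, hs.2.trans hr.2⟩).symm
  · refine intervalIntegral.integral_congr fun s hs => ?_
    rw [Set.uIcc_of_le ht.1] at hs
    exact (hGe s ⟨hs.1, hs.2.trans ht.2⟩).symm

theorem eq_zero_of_integral_eq_zero {g : ℝ → ℝ} {T : ℝ} (hT : 0 < T)
    (hg : ContinuousOn g (Set.Icc 0 T)) (h : ∀ t ∈ Set.Icc 0 T, ∫ s in (0 : ℝ)..t, g s = 0) :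
    ∀ t ∈ Set.Icc 0 T, g t = 0 := fun t ht => by
  have h1 := hasDerivWithinAt_integral_Icc hg ht
  have h2 : HasDerivWithinAt (fun r => ∫ s in (0 : ℝ)..r, g s) 0 (Set.Icc 0 T) t :=
    (hasDerivWithinAt_const t (Set.Icc 0 T) (0 : ℝ)).congr h (h t ht)
  exact (uniqueDiffOn_Icc hT t ht).eq_deriv _ h1 h2

/-- With x = λ t^α, λ^σ = x^σ t^{-ασ}, and x^σ ≤ 1 + x is absorbed by the decay 1/(1+x). Powers of λ
are thus traded for powers of t, with a constant independent of λ. -/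
theorem exists_mlKernel_bound {α β : ℝ} (hα : 1 < α) (hα2 : α < 2) (hβ : 0 < β) (hβα : β < α + 1) :
    ∃ C : ℝ, 0 < C ∧ ∀ lam σ t : ℝ, 0 < lam → 0 ≤ σ → σ ≤ 1 → 0 < t →
      lam ^ σ * |mlKernel α lam β t| ≤ C * t ^ (β - 1 - α * σ) := by
  obtain ⟨C, hC, hb⟩ := exists_mittagLeffler_bound hα hα2 hβ hβα
  refine ⟨C, hC, fun lam σ t hl hσ hσ1 ht => ?_⟩
  set x : ℝ := lam * t ^ α with hx
  have htα : 0 < t ^ α := Real.rpow_pos_of_pos ht _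
  have hxp : 0 < x := by positivity
  have h1 := hb x hxp.le
  have h2 : x ^ σ ≤ 1 + x := by
    rcases le_total x 1 with h | h
    · linarith [Real.rpow_le_one hxp.le h hσ]
    · have := Real.rpow_le_rpow_of_exponent_le h hσ1
      rw [Real.rpow_one] at this
      linarith
  have h3 : lam ^ σ = x ^ σ * t ^ (-(α * σ)) := by
    rw [hx, Real.mul_rpow hl.le htα.le, ← Real.rpow_mul ht.le, mul_assoc, ← Real.rpow_add ht]
    simp
  rw [mlKernel, neg_mul, ← hx, abs_mul, abs_of_pos (Real.rpow_pos_of_pos ht _), h3]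
  calc x ^ σ * t ^ (-(α * σ)) * (t ^ (β - 1) * |mittagLeffler α β (-x)|)
      ≤ (1 + x) * t ^ (-(α * σ)) * (t ^ (β - 1) * (C / (1 + x))) := by gcongr
    _ = C * (t ^ (β - 1) * t ^ (-(α * σ))) := by field_simp
    _ = C * t ^ (β - 1 - α * σ) := by rw [← Real.rpow_add ht]; ring_nf

theorem exists_abs_mlKernel_le {α β : ℝ} (hα : 1 < α) (hα2 : α < 2) (hβ : 0 < β) (hβα : β < α + 1)
    {lam : ℝ} (hl : 0 < lam) :
    ∃ C : ℝ, ∀ t : ℝ, 0 < t → |mlKernel α lam β t| ≤ C * t ^ (β - 1) := by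
  obtain ⟨C, _, hb⟩ := exists_mlKernel_bound hα hα2 hβ hβα
  exact ⟨C, fun t ht => by simpa using hb lam 0 t hl le_rfl zero_le_one ht⟩

theorem integrableOn_of_abs_le_rpow {a : ℝ → ℝ} {C δ : ℝ} (hδ : 0 < δ)
    (ha : ContinuousOn a (Set.Ioi 0)) (hC : ∀ r, 0 < r → |a r| ≤ C * r ^ (δ - 1)) (t : ℝ) :
    IntegrableOn a (Set.Ioc 0 t) := by
  rcases le_total 0 t with h | h
  · have h1 : IntegrableOn (fun r : ℝ => C * r ^ (δ - 1)) (Set.Ioc 0 t) :=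
      ((intervalIntegrable_iff_integrableOn_Ioc_of_le h).1
        (intervalIntegral.intervalIntegrable_rpow' (by linarith))).const_mul C
    refine Integrable.mono' h1 ((ha.mono fun s hs => hs.1).aestronglyMeasurable measurableSet_Ioc) ?_
    filter_upwards [self_mem_ae_restrict measurableSet_Ioc] with s hs using hC s hs.1
  · rw [Set.Ioc_eq_empty (by linarith)]; exact integrableOn_empty

theorem integrableOn_mlKernel {α β : ℝ} (hα : 1 < α) (hα2 : α < 2) (hβ : 0 < β) (hβα : β < α + 1)
    {lam : ℝ} (hl : 0 < lam) (t : ℝ) : IntegrableOn (mlKernel α lam β) (Set.Ioc 0 t) := by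
  obtain ⟨C, hC⟩ := exists_abs_mlKernel_le hα hα2 hβ hβα hl
  exact integrableOn_of_abs_le_rpow hβ (continuousOn_mlKernel (by linarith) hβ lam) hC t

/-- The substitution s = tρ fixes the interval of integration, so dominated convergence in t
applies. -/
theorem conv_eq_scaled (a b : ℝ → ℝ) {t : ℝ} (ht : 0 ≤ t) :
    conv a b t = ∫ ρ in (0 : ℝ)..1, t * (a (t * (1 - ρ)) * b (t * ρ)) := by
  rcases ht.eq_or_lt with h | h
  · subst h; simp [conv]
  · have h1 := intervalIntegral.integral_comp_mul_left (a := 0) (b := 1)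
      (fun s => a (t - s) * b s) h.ne'
    rw [mul_zero, mul_one] at h1
    rw [intervalIntegral.integral_const_mul]
    simp_rw [mul_sub, mul_one]
    rw [h1, smul_eq_mul, conv]
    field_simp

/-- After scaling, the integrand is at most C t^δ M (1-ρ)^{δ-1}, integrable in ρ because δ > 0 and
uniform for t ≤ T. -/
theorem continuousOn_conv {a b : ℝ → ℝ} {C δ T : ℝ} (hδ : 0 < δ)
    (ha : ContinuousOn a (Set.Ioi 0)) (hC : ∀ r, 0 < r → |a r| ≤ C * r ^ (δ - 1))
    (hb : ContinuousOn b (Set.Icc 0 T)) : ContinuousOn (conv a b) (Set.Icc 0 T) := by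
  obtain ⟨M, hM⟩ := isCompact_Icc.exists_bound_of_continuousOn hb
  have hC0 : 0 ≤ C := by
    have := (abs_nonneg _).trans (hC 1 one_pos)
    simpa using this
  intro t₀ ht₀
  have hM0 : 0 ≤ M := (norm_nonneg _).trans (hM t₀ ht₀)
  have hbound : ∀ t ∈ Set.Icc 0 T, ∀ ρ ∈ Set.Ioo (0 : ℝ) 1,
      ‖t * (a (t * (1 - ρ)) * b (t * ρ))‖ ≤ C * t ^ δ * ((1 - ρ) ^ (δ - 1) * M) := by
    intro t ht ρ hρ
    rcases ht.1.eq_or_lt with h | h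
    · subst h; simp [Real.zero_rpow hδ.ne']
    · have h1 : 0 < 1 - ρ := by linarith [hρ.2]
      have h2 : 0 < t * (1 - ρ) := by positivity
      have h3 := hM (t * ρ) ⟨mul_nonneg h.le hρ.1.le,
        (mul_le_of_le_one_right h.le hρ.2.le).trans ht.2⟩
      rw [norm_mul, norm_mul, Real.norm_of_nonneg h.le]
      calc t * (‖a (t * (1 - ρ))‖ * ‖b (t * ρ)‖)
          ≤ t * (C * (t * (1 - ρ)) ^ (δ - 1) * M) := by
            gcongr
            exact hC _ h2
        _ = _ := by
          rw [Real.mul_rpow h.le h1.le, show t ^ δ = t * t ^ (δ - 1) by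
            rw [← Real.rpow_one_add' h.le (by linarith)]; ring_nf]
          ring
  refine ContinuousWithinAt.congr_of_mem (f := fun t => ∫ ρ in (0 : ℝ)..1,
    t * (a (t * (1 - ρ)) * b (t * ρ))) ?_ (fun t ht => conv_eq_scaled a b ht.1) ht₀
  have hae : ∀ᵐ ρ ∂(volume : Measure ℝ), ρ ≠ 1 := by
    simp [ae_iff, measure_singleton]
  refine intervalIntegral.continuousWithinAt_of_dominated_interval
    (bound := fun ρ => C * T ^ δ * ((1 - ρ) ^ (δ - 1) * M)) ?_ ?_ ?_ ?_
  · filter_upwards [self_mem_nhdsWithin] with t ht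
    rcases ht.1.eq_or_lt with h | h
    · subst h
      simpa using aestronglyMeasurable_const
    rw [Set.uIoc_of_le zero_le_one, ← restrict_Ioo_eq_restrict_Ioc]
    refine ContinuousOn.aestronglyMeasurable ?_ measurableSet_Ioo
    refine continuousOn_const.mul (ContinuousOn.mul ?_ ?_)
    · exact ha.comp (by fun_prop) fun ρ hρ => mul_pos h (by linarith [hρ.2])
    · exact hb.comp (by fun_prop) fun ρ hρ => ⟨mul_nonneg h.le hρ.1.le,
        (mul_le_of_le_one_right h.le hρ.2.le).trans ht.2⟩
  · filter_upwards [self_mem_nhdsWithin] with t ht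
    filter_upwards [hae] with ρ hρ1 hρ
    rw [Set.uIoc_of_le zero_le_one] at hρ
    have hρ' : ρ ∈ Set.Ioo (0 : ℝ) 1 := ⟨hρ.1, lt_of_le_of_ne hρ.2 hρ1⟩
    refine (hbound t ht ρ hρ').trans ?_
    have := Real.rpow_le_rpow ht.1 ht.2 hδ.le
    have h1 : 0 < 1 - ρ := by linarith [hρ'.2]
    gcongr
  · have h1 : IntervalIntegrable (fun ρ : ℝ => ρ ^ (δ - 1)) volume 0 1 :=
      intervalIntegral.intervalIntegrable_rpow' (by linarith)
    have h2 := (h1.comp_sub_left 1).symm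
    simp only [sub_zero, sub_self] at h2
    exact (h2.mul_const M).const_mul _
  · filter_upwards [hae] with ρ hρ1 hρ
    rw [Set.uIoc_of_le zero_le_one] at hρ
    have hρ' : ρ ∈ Set.Ioo (0 : ℝ) 1 := ⟨hρ.1, lt_of_le_of_ne hρ.2 hρ1⟩
    have hmaps : ∀ t ∈ Set.Icc 0 T, t * ρ ∈ Set.Icc 0 T := fun t ht =>
      ⟨mul_nonneg ht.1 hρ.1.le, (mul_le_of_le_one_right ht.1 hρ.2).trans ht.2⟩
    -- At t₀ = 0 the argument of `a` runs into its possible singularity; there the factor t^δ of the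
    -- bound gives the limit.
    rcases ht₀.1.eq_or_lt with h | h
    · subst h
      rw [ContinuousWithinAt, zero_mul]
      refine squeeze_zero_norm' (a := fun t => C * t ^ δ * ((1 - ρ) ^ (δ - 1) * M)) ?_ ?_
      · filter_upwards [self_mem_nhdsWithin] with t ht using hbound t ht ρ hρ'
      · have h3 : Continuous fun t : ℝ => C * t ^ δ * ((1 - ρ) ^ (δ - 1) * M) := by
          have : Continuous fun t : ℝ => t ^ δ := Real.continuous_rpow_const hδ.le
          fun_prop
        have h4 := h3.tendsto 0
        simp only [Real.zero_rpow hδ.ne', mul_zero, zero_mul] at h4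
        exact h4.mono_left nhdsWithin_le_nhds
    · refine continuousWithinAt_id.mul (ContinuousWithinAt.mul ?_ ?_)
      · have h5 : 0 < t₀ * (1 - ρ) := mul_pos h (by linarith [hρ'.2])
        exact ((ha.continuousAt (Ioi_mem_nhds h5)).comp (f := fun t => t * (1 - ρ))
          (by fun_prop)).continuousWithinAt
      · exact ContinuousWithinAt.comp (f := fun t => t * ρ) (hb _ (hmaps t₀ ht₀)) (by fun_prop) hmaps

/-! ### The scalar fractional equation -/

/-- The solution of `D_t^α y + λ y = F`, `y(0) = a`, `y'(0) = b`. -/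
def modeSol (α lam a b : ℝ) (F : ℝ → ℝ) (t : ℝ) : ℝ :=
  a * mlKernel α lam 1 t + b * mlKernel α lam 2 t + conv (mlKernel α lam α) F t

/-- The derivative of `modeSol`. -/
def modeDeriv (α lam a b : ℝ) (F : ℝ → ℝ) (t : ℝ) : ℝ :=
  -lam * a * mlKernel α lam α t + b * mlKernel α lam 1 t + conv (mlKernel α lam (α - 1)) F t

section

variable {α lam T : ℝ} {F : ℝ → ℝ}

theorem continuousOn_conv_mlKernel (hα : 1 < α) (hα2 : α < 2) (hl : 0 < lam) {β : ℝ} (hβ : 0 < β)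
    (hβα : β < α + 1) (hF : ContinuousOn F (Set.Icc 0 T)) :
    ContinuousOn (conv (mlKernel α lam β) F) (Set.Icc 0 T) := by
  obtain ⟨C, hC⟩ := exists_abs_mlKernel_le hα hα2 hβ hβα hl
  exact continuousOn_conv hβ (continuousOn_mlKernel (by linarith) hβ lam) hC hF

theorem continuousOn_modeSol (hα : 1 < α) (hα2 : α < 2) (hl : 0 < lam) (a b : ℝ)
    (hF : ContinuousOn F (Set.Icc 0 T)) :
    ContinuousOn (modeSol α lam a b F) (Set.Icc 0 T) := by
  have h1 := continuous_mlKernel (α := α) (by linarith) (le_refl 1) lam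
  have h2 := continuous_mlKernel (α := α) (β := 2) (by linarith) (by norm_num) lam
  exact ((continuousOn_const.mul h1.continuousOn).add (continuousOn_const.mul h2.continuousOn)).add
    (continuousOn_conv_mlKernel hα hα2 hl (by linarith) (by linarith) hF)

theorem mlKernel_at_zero {β : ℝ} (hβ : β ≠ 1) : mlKernel α lam β 0 = 0 := by
  rw [mlKernel, Real.zero_rpow (by intro h; apply hβ; linarith), zero_mul]

theorem mlKernel_one_at_zero (hα : 0 < α) : mlKernel α lam 1 0 = 1 := by
  simp [mlKernel, Real.zero_rpow hα.ne', mittagLeffler_zero]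

theorem modeSol_zero (hα : 0 < α) (a b : ℝ) : modeSol α lam a b F 0 = a := by
  rw [modeSol, mlKernel_one_at_zero hα, mlKernel_at_zero (by norm_num), conv_zero]
  ring

theorem modeDeriv_zero (hα : 1 < α) (a b : ℝ) : modeDeriv α lam a b F 0 = b := by
  rw [modeDeriv, mlKernel_one_at_zero (by linarith), mlKernel_at_zero hα.ne', conv_zero]
  ring

theorem conv_fracKernel_conv_mlKernel (hα : 1 < α) (hα2 : α < 2) (hl : 0 < lam) {β δ : ℝ}
    (hβ : 0 < β) (hβα : β < α + 1) (hδ : 0 < δ) (hF : ContinuousOn F (Set.Icc 0 T)) {t : ℝ}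
    (ht : t ∈ Set.Icc 0 T) :
    conv (fracKernel δ) (conv (mlKernel α lam β) F) t = conv (mlKernel α lam (δ + β)) F t := by
  obtain ⟨M, hM⟩ := isCompact_Icc.exists_bound_of_continuousOn hF
  have hsub : Set.Ioc 0 t ⊆ Set.Icc 0 T := fun s hs => ⟨hs.1.le, hs.2.trans ht.2⟩
  rw [conv_assoc ht.1 (integrableOn_fracKernel hδ t) (integrableOn_mlKernel hα hα2 hβ hβα hl t)
    ((hF.mono hsub).aestronglyMeasurable measurableSet_Ioc) (fun s hs => hM s (hsub hs))]
  exact conv_congr ht.1 (fun s hs => conv_fracKernel_mlKernel (by linarith) hβ hδ lam hs.1)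
    fun _ _ => rfl

theorem conv_fracKernel_one (b : ℝ → ℝ) (t : ℝ) : conv (fracKernel 1) b t = ∫ s in (0 : ℝ)..t, b s := by
  simp [conv, fracKernel_one]

/-- Integration raises the order of each kernel by one, and the recurrence at β = 1 turns -λ K_{1+α}
into K_1 - 1. The integrated form avoids differentiating under a convolution whose kernel K_{α-1} is
singular at 0. -/
theorem modeSol_eq_integral (hα : 1 < α) (hα2 : α < 2) (hl : 0 < lam) (a b : ℝ)
    (hF : ContinuousOn F (Set.Icc 0 T)) {t : ℝ} (ht : t ∈ Set.Icc 0 T) :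
    modeSol α lam a b F t = a + ∫ s in (0 : ℝ)..t, modeDeriv α lam a b F s := by
  rcases ht.1.eq_or_lt with h | h
  · subst h
    rw [modeSol_zero (by linarith), intervalIntegral.integral_same, add_zero]
  have hα0 : 0 < α := by linarith
  have hsub : Set.Icc 0 t ⊆ Set.Icc 0 T := Set.Icc_subset_Icc_right ht.2
  have h1 := continuous_mlKernel (α := α) hα0 (le_refl 1) lam
  have h2 := continuous_mlKernel (α := α) (β := α) hα0 hα.le lam
  have h3 := (continuousOn_conv_mlKernel hα hα2 hl (by linarith : 0 < α - 1) (by linarith) hF).mono hsub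
  have e1 : ∫ s in (0 : ℝ)..t, mlKernel α lam α s = mlKernel α lam (1 + α) t := by
    rw [← conv_fracKernel_one, conv_fracKernel_mlKernel hα0 hα0 one_pos lam h]
  have e2 : ∫ s in (0 : ℝ)..t, mlKernel α lam 1 s = mlKernel α lam 2 t := by
    rw [← conv_fracKernel_one, conv_fracKernel_mlKernel hα0 one_pos one_pos lam h]
    norm_num
  have e3 : ∫ s in (0 : ℝ)..t, conv (mlKernel α lam (α - 1)) F s = conv (mlKernel α lam α) F t := by
    rw [← conv_fracKernel_one, conv_fracKernel_conv_mlKernel hα hα2 hl (by linarith) (by linarith)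
      one_pos hF ht]
    ring_nf
  have i3 : IntervalIntegrable (conv (mlKernel α lam (α - 1)) F) volume 0 t :=
    ContinuousOn.intervalIntegrable (by rwa [Set.uIcc_of_le ht.1])
  simp only [modeDeriv]
  rw [intervalIntegral.integral_add (Continuous.intervalIntegrable (by fun_prop) _ _) i3,
    intervalIntegral.integral_add (Continuous.intervalIntegrable (by fun_prop) _ _)
      (Continuous.intervalIntegrable (by fun_prop) _ _),
    intervalIntegral.integral_const_mul, intervalIntegral.integral_const_mul, e1, e2, e3, modeSol,
    mlKernel_recurrence hα0 one_pos lam h, fracKernel_one, add_comm α 1]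
  ring

theorem conv_linear_combination {a x y z : ℝ → ℝ} {t : ℝ} (ht : 0 ≤ t)
    (ha : IntegrableOn a (Set.Ioc 0 t)) (hx : ContinuousOn x (Set.Icc 0 t))
    (hy : ContinuousOn y (Set.Icc 0 t)) (hz : ContinuousOn z (Set.Icc 0 t)) (c d : ℝ) :
    conv a (fun s => c * x s + d * y s + z s) t =
      c * conv a x t + d * conv a y t + conv a z t := by
  have hx' : ContinuousOn (fun s => c * x s) (Set.Icc 0 t) := continuousOn_const.mul hx
  have hy' : ContinuousOn (fun s => d * y s) (Set.Icc 0 t) := continuousOn_const.mul hy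
  have hxy : ContinuousOn (fun s => c * x s + d * y s) (Set.Icc 0 t) := hx'.add hy'
  rw [conv_add (intervalIntegrable_conv_of_continuousOn ht ha hxy)
    (intervalIntegrable_conv_of_continuousOn ht ha hz),
    conv_add (intervalIntegrable_conv_of_continuousOn ht ha hx')
    (intervalIntegrable_conv_of_continuousOn ht ha hy'), conv_const_mul, conv_const_mul]

theorem conv_sub_const_mul {a x y : ℝ → ℝ} {t : ℝ} (ht : 0 ≤ t)
    (ha : IntegrableOn a (Set.Ioc 0 t)) (hx : ContinuousOn x (Set.Icc 0 t))
    (hy : ContinuousOn y (Set.Icc 0 t)) (c : ℝ) :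
    conv a (fun s => x s - c * y s) t = conv a x t - c * conv a y t := by
  have hy' : ContinuousOn (fun s => c * y s) (Set.Icc 0 t) := continuousOn_const.mul hy
  rw [conv_sub (intervalIntegrable_conv_of_continuousOn ht ha hx)
    (intervalIntegrable_conv_of_continuousOn ht ha hy'), conv_const_mul]

/-- The equation D^α y = F - λy integrated twice, which makes sense without differentiability of the
potential. Both sides reduce to a, b and F tested against kernels of orders 3, 4 and 2. -/
theorem conv_caputo_modeSol (hα : 1 < α) (hα2 : α < 2) (hl : 0 < lam) (a b : ℝ)
    (hF : ContinuousOn F (Set.Icc 0 T)) {t : ℝ} (ht : t ∈ Set.Icc 0 T) :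
    conv (fracKernel (2 - α)) (fun s => modeSol α lam a b F s - a - s * b) t =
      conv (fracKernel 2) (fun s => F s - lam * modeSol α lam a b F s) t := by
  rcases ht.1.eq_or_lt with h | h
  · subst h; rw [conv_zero, conv_zero]
  have hα0 : 0 < α := by linarith
  have hsub : Set.Icc 0 t ⊆ Set.Icc 0 T := Set.Icc_subset_Icc_right ht.2
  have c : ∀ β : ℝ, 1 ≤ β → ContinuousOn (mlKernel α lam β) (Set.Icc 0 t) := fun β hβ =>
    (continuous_mlKernel hα0 hβ lam).continuousOn
  have cF := (continuousOn_conv_mlKernel hα hα2 hl hα0 (by linarith) hF).mono hsub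
  have hp := integrableOn_fracKernel (by linarith : 0 < 2 - α) t
  have hp2 := integrableOn_fracKernel (two_pos) t
  -- The recurrence at β = 1 and β = 2 cancels a + s b exactly, leaving kernels of orders α+1 and
  -- α+2, which the fractional integral raises by 2-α.
  have L : conv (fracKernel (2 - α)) (fun s => modeSol α lam a b F s - a - s * b) t =
      -lam * a * mlKernel α lam 3 t + -lam * b * mlKernel α lam 4 t + conv (mlKernel α lam 2) F t := by
    rw [conv_congr (a' := fracKernel (2 - α)) (b' := fun s => (-lam * a * mlKernel α lam (α + 1) s +
        -lam * b * mlKernel α lam (α + 2) s) + conv (mlKernel α lam α) F s) h.le (fun _ _ => rfl)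
      (fun s hs => by
        rw [modeSol, mlKernel_recurrence hα0 one_pos lam hs.1,
          mlKernel_recurrence hα0 two_pos lam hs.1, fracKernel_one, fracKernel_two]
        ring)]
    rw [conv_linear_combination h.le hp (c _ (by linarith)) (c _ (by linarith)) cF,
      conv_fracKernel_mlKernel hα0 (by linarith) (by linarith) lam h,
      conv_fracKernel_mlKernel hα0 (by linarith) (by linarith) lam h,
      conv_fracKernel_conv_mlKernel hα hα2 hl hα0 (by linarith) (by linarith) hF ht]
    ring_nf
  have R : conv (fracKernel 2) (fun s => F s - lam * modeSol α lam a b F s) t =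
      conv (fracKernel 2) F t - lam * (a * mlKernel α lam 3 t + b * mlKernel α lam 4 t +
        conv (mlKernel α lam (α + 2)) F t) := by
    have cS : ContinuousOn (modeSol α lam a b F) (Set.Icc 0 t) :=
      (continuousOn_modeSol hα hα2 hl a b hF).mono hsub
    rw [conv_sub_const_mul h.le hp2 (hF.mono hsub) cS]
    have : conv (fracKernel 2) (modeSol α lam a b F) t = _ :=
      conv_linear_combination h.le hp2 (c 1 le_rfl) (c 2 one_le_two) cF a b
    rw [this,
      conv_fracKernel_mlKernel hα0 one_pos two_pos lam h,
      conv_fracKernel_mlKernel hα0 two_pos two_pos lam h,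
      conv_fracKernel_conv_mlKernel hα hα2 hl hα0 (by linarith) two_pos hF ht]
    ring_nf
  have hK : conv (mlKernel α lam 2) F t =
      conv (fracKernel 2) F t - lam * conv (mlKernel α lam (α + 2)) F t := by
    have hFi : IntegrableOn F (Set.Ioc 0 t) :=
      ((hF.mono hsub).integrableOn_Icc).mono_set Set.Ioc_subset_Icc_self
    have c2 : ContinuousOn (fracKernel 2) (Set.Icc 0 t) := by
      simp_rw [funext fracKernel_two]
      exact continuousOn_id
    rw [conv_comm _ F, conv_comm _ F, conv_comm _ F,
      ← conv_sub_const_mul h.le hFi c2 (c _ (by linarith))]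
    exact conv_congr h.le (fun _ _ => rfl) fun s hs => mlKernel_recurrence hα0 two_pos lam hs.1
  rw [L, R, hK]
  ring

theorem conv_fracKernel_two_eq (hF : ContinuousOn F (Set.Icc 0 T)) {t : ℝ} (ht : t ∈ Set.Icc 0 T) :
    conv (fracKernel 2) F t = ∫ s in (0 : ℝ)..t, ∫ r in (0 : ℝ)..s, F r := by
  obtain ⟨M, hM⟩ := isCompact_Icc.exists_bound_of_continuousOn hF
  have hsub : Set.Ioc 0 t ⊆ Set.Icc 0 T := fun s hs => ⟨hs.1.le, hs.2.trans ht.2⟩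
  have h1 := integrableOn_fracKernel one_pos t
  have := conv_assoc ht.1 h1 h1 ((hF.mono hsub).aestronglyMeasurable measurableSet_Ioc)
    (fun s hs => hM s (hsub hs))
  simp_rw [← conv_fracKernel_one]
  rw [this]
  refine conv_congr ht.1 (fun s hs => ?_) fun _ _ => rfl
  rw [conv_fracKernel one_pos one_pos hs.1]
  norm_num

/-- Convolving the hypothesis with K_α gives K_2 * d = -λ K_{2+α} * d. Since K_2 = g_2 - λ K_{2+α},
this says g_2 * d = 0: the double primitive of d vanishes, hence so does d. -/
theorem eq_zero_of_conv_caputo (hα : 1 < α) (hα2 : α < 2) (hl : 0 < lam) (hT : 0 < T) {d : ℝ → ℝ}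
    (hd : ContinuousOn d (Set.Icc 0 T))
    (h : ∀ t ∈ Set.Icc 0 T, conv (fracKernel (2 - α)) d t = -lam * conv (fracKernel 2) d t) :
    ∀ t ∈ Set.Icc 0 T, d t = 0 := by
  have hα0 : 0 < α := by linarith
  obtain ⟨M, hM⟩ := isCompact_Icc.exists_bound_of_continuousOn hd
  have hsub : ∀ {t}, t ∈ Set.Icc 0 T → Set.Ioc 0 t ⊆ Set.Icc 0 T :=
    fun ht s hs => ⟨hs.1.le, hs.2.trans ht.2⟩
  have hassoc : ∀ (δ : ℝ), 0 < δ → ∀ t ∈ Set.Icc 0 T, conv (mlKernel α lam α) (conv (fracKernel δ) d) t =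
      conv (mlKernel α lam (δ + α)) d t := fun δ hδ t ht => by
    rw [conv_assoc ht.1 (integrableOn_mlKernel hα hα2 hα0 (by linarith) hl t)
      (integrableOn_fracKernel hδ t) ((hd.mono (hsub ht)).aestronglyMeasurable measurableSet_Ioc)
      (fun s hs => hM s (hsub ht hs))]
    refine conv_congr ht.1 (fun s hs => ?_) fun _ _ => rfl
    rw [conv_comm, conv_fracKernel_mlKernel hα0 hα0 hδ lam hs.1]
  have h2 : ∀ t ∈ Set.Icc 0 T, conv (fracKernel 2) d t = 0 := by
    intro t ht
    have e1 := hassoc (2 - α) (by linarith) t ht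
    have e2 := hassoc 2 two_pos t ht
    rw [sub_add_cancel] at e1
    have e3 : conv (mlKernel α lam α) (conv (fracKernel (2 - α)) d) t =
        -lam * conv (mlKernel α lam α) (conv (fracKernel 2) d) t := by
      rw [← conv_const_mul]
      exact conv_congr ht.1 (fun _ _ => rfl) fun s hs => h s ⟨hs.1.le, hs.2.le.trans ht.2⟩
    rw [e1, e2] at e3
    have hdi : IntegrableOn d (Set.Ioc 0 t) := (hd.integrableOn_Icc).mono_set (hsub ht)
    have hK := conv_sub_const_mul ht.1 hdi
      (continuous_mlKernel (β := 2) hα0 (by norm_num) lam).continuousOn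
      (continuous_mlKernel (β := 2 + α) hα0 (by linarith) lam).continuousOn (-lam)
    rw [conv_comm d (mlKernel α lam 2), conv_comm d (mlKernel α lam (2 + α)), e3, sub_self] at hK
    rw [← hK, conv_comm _ d]
    refine conv_congr ht.1 (fun _ _ => rfl) fun s hs => ?_
    rw [mlKernel_recurrence hα0 two_pos lam hs.1, add_comm α 2]
    ring
  have hD : ContinuousOn (fun t => ∫ s in (0 : ℝ)..t, d s) (Set.Icc 0 T) := fun t ht =>
    (hasDerivWithinAt_integral_Icc hd ht).continuousWithinAt
  refine eq_zero_of_integral_eq_zero hT hd (eq_zero_of_integral_eq_zero hT hD fun t ht => ?_)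
  rw [← conv_fracKernel_two_eq hd ht, h2 t ht]

end

/-! ### The compact resolvent and its eigenbasis -/

/-- Distinct orthonormal vectors are at distance √2 > 1, so balls of radius 1/2 around them are
disjoint, and a separable space holds only countably many. -/
theorem countable_of_orthonormal {E : Type*} [NormedAddCommGroup E] [InnerProductSpace ℝ E]
    [TopologicalSpace.SeparableSpace E] {ι : Type*} {v : ι → E} (hv : Orthonormal ℝ v) :
    Countable ι := by
  have hd : ∀ i j, i ≠ j → 1 < ‖v i - v j‖ := fun i j hij => by
    have h1 := norm_sub_sq_real (v i) (v j)
    rw [hv.1 i, hv.1 j, hv.2 hij] at h1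
    nlinarith [norm_nonneg (v i - v j)]
  have : (Set.univ : Set ι).Countable := by
    refine Set.PairwiseDisjoint.countable_of_isOpen (s := fun i => Metric.ball (v i) (1 / 2)) ?_
      (fun i _ => Metric.isOpen_ball) fun i _ => ⟨v i, Metric.mem_ball_self (by norm_num)⟩
    intro i _ j _ hij
    refine Metric.ball_disjoint_ball ?_
    rw [dist_eq_norm]
    linarith [hd i j hij]
  exact Set.countable_univ_iff.1 this

theorem secondCountable_of_totallyBounded {X : Type*} [MetricSpace X]
    (hX : TotallyBounded (Set.univ : Set X)) : SecondCountableTopology X := by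
  have : TopologicalSpace.SeparableSpace X :=
    TopologicalSpace.isSeparable_univ_iff.1 hX.isSeparable
  exact UniformSpace.secondCountable_of_separable X

theorem separableSpace_L2 {X : Type*} [MetricSpace X] [MeasurableSpace X] [BorelSpace X]
    (hX : TotallyBounded (Set.univ : Set X)) (m : Measure X) [IsFiniteMeasure m] :
    TopologicalSpace.SeparableSpace (L2 m) := by
  have := secondCountable_of_totallyBounded hX
  have : Fact ((2 : ℝ≥0∞) ≠ ⊤) := ⟨by norm_num⟩
  infer_instance

/-- Each eigenspace, the kernel included, receives its own Hilbert basis. The eigenspaces are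
mutually orthogonal and, by the spectral theorem for compact symmetric operators, nothing is
orthogonal to all of them. -/
theorem exists_hilbertBasis_eigenvectors {E : Type*} [NormedAddCommGroup E] [InnerProductSpace ℝ E]
    [CompleteSpace E] [TopologicalSpace.SeparableSpace E] {R : E →L[ℝ] E}
    (hR : IsCompactOperator R) (hS : R.IsSymmetric) :
    ∃ (ι : Set ℕ) (b : HilbertBasis ι ℝ E) (μ : ι → ℝ), ∀ i, R (b i) = μ i • b i := by
  set Eg : ℝ → Submodule ℝ E := fun μ => Module.End.eigenspace (R : Module.End ℝ E) μ with hEg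
  have hclosed : ∀ μ, IsClosed (Eg μ : Set E) := fun μ => by
    have : (Eg μ : Set E) = {x | R x = μ • x} := by
      ext x; exact Module.End.mem_eigenspace_iff
    rw [this]
    exact isClosed_eq R.continuous (by fun_prop)
  have hcompl : ∀ μ, CompleteSpace (Eg μ) := fun μ => (hclosed μ).completeSpace_coe
  have hex : ∀ μ, ∃ (w : Set (Eg μ)) (b : HilbertBasis w ℝ (Eg μ)), True := fun μ => by
    obtain ⟨w, b, _⟩ := exists_hilbertBasis ℝ (Eg μ)
    exact ⟨w, b, trivial⟩
  choose w b _ using hex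
  set v : (Σ μ, w μ) → E := fun i => (b i.1 i.2 : E) with hv
  have hon : Orthonormal ℝ v :=
    hS.orthogonalFamily_eigenspaces.orthonormal_sigma_orthonormal fun μ => (b μ).orthonormal
  have hbot : (Submodule.span ℝ (Set.range v))ᗮ = ⊥ := by
    rw [eq_bot_iff, ← ContinuousLinearMap.orthogonalComplement_iSup_eigenspaces_eq_bot hR hS]
    intro x hx
    rw [← Submodule.iInf_orthogonal, Submodule.mem_iInf]
    intro μ
    rw [Submodule.mem_orthogonal']
    intro y hy
    have h1 := ((b μ).hasSum_repr ⟨y, hy⟩).mapL ((innerSL ℝ x).comp (Eg μ).subtypeL)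
    have h2 : ∀ i, ((innerSL ℝ x).comp (Eg μ).subtypeL) ((b μ).repr ⟨y, hy⟩ i • (b μ) i) = 0 := by
      intro i
      have h3 : inner ℝ x (v ⟨μ, i⟩) = 0 :=
        (Submodule.mem_orthogonal' _ _).1 hx _ (Submodule.subset_span ⟨_, rfl⟩)
      rw [map_smul]
      simp only [ContinuousLinearMap.comp_apply, Submodule.subtypeL_apply, innerSL_apply_apply]
      rw [show inner ℝ x ((b μ i : Eg μ) : E) = 0 from h3, smul_zero]
    simp_rw [h2] at h1
    exact (h1.unique hasSum_zero)
  have hcount : Countable (Σ μ, w μ) := countable_of_orthonormal hon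
  obtain ⟨f, hf⟩ := exists_injective_nat (Σ μ, w μ)
  let e := Equiv.ofInjective f hf
  have hon' : Orthonormal ℝ (v ∘ e.symm) := hon.comp _ e.symm.injective
  have hbot' : (Submodule.span ℝ (Set.range (v ∘ e.symm)))ᗮ = ⊥ := by
    rw [e.symm.surjective.range_comp, hbot]
  refine ⟨Set.range f, HilbertBasis.mkOfOrthogonalEqBot hon' hbot', fun i => (e.symm i).1,
    fun i => ?_⟩
  rw [HilbertBasis.coe_mkOfOrthogonalEqBot]
  exact Module.End.mem_eigenspace_iff.1 (b (e.symm i).1 (e.symm i).2).2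

namespace DirichletForm

variable {X : Type*} [MeasurableSpace X] {m : Measure X}

/-- The form domain as a type of its own, to carry the form norm. -/
def FormSpace (𝓔 : DirichletForm m) : Type _ := 𝓔.dom

instance (𝓔 : DirichletForm m) : AddCommGroup 𝓔.FormSpace := inferInstanceAs (AddCommGroup 𝓔.dom)

instance (𝓔 : DirichletForm m) : Module ℝ 𝓔.FormSpace := inferInstanceAs (Module ℝ 𝓔.dom)

/-- The identification of the two types for the form domain. -/
def toDom (𝓔 : DirichletForm m) : 𝓔.FormSpace →ₗ[ℝ] 𝓔.dom := LinearMap.id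

/-- The scalar product `𝓔(a,b) + (a,b)`. -/
@[reducible]
def formCore (𝓔 : DirichletForm m) : InnerProductSpace.Core ℝ 𝓔.FormSpace where
  inner a b := 𝓔.form (𝓔.toDom a) (𝓔.toDom b) + inner ℝ (𝓔.toDom a) (𝓔.toDom b)
  conj_inner_symm a b := by
    simp only [conj_trivial]
    rw [𝓔.symm, real_inner_comm]
  re_inner_nonneg a := by
    simp only [RCLike.re_to_real]
    exact add_nonneg (𝓔.nonneg _) real_inner_self_nonneg
  add_left a b c := by
    simp only [map_add, LinearMap.add_apply, inner_add_left]
    ring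
  smul_left a b r := by
    have h : inner ℝ (r • 𝓔.toDom a) (𝓔.toDom b) = r * inner ℝ (𝓔.toDom a) (𝓔.toDom b) :=
      real_inner_smul_left (𝓔.toDom a : L2 m) (𝓔.toDom b : L2 m) r
    simp only [map_smul, LinearMap.smul_apply, smul_eq_mul, conj_trivial]
    rw [h]
    ring
  definite a h := by
    have h1 : inner ℝ (𝓔.toDom a) (𝓔.toDom a) = 0 :=
      le_antisymm (by linarith [𝓔.nonneg (𝓔.toDom a)]) real_inner_self_nonneg
    exact inner_self_eq_zero.1 h1

instance (𝓔 : DirichletForm m) : NormedAddCommGroup 𝓔.FormSpace :=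
  𝓔.formCore.toNormedAddCommGroup

instance (𝓔 : DirichletForm m) : InnerProductSpace ℝ 𝓔.FormSpace :=
  InnerProductSpace.ofCore 𝓔.formCore.toCore

theorem inner_formSpace (𝓔 : DirichletForm m) (a b : 𝓔.FormSpace) :
    inner ℝ a b = 𝓔.form (𝓔.toDom a) (𝓔.toDom b) + inner ℝ (𝓔.toDom a) (𝓔.toDom b) := rfl

theorem norm_sq_formSpace (𝓔 : DirichletForm m) (a : 𝓔.FormSpace) :
    ‖a‖ ^ 2 = 𝓔.form (𝓔.toDom a) (𝓔.toDom a) + inner ℝ (𝓔.toDom a) (𝓔.toDom a) := by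
  rw [← inner_formSpace, real_inner_self_eq_norm_sq]

/-- Closedness of the form with r = 1 is exactly completeness for the form norm. -/
instance (𝓔 : DirichletForm m) : CompleteSpace 𝓔.FormSpace := by
  refine Metric.complete_of_cauchySeq_tendsto fun a ha => ?_
  have h1 : Tendsto (fun k : ℕ × ℕ => ‖a k.1 - a k.2‖ ^ 2) atTop (𝓝 0) := by
    have := cauchySeq_iff_tendsto_dist_atTop_0.1 ha
    simp_rw [dist_eq_norm] at this
    simpa using this.pow 2
  obtain ⟨b, hb⟩ := 𝓔.closed 1 one_pos (fun n => 𝓔.toDom (a n)) (by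
    refine h1.congr fun k => ?_
    rw [norm_sq_formSpace, one_mul]
    simp only [map_sub])
  let b' : 𝓔.FormSpace := b
  refine ⟨b', tendsto_iff_norm_sub_tendsto_zero.2 ?_⟩
  have h2 : Tendsto (fun n => ‖a n - b'‖ ^ 2) atTop (𝓝 0) := by
    refine hb.congr fun n => ?_
    rw [norm_sq_formSpace, one_mul]
    rfl
  have h3 := h2.sqrt
  simpa [Real.sqrt_sq (norm_nonneg _)] using h3

/-- The embedding of the form domain in `L²`. -/
def embed (𝓔 : DirichletForm m) : 𝓔.FormSpace →L[ℝ] L2 m :=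
  (𝓔.dom.subtype ∘ₗ 𝓔.toDom).mkContinuous 1 fun a => by
    rw [one_mul]
    refine le_of_sq_le_sq ?_ (norm_nonneg _)
    rw [norm_sq_formSpace]
    have h1 : ‖(𝓔.dom.subtype ∘ₗ 𝓔.toDom) a‖ ^ 2 = inner ℝ (𝓔.toDom a) (𝓔.toDom a) :=
      (real_inner_self_eq_norm_sq (𝓔.toDom a)).symm
    linarith [𝓔.nonneg (𝓔.toDom a)]

theorem isCompactOperator_embed (𝓔 : DirichletForm m) (h : 𝓔.CompactEmbedding) :
    IsCompactOperator 𝓔.embed := by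
  refine ⟨_, h, ?_⟩
  refine mem_of_superset (Metric.closedBall_mem_nhds 0 one_pos) fun a ha => subset_closure ?_
  refine ⟨𝓔.toDom a, rfl, ?_⟩
  have h1 : ‖a‖ ≤ 1 := by simpa using ha
  have h2 := 𝓔.norm_sq_formSpace a
  have h3 : ‖a‖ ^ 2 ≤ 1 := by nlinarith [norm_nonneg a]
  rw [h2] at h3
  exact h3

/-- The operator `(A + 1)⁻¹`. -/
def resolvent (𝓔 : DirichletForm m) : L2 m →L[ℝ] L2 m :=
  𝓔.embed.comp (ContinuousLinearMap.adjoint 𝓔.embed)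

/-- The defining identity of the adjoint, read in the form scalar product, is the weak equation
(A+1)a = h for a = J*h. -/
theorem form_adjoint (𝓔 : DirichletForm m) (h : L2 m) (b : 𝓔.dom) :
    𝓔.form (𝓔.toDom (ContinuousLinearMap.adjoint 𝓔.embed h)) b + inner ℝ (𝓔.resolvent h) (b : L2 m) =
      inner ℝ h (b : L2 m) :=
  ContinuousLinearMap.adjoint_inner_left 𝓔.embed (b : 𝓔.FormSpace) h

/-- If J J*h = 0 then ‖J*h‖² = (h, J J*h) = 0, so h is orthogonal to the form domain, which is
dense. -/
theorem resolvent_injective (𝓔 : DirichletForm m) {h : L2 m} (hh : 𝓔.resolvent h = 0) : h = 0 := by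
  have h0 : ContinuousLinearMap.adjoint 𝓔.embed h = 0 := by
    rw [← inner_self_eq_zero (𝕜 := ℝ), ContinuousLinearMap.adjoint_inner_left]
    change inner ℝ h (𝓔.resolvent h) = 0
    rw [hh, inner_zero_right]
  refine 𝓔.dense_dom.eq_zero_of_inner_left ℝ fun b hb => ?_
  have := 𝓔.form_adjoint h ⟨b, hb⟩
  rw [h0, hh] at this
  simpa using this.symm

/-- `resolvent` inverts A+1, so its eigenvalue μ, nonzero by injectivity, corresponds to the
eigenvalue μ⁻¹ - 1 of A. -/
theorem operatorGraph_of_resolvent (𝓔 : DirichletForm m) {h : L2 m} {μ : ℝ} (hh : h ≠ 0)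
    (he : 𝓔.resolvent h = μ • h) : 𝓔.OperatorGraph h ((μ⁻¹ - 1) • h) := by
  have hμ : μ ≠ 0 := by
    rintro rfl
    exact hh (𝓔.resolvent_injective (by simpa using he))
  set a := 𝓔.toDom (ContinuousLinearMap.adjoint 𝓔.embed h) with ha
  have hah : h = μ⁻¹ • (a : L2 m) := by
    have : (a : L2 m) = 𝓔.resolvent h := rfl
    rw [this, he, smul_smul, inv_mul_cancel₀ hμ, one_smul]
  have hmem : h ∈ 𝓔.dom := by
    rw [hah]
    exact 𝓔.dom.smul_mem _ a.2
  refine ⟨hmem, fun b => ?_⟩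
  have e : (⟨h, hmem⟩ : 𝓔.dom) = μ⁻¹ • a := Subtype.ext hah
  have h1 := 𝓔.form_adjoint h b
  rw [he, real_inner_smul_left, ← ha] at h1
  rw [e, map_smul, LinearMap.smul_apply, smul_eq_mul, real_inner_smul_left]
  have h2 : 𝓔.form a b = (1 - μ) * inner ℝ h (b : L2 m) := by linarith
  rw [h2]
  field_simp

theorem exists_eigenSystem (𝓔 : DirichletForm m) (hcomp : 𝓔.CompactEmbedding)
    [TopologicalSpace.SeparableSpace (L2 m)] :
    ∃ ι : Set ℕ, Nonempty (𝓔.EigenSystem ι) := by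
  have hR : IsCompactOperator 𝓔.resolvent :=
    (𝓔.isCompactOperator_embed hcomp).comp_clm (ContinuousLinearMap.adjoint 𝓔.embed)
  have hS : 𝓔.resolvent.IsSymmetric := by
    have : IsSelfAdjoint 𝓔.resolvent := by
      rw [ContinuousLinearMap.isSelfAdjoint_iff', resolvent, ContinuousLinearMap.adjoint_comp,
        ContinuousLinearMap.adjoint_adjoint]
    exact this.isSymmetric
  obtain ⟨ι, b, μ, hb⟩ := exists_hilbertBasis_eigenvectors hR hS
  exact ⟨ι, ⟨⟨b, fun i => (μ i)⁻¹ - 1, fun i =>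
    𝓔.operatorGraph_of_resolvent (b.orthonormal.ne_zero i) (hb i)⟩⟩⟩

end DirichletForm

/-! ### Coordinates in V_s, its dual and the form domain -/

section Multiplier

variable {ι : Type*}

theorem memℓp_mul_of_bound {c : ι → ℝ} {M : ℝ} (hc : ∀ i, |c i| ≤ M) {x : ι → ℝ}
    (hx : Memℓp x 2) : Memℓp (fun i => c i * x i) 2 := by
  have h2 : (0 : ℝ) < (2 : ℝ≥0∞).toReal := by norm_num
  have hx' := Memℓp.const_smul (𝕜 := ℝ) hx M
  rw [memℓp_gen_iff h2] at hx' ⊢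
  refine Summable.of_nonneg_of_le (fun i => by positivity) (fun i => ?_) hx'
  simp only [Pi.smul_apply, smul_eq_mul, norm_mul]
  gcongr
  exact (hc i).trans (le_abs_self M)

/-- The multiplication operator on `ℓ²` with a bounded sequence. -/
def mulLp (c : ι → ℝ) (M : ℝ) (hc : ∀ i, |c i| ≤ M) :
    lp (fun _ : ι => ℝ) 2 →L[ℝ] lp (fun _ : ι => ℝ) 2 :=
  LinearMap.mkContinuous
    { toFun := fun x => ⟨fun i => c i * x i, memℓp_mul_of_bound hc x.2⟩
      map_add' := fun x y => by
        ext i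
        simp only [lp.coeFn_add, Pi.add_apply, mul_add]
      map_smul' := fun r x => by
        ext i
        simp only [lp.coeFn_smul, Pi.smul_apply, smul_eq_mul, RingHom.id_apply]
        ring } |M| fun x => by
    rw [← norm_smul_of_nonneg (abs_nonneg M)]
    refine lp.norm_mono (by norm_num) fun i => ?_
    simp only [LinearMap.coe_mk, AddHom.coe_mk, lp.coeFn_smul, Pi.smul_apply, smul_eq_mul, norm_mul,
      norm_abs_eq_norm]
    gcongr
    exact (hc i).trans (le_abs_self M)

theorem mulLp_apply (c : ι → ℝ) (M : ℝ) (hc : ∀ i, |c i| ≤ M) (x : lp (fun _ : ι => ℝ) 2) (i : ι) :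
    mulLp c M hc x i = c i * x i := rfl

end Multiplier

namespace DirichletForm.EigenSystem

universe u v

variable {X : Type u} [MeasurableSpace X] {m : Measure X} {𝓔 : DirichletForm m} {ι : Type v}

theorem inner_repr_symm (S : 𝓔.EigenSystem ι) (x : lp (fun _ : ι => ℝ) 2) (i : ι) :
    inner ℝ (S.φ i) (S.φ.repr.symm x) = x i := by
  rw [← S.φ.repr_apply_apply, LinearIsometryEquiv.apply_symm_apply]

theorem eq_of_inner (S : 𝓔.EigenSystem ι) {h k : L2 m}
    (hh : ∀ i, inner ℝ (S.φ i) h = inner ℝ (S.φ i) k) : h = k := by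
  rw [← sub_eq_zero]
  refine S.eq_zero_of_inner fun i => ?_
  rw [inner_sub_right, hh i, sub_self]

theorem toL2_basisVec (S : 𝓔.EigenSystem ι) (s : ℝ) (i : ι) : S.toL2 (S.basisVec s i) = S.φ i := rfl

theorem form_eigen (S : 𝓔.EigenSystem ι) (i : ι) (b : 𝓔.dom) :
    𝓔.form ⟨S.φ i, (S.eig i).choose⟩ b = S.lam i * inner ℝ (S.φ i) (b : L2 m) := by
  rw [(S.eig i).choose_spec b, real_inner_smul_left]

theorem form_basis_right (S : 𝓔.EigenSystem ι) (i : ι) (a : 𝓔.dom) (h : S.φ i ∈ 𝓔.dom) :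
    𝓔.form a ⟨S.φ i, h⟩ = S.lam i * inner ℝ (S.φ i) (a : L2 m) := by
  rw [𝓔.symm]
  exact S.form_eigen i a

theorem coord_smul_basisVec [DecidableEq ι] (S : 𝓔.EigenSystem ι) (s c : ℝ) (i : ι) :
    S.coord s (c • S.basisVec s i) = lp.single 2 i (S.lam i ^ s * c) := by
  ext j
  rw [coord_apply, map_smul, toL2_basisVec, real_inner_smul_right, lp.single_apply]
  by_cases h : j = i
  · subst h
    simp [S.φ.orthonormal.1 j]
  · have : inner ℝ (S.φ j) (S.φ i) = (0 : ℝ) := S.φ.orthonormal.2 h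
    rw [this, Pi.single_eq_of_ne h, mul_zero, mul_zero]

/-- The eigenfunctions, normalized in the form norm. -/
def formVec (S : 𝓔.EigenSystem ι) (i : ι) : 𝓔.FormSpace :=
  (Real.sqrt (S.lam i + 1))⁻¹ • (show 𝓔.FormSpace from (⟨S.φ i, (S.eig i).choose⟩ : 𝓔.dom))

theorem embed_formVec (S : 𝓔.EigenSystem ι) (i : ι) :
    𝓔.embed (S.formVec i) = (Real.sqrt (S.lam i + 1))⁻¹ • S.φ i := by
  rw [formVec, map_smul]
  rfl

variable [hF : Fact (0 < 𝓔.firstEigenvalue)]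

theorem abs_rpow_neg_le (S : 𝓔.EigenSystem ι) {s : ℝ} (hs : 0 ≤ s) (i : ι) :
    |S.lam i ^ (-s)| ≤ 𝓔.firstEigenvalue ^ (-s) := by
  rw [abs_of_nonneg (Real.rpow_nonneg (S.lam_pos i).le _)]
  exact Real.rpow_le_rpow_of_nonpos hF.out (S.le_lam i) (by linarith)

theorem lam_rpow_mul_rpow_neg (S : 𝓔.EigenSystem ι) (s : ℝ) (i : ι) :
    S.lam i ^ s * S.lam i ^ (-s) = 1 := by
  rw [← Real.rpow_add (S.lam_pos i), add_neg_cancel, Real.rpow_zero]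

/-- The element of `V_s` with the given coordinates `(λ_i^s (h, φ_i))_i` in `ℓ²`. -/
def ofCoord (S : 𝓔.EigenSystem ι) {s : ℝ} (hs : 0 ≤ s) (x : lp (fun _ : ι => ℝ) 2) : S.Space s :=
  ⟨S.φ.repr.symm (mulLp (fun i => S.lam i ^ (-s)) _ (S.abs_rpow_neg_le hs) x), by
    change Memℓp _ 2
    simp_rw [inner_repr_symm, mulLp_apply, ← mul_assoc, lam_rpow_mul_rpow_neg, one_mul]
    exact x.2⟩

theorem inner_toL2_ofCoord (S : 𝓔.EigenSystem ι) {s : ℝ} (hs : 0 ≤ s)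
    (x : lp (fun _ : ι => ℝ) 2) (i : ι) :
    inner ℝ (S.φ i) (S.toL2 (S.ofCoord hs x)) = S.lam i ^ (-s) * x i :=
  S.inner_repr_symm _ i

theorem coord_ofCoord (S : 𝓔.EigenSystem ι) {s : ℝ} (hs : 0 ≤ s) (x : lp (fun _ : ι => ℝ) 2) :
    S.coord s (S.ofCoord hs x) = x := by
  ext i
  rw [coord_apply, inner_toL2_ofCoord, ← mul_assoc, lam_rpow_mul_rpow_neg, one_mul]

theorem norm_ofCoord (S : 𝓔.EigenSystem ι) {s : ℝ} (hs : 0 ≤ s) (x : lp (fun _ : ι => ℝ) 2) :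
    ‖S.ofCoord hs x‖ = ‖x‖ := by
  rw [norm_def, coord_ofCoord]

theorem isometry_coord (S : 𝓔.EigenSystem ι) (s : ℝ) : Isometry (S.coord s) :=
  AddMonoidHomClass.isometry_of_norm _ fun _ => rfl

theorem continuous_ofCoord (S : 𝓔.EigenSystem ι) {s : ℝ} (hs : 0 ≤ s) :
    Continuous (S.ofCoord hs) := by
  rw [(S.isometry_coord s).isUniformInducing.isInducing.continuous_iff]
  simp_rw [Function.comp_def, coord_ofCoord]
  exact continuous_id

theorem hasSum_basisVec (S : 𝓔.EigenSystem ι) {s : ℝ} (h : S.Space s) :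
    HasSum (fun i => inner ℝ (S.φ i) (S.toL2 h) • S.basisVec s i) h := by
  classical
  rw [← (S.isometry_coord s).isUniformInducing.isInducing.hasSum_iff (g := (S.coord s))]
  simp_rw [Function.comp_def, coord_smul_basisVec, ← coord_apply]
  exact lp.hasSum_single (by norm_num) _

/-- Finite combinations of eigenfunctions are dense in V_s, so identities in V_{-s} may be checked
mode by mode. -/
theorem dual_ext (S : 𝓔.EigenSystem ι) {s : ℝ} {L M : S.Dual s}
    (h : ∀ i, L (S.basisVec s i) = M (S.basisVec s i)) : L = M := by
  ext w
  refine ((S.hasSum_basisVec w).mapL L).unique ?_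
  refine ((S.hasSum_basisVec w).mapL M).congr_fun fun i => ?_
  rw [map_smul, map_smul, h]

/-- The isometry of `V_s` into `ℓ²` as a continuous linear map. -/
def coordL (S : 𝓔.EigenSystem ι) (s : ℝ) : S.Space s →L[ℝ] lp (fun _ : ι => ℝ) 2 :=
  (S.coord s).mkContinuous 1 fun h => by rw [one_mul]; exact (S.norm_def h).ge

/-- The functional `h ↦ ∑ y_i λ_i^s (h, φ_i)` on `V_s`. -/
def seqDual (S : 𝓔.EigenSystem ι) (s : ℝ) : lp (fun _ : ι => ℝ) 2 →L[ℝ] S.Dual s :=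
  ((ContinuousLinearMap.compL ℝ (S.Space s) (lp (fun _ : ι => ℝ) 2) ℝ).flip (S.coordL s)).comp
    (innerSL ℝ)

theorem seqDual_apply (S : 𝓔.EigenSystem ι) {s : ℝ} (y : lp (fun _ : ι => ℝ) 2) (h : S.Space s) :
    S.seqDual s y h = inner ℝ y (S.coord s h) := rfl

theorem norm_seqDual_le (S : 𝓔.EigenSystem ι) {s : ℝ} (y : lp (fun _ : ι => ℝ) 2) :
    ‖S.seqDual s y‖ ≤ ‖y‖ := by
  refine ContinuousLinearMap.opNorm_le_bound _ (norm_nonneg _) fun h => ?_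
  rw [seqDual_apply, norm_def]
  exact norm_inner_le_norm _ _

theorem hasSum_seqDual (S : 𝓔.EigenSystem ι) {s : ℝ} (y : lp (fun _ : ι => ℝ) 2) (h : S.Space s) :
    HasSum (fun i => y i * (S.lam i ^ s * inner ℝ (S.φ i) (S.toL2 h))) (S.seqDual s y h) := by
  refine (lp.hasSum_inner y (S.coord s h)).congr_fun fun i => ?_
  rw [coord_apply, RCLike.inner_apply, conj_trivial, mul_comm]

theorem seqDual_basisVec (S : 𝓔.EigenSystem ι) {s : ℝ} (y : lp (fun _ : ι => ℝ) 2) (i : ι) :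
    S.seqDual s y (S.basisVec s i) = S.lam i ^ s * y i := by
  classical
  have := S.coord_smul_basisVec s 1 i
  rw [one_smul, mul_one] at this
  rw [seqDual_apply, this, lp.inner_single_right, RCLike.inner_apply, conj_trivial]

/-- The eigenvalue equation makes the form product with φ_i equal to λ_i + 1 times the L² product;
this explains the normalization by √(λ_i + 1). -/
theorem inner_formVec (S : 𝓔.EigenSystem ι) (i : ι) (b : 𝓔.FormSpace) :
    inner ℝ (S.formVec i) b = Real.sqrt (S.lam i + 1) * inner ℝ (S.φ i) (𝓔.embed b) := by
  have hl : 0 < S.lam i + 1 := by linarith [S.lam_pos i]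
  have h1 : inner ℝ (show 𝓔.FormSpace from (⟨S.φ i, (S.eig i).choose⟩ : 𝓔.dom)) b =
      (S.lam i + 1) * inner ℝ (S.φ i) (𝓔.embed b) := by
    have h2 := S.form_eigen i (𝓔.toDom b)
    rw [add_mul, one_mul]
    exact congrArg₂ (· + ·) h2 rfl
  rw [formVec, real_inner_smul_left, h1, ← mul_assoc]
  congr 1
  nth_rewrite 2 [← Real.mul_self_sqrt hl.le]
  have := (Real.sqrt_pos.2 hl).ne'
  field_simp

theorem orthonormal_formVec (S : 𝓔.EigenSystem ι) : Orthonormal ℝ S.formVec := by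
  classical
  rw [orthonormal_iff_ite]
  intro i j
  have hl : 0 < S.lam i + 1 := by linarith [S.lam_pos i]
  rw [inner_formVec, embed_formVec, real_inner_smul_right, orthonormal_iff_ite.1 S.φ.orthonormal i j]
  by_cases h : i = j
  · subst h
    simp [mul_inv_cancel₀ (Real.sqrt_pos.2 hl).ne']
  · simp [h]

/-- The Hilbert basis of the form domain given by the normalized eigenfunctions. -/
def formBasis (S : 𝓔.EigenSystem ι) : HilbertBasis ι ℝ 𝓔.FormSpace :=
  HilbertBasis.mkOfOrthogonalEqBot S.orthonormal_formVec (by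
    rw [eq_bot_iff]
    intro a ha
    have h0 : 𝓔.embed a = 0 := S.eq_zero_of_inner fun i => by
      have h1 := (Submodule.mem_orthogonal _ _).1 ha _ (Submodule.subset_span ⟨i, rfl⟩)
      rw [inner_formVec] at h1
      have hl : 0 < S.lam i + 1 := by linarith [S.lam_pos i]
      exact (mul_eq_zero.1 h1).resolve_left (Real.sqrt_pos.2 hl).ne'
    exact Subtype.ext h0)

theorem formBasis_apply (S : 𝓔.EigenSystem ι) (i : ι) : S.formBasis i = S.formVec i := by
  rw [formBasis, HilbertBasis.coe_mkOfOrthogonalEqBot]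

/-- Parseval in the form domain has weights λ_i + 1, Parseval in L² has weights 1; the difference is
the form. -/
theorem hasSum_form (S : 𝓔.EigenSystem ι) (a b : 𝓔.dom) :
    HasSum (fun i => S.lam i * (inner ℝ (S.φ i) (a : L2 m) * inner ℝ (S.φ i) (b : L2 m)))
      (𝓔.form a b) := by
  have h1 := S.formBasis.hasSum_inner_mul_inner (show 𝓔.FormSpace from a) (show 𝓔.FormSpace from b)
  have h2 := S.φ.hasSum_inner_mul_inner (a : L2 m) (b : L2 m)
  have h3 := h1.sub h2
  have e : inner ℝ (show 𝓔.FormSpace from a) (show 𝓔.FormSpace from b) -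
      inner ℝ (a : L2 m) (b : L2 m) = 𝓔.form a b := add_sub_cancel_right _ _
  rw [e] at h3
  refine h3.congr_fun fun i => ?_
  have hl : 0 < S.lam i + 1 := by linarith [S.lam_pos i]
  rw [formBasis_apply, real_inner_comm (S.formVec i), inner_formVec, inner_formVec,
    real_inner_comm (S.φ i) (a : L2 m)]
  have e1 : 𝓔.embed (show 𝓔.FormSpace from a) = (a : L2 m) := rfl
  have e2 : 𝓔.embed (show 𝓔.FormSpace from b) = (b : L2 m) := rfl
  rw [e1, e2]
  linear_combination (-(inner ℝ (S.φ i) (a : L2 m) * inner ℝ (S.φ i) (b : L2 m))) *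
    (Real.mul_self_sqrt hl.le)

/-- As λ_i + 1 ≤ (1 + λ₁⁻¹) λ_i, the numbers √(λ_i + 1)(h, φ_i) are square summable. They are the
coordinates of a form-domain element with the same L² coefficients as h. -/
theorem V_half_le_dom (S : 𝓔.EigenSystem ι) : S.V (1 / 2) ≤ 𝓔.dom := by
  intro h hh
  have hx : Memℓp (fun i => S.lam i ^ (1 / 2 : ℝ) * inner ℝ (S.φ i) h) 2 := hh
  have hb : ∀ i, |Real.sqrt (S.lam i + 1) * S.lam i ^ (-(1 / 2 : ℝ))| ≤
      Real.sqrt (1 + 𝓔.firstEigenvalue⁻¹) := fun i => by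
    have hl := S.lam_pos i
    rw [abs_of_nonneg (by positivity), Real.rpow_neg hl.le, ← Real.sqrt_eq_rpow, ← Real.sqrt_inv,
      ← Real.sqrt_mul (by positivity)]
    apply Real.sqrt_le_sqrt
    rw [add_mul, one_mul, mul_inv_cancel₀ hl.ne']
    have := inv_anti₀ hF.out (S.le_lam i)
    linarith
  have hy : Memℓp (fun i => Real.sqrt (S.lam i + 1) * inner ℝ (S.φ i) h) 2 := by
    have e : (fun i => Real.sqrt (S.lam i + 1) * inner ℝ (S.φ i) h) = fun i =>
        Real.sqrt (S.lam i + 1) * S.lam i ^ (-(1 / 2 : ℝ)) *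
          (S.lam i ^ (1 / 2 : ℝ) * inner ℝ (S.φ i) h) := by
      funext i
      linear_combination (-(Real.sqrt (S.lam i + 1) * inner ℝ (S.φ i) h)) *
        S.lam_rpow_mul_rpow_neg (1 / 2) i
    rw [e]
    exact memℓp_mul_of_bound hb hx
  set a : 𝓔.FormSpace := S.formBasis.repr.symm ⟨_, hy⟩ with ha
  have e : 𝓔.embed a = h := S.eq_of_inner fun i => by
    have h1 : inner ℝ (S.formBasis i) a = Real.sqrt (S.lam i + 1) * inner ℝ (S.φ i) h := by
      rw [← S.formBasis.repr_apply_apply, ha, LinearIsometryEquiv.apply_symm_apply]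
    rw [formBasis_apply, inner_formVec] at h1
    have hl : 0 < S.lam i + 1 := by linarith [S.lam_pos i]
    exact mul_left_cancel₀ (Real.sqrt_pos.2 hl).ne' h1
  rw [← e]
  exact (𝓔.toDom a).2

theorem toL2_mem_dom (S : 𝓔.EigenSystem ι) {s : ℝ} (hs : 1 / 2 ≤ s) (h : S.Space s) :
    S.toL2 h ∈ 𝓔.dom := S.V_half_le_dom (S.V_anti hs (S.toL2_mem h))

end DirichletForm.EigenSystem

/-! ### Square-summable families of convolutions -/

/-- For κ = 2 - α the condition κp < 1 is p < 1/(2-α), and t^{1/p-κ} is the power of t in front of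
the source norm. -/
theorem memLp_rpow_sub {κ p t : ℝ} (hp : 1 ≤ p) (hκ : κ * p < 1) (ht : 0 < t) :
    MemLp (fun τ : ℝ => (t - τ) ^ (-κ)) (ENNReal.ofReal p) (volume.restrict (Set.Ioc 0 t)) ∧
    (eLpNorm (fun τ : ℝ => (t - τ) ^ (-κ)) (ENNReal.ofReal p)
      (volume.restrict (Set.Ioc 0 t))).toReal = ((1 - κ * p)⁻¹) ^ p⁻¹ * t ^ (1 / p - κ) := by
  have hp0 : 0 < p := by linarith
  have hpr : (ENNReal.ofReal p).toReal = p := ENNReal.toReal_ofReal hp0.le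
  have hm : AEStronglyMeasurable (fun τ : ℝ => (t - τ) ^ (-κ)) (volume.restrict (Set.Ioc 0 t)) :=
    Measurable.aestronglyMeasurable (by fun_prop)
  have hcongr : ∀ τ ∈ Set.Ioc 0 t, (t - τ) ^ (-(κ * p)) = ‖(t - τ) ^ (-κ)‖ ^ p := fun τ hτ => by
    have h0 : 0 ≤ t - τ := by linarith [hτ.2]
    rw [Real.norm_of_nonneg (Real.rpow_nonneg h0 _), ← Real.rpow_mul h0, neg_mul]
  have hi : IntegrableOn (fun τ : ℝ => (t - τ) ^ (-(κ * p))) (Set.Ioc 0 t) := by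
    have h1 : IntervalIntegrable (fun r : ℝ => r ^ (-(κ * p))) volume 0 t :=
      intervalIntegral.intervalIntegrable_rpow' (by linarith)
    have h2 := (h1.comp_sub_left t).symm
    simp only [sub_zero, sub_self] at h2
    exact (intervalIntegrable_iff_integrableOn_Ioc_of_le ht.le).1 h2
  have hmem : MemLp (fun τ : ℝ => (t - τ) ^ (-κ)) (ENNReal.ofReal p)
      (volume.restrict (Set.Ioc 0 t)) := by
    rw [← integrable_norm_rpow_iff hm (by simpa using hp0) (by simp), hpr]
    exact hi.congr_fun hcongr measurableSet_Ioc
  refine ⟨hmem, ?_⟩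
  rw [hmem.eLpNorm_eq_integral_rpow_norm (by simpa using hp0) (by simp), hpr,
    ← setIntegral_congr_fun measurableSet_Ioc hcongr, ← intervalIntegral.integral_of_le ht.le,
    intervalIntegral.integral_comp_sub_left (fun r => r ^ (-(κ * p))) t, sub_self, sub_zero,
    integral_rpow (Or.inl (by linarith)), Real.zero_rpow (by linarith), sub_zero,
    ENNReal.toReal_ofReal (by
      have : 0 < -(κ * p) + 1 := by linarith
      positivity), div_eq_mul_inv,
    Real.mul_rpow (by positivity) (inv_nonneg.2 (by linarith)), ← Real.rpow_mul ht.le, mul_comm]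
  congr 2
  · ring_nf
  · field_simp
    ring

theorem integrableOn_rpow_mul_and_le {κ p t T : ℝ} {q : ℝ≥0∞} (hp : 1 ≤ p) (hκ : κ * p < 1)
    (hpq : ENNReal.HolderConjugate (ENNReal.ofReal p) q) (ht : 0 < t) (htT : t ≤ T) {g : ℝ → ℝ}
    (hg : MemLp g q (volume.restrict (Set.Ioo 0 T))) :
    IntegrableOn (fun τ => (t - τ) ^ (-κ) * g τ) (Set.Ioc 0 t) ∧
    ∫ τ in Set.Ioc 0 t, |(t - τ) ^ (-κ) * g τ| ≤ ((1 - κ * p)⁻¹) ^ p⁻¹ * t ^ (1 / p - κ) *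
      (eLpNorm g q (volume.restrict (Set.Ioo 0 T))).toReal := by
  obtain ⟨hr, hrn⟩ := memLp_rpow_sub hp hκ ht
  have hle : volume.restrict (Set.Ioc 0 t) ≤ volume.restrict (Set.Ioo 0 T) := by
    rw [← restrict_Ioo_eq_restrict_Ioc]
    exact Measure.restrict_mono (Set.Ioo_subset_Ioo_right htT) le_rfl
  have hg' : MemLp g q (volume.restrict (Set.Ioc 0 t)) := hg.mono_measure hle
  have hmul : MemLp (fun τ => (t - τ) ^ (-κ) * g τ) 1 (volume.restrict (Set.Ioc 0 t)) :=
    hg'.smul hr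
  refine ⟨memLp_one_iff_integrable.1 hmul, ?_⟩
  have h1 := eLpNorm_smul_le_mul_eLpNorm (p := ENNReal.ofReal p) (q := q) (r := 1) hg'.1 hr.1
  rw [← hrn]
  have e : ∫ τ in Set.Ioc 0 t, |(t - τ) ^ (-κ) * g τ| =
      (eLpNorm (fun τ => (t - τ) ^ (-κ) * g τ) 1 (volume.restrict (Set.Ioc 0 t))).toReal := by
    rw [eLpNorm_one_eq_lintegral_enorm, ← integral_norm_eq_lintegral_enorm hmul.1]
    rfl
  rw [e, ← ENNReal.toReal_mul]
  refine ENNReal.toReal_mono (ENNReal.mul_ne_top hr.2.ne hg.2.ne) (h1.trans ?_)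
  gcongr

/-- Minkowski's inequality by duality: the vector c of convolutions is paired with itself, finite
sum and integral are exchanged, and Cauchy–Schwarz under the integral gives N² ≤ N · C∫|…| with N =
|c|. -/
theorem sum_sq_conv_le {ι : Type*} {k f : ι → ℝ → ℝ} {g : ℝ → ℝ} {C κ t : ℝ} (ht : 0 ≤ t)
    (hC : 0 ≤ C) (hkc : ∀ i, ContinuousOn (k i) (Set.Ioi 0))
    (hk : ∀ i r, 0 < r → |k i r| ≤ C * r ^ (-κ))
    (hf : ∀ i, AEStronglyMeasurable (f i) (volume.restrict (Set.Ioc 0 t)))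
    (hg : IntegrableOn (fun τ => (t - τ) ^ (-κ) * g τ) (Set.Ioc 0 t)) (s : Finset ι)
    (hg0 : ∀ τ, 0 ≤ g τ) (hfg : ∀ τ, ∑ i ∈ s, f i τ ^ 2 ≤ g τ ^ 2) :
    ∑ i ∈ s, conv (k i) (f i) t ^ 2 ≤ (C * ∫ τ in Set.Ioc 0 t, |(t - τ) ^ (-κ) * g τ|) ^ 2 := by
  set c : ι → ℝ := fun i => conv (k i) (f i) t with hc
  have hfi : ∀ i ∈ s, ∀ τ, |f i τ| ≤ g τ := fun i hi τ => abs_le_of_sq_le_sq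
    ((Finset.single_le_sum (fun j _ => sq_nonneg (f j τ)) hi).trans (hfg τ)) (hg0 τ)
  have hkm : ∀ i, AEStronglyMeasurable (fun τ => k i (t - τ)) (volume.restrict (Set.Ioc 0 t)) := by
    intro i
    rw [← restrict_Ioo_eq_restrict_Ioc]
    refine ContinuousOn.aestronglyMeasurable ?_ measurableSet_Ioo
    exact (hkc i).comp (by fun_prop) fun τ hτ => by
      have := hτ.2
      simpa using this
  have hbd : ∀ τ ∈ Set.Ioo 0 t, ∀ i ∈ s, |k i (t - τ)| ≤ C * (t - τ) ^ (-κ) := fun τ hτ i _ =>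
    hk i (t - τ) (by linarith [hτ.2])
  have hinteg : ∀ i ∈ s, IntegrableOn (fun τ => k i (t - τ) * f i τ) (Set.Ioc 0 t) := by
    intro i hi
    refine Integrable.mono' (hg.const_mul C) ((hkm i).mul (hf i)) ?_
    rw [← restrict_Ioo_eq_restrict_Ioc]
    filter_upwards [self_mem_ae_restrict measurableSet_Ioo] with τ hτ
    rw [norm_mul, ← mul_assoc]
    have h0 : 0 ≤ (t - τ) ^ (-κ) := Real.rpow_nonneg (by linarith [hτ.2]) _
    exact mul_le_mul (hbd τ hτ i hi) (hfi i hi τ) (abs_nonneg _) (by positivity)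
  set N : ℝ := Real.sqrt (∑ i ∈ s, c i ^ 2) with hN
  have hN0 : 0 ≤ N := Real.sqrt_nonneg _
  have hNsq : N ^ 2 = ∑ i ∈ s, c i ^ 2 := Real.sq_sqrt (Finset.sum_nonneg fun i _ => sq_nonneg _)
  have e1 : ∑ i ∈ s, c i ^ 2 = ∫ τ in Set.Ioc 0 t, ∑ i ∈ s, c i * (k i (t - τ) * f i τ) := by
    rw [integral_finsetSum _ fun i hi => (hinteg i hi).const_mul (c i)]
    refine Finset.sum_congr rfl fun i _ => ?_
    rw [integral_const_mul, sq, ← intervalIntegral.integral_of_le ht]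
    rfl
  have hpt : ∀ τ ∈ Set.Ioo 0 t, ∑ i ∈ s, c i * (k i (t - τ) * f i τ) ≤
      N * (C * |(t - τ) ^ (-κ) * g τ|) := by
    intro τ hτ
    have h0 : 0 ≤ (t - τ) ^ (-κ) := Real.rpow_nonneg (by linarith [hτ.2]) _
    rw [abs_of_nonneg (mul_nonneg h0 (hg0 τ))]
    refine (Real.sum_mul_le_sqrt_mul_sqrt s _ _).trans ?_
    refine mul_le_mul_of_nonneg_left ?_ hN0
    rw [← mul_assoc]
    refine Real.sqrt_le_iff.2 ⟨mul_nonneg (mul_nonneg hC h0) (hg0 τ), ?_⟩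
    calc ∑ i ∈ s, (k i (t - τ) * f i τ) ^ 2 ≤ ∑ i ∈ s, (C * (t - τ) ^ (-κ)) ^ 2 * f i τ ^ 2 := by
          refine Finset.sum_le_sum fun i hi => ?_
          rw [mul_pow]
          refine mul_le_mul_of_nonneg_right ?_ (sq_nonneg _)
          exact sq_le_sq' (neg_le_of_abs_le (hbd τ hτ i hi)) (le_of_abs_le (hbd τ hτ i hi))
      _ = (C * (t - τ) ^ (-κ)) ^ 2 * ∑ i ∈ s, f i τ ^ 2 := (Finset.mul_sum _ _ _).symm
      _ ≤ (C * (t - τ) ^ (-κ)) ^ 2 * g τ ^ 2 := by gcongr; exact hfg τ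
      _ = _ := by ring
  have e2 : N ^ 2 ≤ N * (C * ∫ τ in Set.Ioc 0 t, |(t - τ) ^ (-κ) * g τ|) := by
    rw [hNsq, e1, ← integral_const_mul, ← integral_const_mul, integral_Ioc_eq_integral_Ioo,
      integral_Ioc_eq_integral_Ioo]
    refine setIntegral_mono_on ?_ ?_ measurableSet_Ioo hpt
    · exact IntegrableOn.mono_set (integrable_finsetSum _ fun i hi => (hinteg i hi).const_mul (c i))
        Set.Ioo_subset_Ioc_self
    · exact ((hg.mono_set Set.Ioo_subset_Ioc_self).norm.const_mul C).const_mul N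
  have hI : 0 ≤ C * ∫ τ in Set.Ioc 0 t, |(t - τ) ^ (-κ) * g τ| :=
    mul_nonneg hC (integral_nonneg fun τ => abs_nonneg _)
  rw [← hNsq]
  rcases hN0.eq_or_lt with h | h
  · rw [← h, zero_pow two_ne_zero]
    exact sq_nonneg _
  · have h3 : N ≤ C * ∫ τ in Set.Ioc 0 t, |(t - τ) ^ (-κ) * g τ| := by
      rw [sq] at e2
      exact le_of_mul_le_mul_left e2 h
    gcongr

/-- Dominated convergence for the series of squared differences, each at most (2|y_i|)². -/
theorem continuousOn_lp_of_dominated {ι : Type*} {x : ℝ → lp (fun _ : ι => ℝ) 2} {A : Set ℝ}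
    {y : lp (fun _ : ι => ℝ) 2} (hx : ∀ i, ContinuousOn (fun t => x t i) A)
    (hy : ∀ t ∈ A, ∀ i, |x t i| ≤ |y i|) : ContinuousOn x A := by
  intro t₀ ht₀
  have h2 : (0 : ℝ) < (2 : ℝ≥0∞).toReal := by norm_num
  rw [ContinuousWithinAt, tendsto_iff_norm_sub_tendsto_zero]
  have hsum : Summable fun i => (2 * |y i|) ^ 2 := by
    have := ((lp.memℓp y).summable h2).mul_left 4
    refine this.congr fun i => ?_
    simp only [ENNReal.toReal_ofNat, Real.rpow_two, Real.norm_eq_abs]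
    ring
  have h3 : Tendsto (fun t => ∑' i, (x t i - x t₀ i) ^ 2) (𝓝[A] t₀) (𝓝 (∑' _ : ι, (0 : ℝ))) := by
    refine tendsto_tsum_of_dominated_convergence hsum (fun i => ?_) ?_
    · have : ContinuousWithinAt (fun t => (x t i - x t₀ i) ^ 2) A t₀ :=
        ((hx i t₀ ht₀).sub continuousWithinAt_const).pow 2
      simpa [ContinuousWithinAt] using this
    · filter_upwards [self_mem_nhdsWithin] with t ht i
      rw [norm_pow, Real.norm_eq_abs]
      gcongr
      have := abs_sub (x t i) (x t₀ i)
      linarith [hy t ht i, hy t₀ ht₀ i]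
  rw [tsum_zero] at h3
  have h4 := h3.sqrt
  rw [Real.sqrt_zero] at h4
  refine h4.congr fun t => ?_
  rw [lp.norm_eq_tsum_rpow h2]
  simp [Real.sqrt_eq_rpow]

variable {ι : Type*} {H : Type*} [NormedAddCommGroup H] [InnerProductSpace ℝ H]

theorem sum_inner_sq_le (b : HilbertBasis ι ℝ H) (x : H) (s : Finset ι) :
    ∑ i ∈ s, (inner ℝ (b i) x : ℝ) ^ 2 ≤ ‖x‖ ^ 2 := by
  have := b.orthonormal.sum_inner_products_le (x := x) (s := s)
  simpa using this

theorem hasSum_inner_sq (b : HilbertBasis ι ℝ H) (x : H) :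
    HasSum (fun i => (inner ℝ (b i) x : ℝ) ^ 2) (‖x‖ ^ 2) := by
  have := b.hasSum_inner_mul_inner x x
  rw [real_inner_self_eq_norm_sq] at this
  refine this.congr_fun fun i => ?_
  rw [real_inner_comm, sq]

/-- The norm of the part of `x` in the closed span of the `b i`, `i ∉ s`. -/
def tailNorm (b : HilbertBasis ι ℝ H) (s : Finset ι) (x : H) : ℝ :=
  Real.sqrt (‖x‖ ^ 2 - ∑ i ∈ s, (inner ℝ (b i) x : ℝ) ^ 2)

theorem tailNorm_nonneg (b : HilbertBasis ι ℝ H) (s : Finset ι) (x : H) : 0 ≤ tailNorm b s x :=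
  Real.sqrt_nonneg _

theorem tailNorm_sq (b : HilbertBasis ι ℝ H) (s : Finset ι) (x : H) :
    tailNorm b s x ^ 2 = ‖x‖ ^ 2 - ∑ i ∈ s, (inner ℝ (b i) x : ℝ) ^ 2 :=
  Real.sq_sqrt (by linarith [sum_inner_sq_le b x s])

theorem tailNorm_le (b : HilbertBasis ι ℝ H) (s : Finset ι) (x : H) : tailNorm b s x ≤ ‖x‖ :=
  Real.sqrt_le_iff.2 ⟨norm_nonneg _, by
    linarith [Finset.sum_nonneg fun i (_ : i ∈ s) => sq_nonneg (inner ℝ (b i) x)]⟩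

theorem tailNorm_empty (b : HilbertBasis ι ℝ H) (x : H) : tailNorm b ∅ x = ‖x‖ := by
  simp [tailNorm]

theorem sum_sdiff_le_tailNorm [DecidableEq ι] (b : HilbertBasis ι ℝ H) (s s' : Finset ι) (x : H) :
    ∑ i ∈ s' \ s, (inner ℝ (b i) x : ℝ) ^ 2 ≤ tailNorm b s x ^ 2 := by
  rw [tailNorm_sq]
  have h1 := sum_inner_sq_le b x ((s' \ s) ∪ s)
  rw [Finset.sum_union Finset.sdiff_disjoint] at h1
  linarith

theorem continuous_tailNorm (b : HilbertBasis ι ℝ H) (s : Finset ι) : Continuous (tailNorm b s) := by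
  unfold tailNorm
  fun_prop

theorem tendsto_tailNorm (b : HilbertBasis ι ℝ H) (x : H) :
    Tendsto (fun s => tailNorm b s x) atTop (𝓝 0) := by
  have h : Tendsto (fun s : Finset ι => ‖x‖ ^ 2 - ∑ i ∈ s, (inner ℝ (b i) x : ℝ) ^ 2) atTop
      (𝓝 (‖x‖ ^ 2 - ‖x‖ ^ 2)) := tendsto_const_nhds.sub (hasSum_inner_sq b x)
  rw [sub_self] at h
  simpa [tailNorm] using h.sqrt

/-- Dominated convergence with majorant ‖f‖^q; this needs q < ∞, as tails need not vanish in L^∞. -/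
theorem tendsto_eLpNorm_tailNorm [Countable ι] (b : HilbertBasis ι ℝ H) {μ : Measure ℝ} {f : ℝ → H}
    {q : ℝ≥0∞} (hq0 : q ≠ 0) (hq : q ≠ ⊤) (hf : MemLp f q μ) :
    Tendsto (fun s => eLpNorm (fun τ => tailNorm b s (f τ)) q μ) atTop (𝓝 0) := by
  have hqr : 0 < q.toReal := ENNReal.toReal_pos hq0 hq
  simp_rw [eLpNorm_eq_lintegral_rpow_enorm_toReal hq0 hq]
  have h1 : Tendsto (fun s => ∫⁻ τ, ‖tailNorm b s (f τ)‖ₑ ^ q.toReal ∂μ) atTop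
      (𝓝 (∫⁻ _, 0 ∂μ)) := by
    refine tendsto_lintegral_filter_of_dominated_convergence' (fun τ => ‖f τ‖ₑ ^ q.toReal) ?_ ?_ ?_ ?_
    · exact Eventually.of_forall fun s =>
        (((continuous_tailNorm b s).comp_aestronglyMeasurable hf.1).enorm.pow_const _)
    · refine Eventually.of_forall fun s => Eventually.of_forall fun τ => ?_
      gcongr
      refine enorm_le_iff_norm_le.2 ?_
      rw [Real.norm_of_nonneg (tailNorm_nonneg _ _ _)]
      exact tailNorm_le b s (f τ)
    · exact (lintegral_rpow_enorm_lt_top_of_eLpNorm_lt_top hq0 hq hf.2).ne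
    · refine Eventually.of_forall fun τ => ?_
      have h2 : Tendsto (fun s => ‖tailNorm b s (f τ)‖ₑ) atTop (𝓝 0) := by
        simpa using (tendsto_tailNorm b (f τ)).enorm
      have := (ENNReal.continuous_rpow_const (y := q.toReal)).tendsto 0 |>.comp h2
      simpa [Function.comp_def, ENNReal.zero_rpow_of_pos hqr] using this
  rw [lintegral_zero] at h1
  have := (ENNReal.continuous_rpow_const (y := 1 / q.toReal)).tendsto 0 |>.comp h1
  simpa [Function.comp_def, ENNReal.zero_rpow_of_pos (one_div_pos.2 hqr), ENNReal.zero_rpow_of_pos (inv_pos.2 hqr)] using this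

/-- Off the finite set s only the spectral tail of f enters, so the bound carries its L^q norm. An
empty s gives the full estimate; large s give uniform convergence. -/
theorem sum_sq_conv_tail_le [DecidableEq ι] (b : HilbertBasis ι ℝ H) {k : ι → ℝ → ℝ} {f : ℝ → H}
    {C κ p t T : ℝ} {q : ℝ≥0∞} (hp : 1 ≤ p) (hκ : κ * p < 1)
    (hpq : ENNReal.HolderConjugate (ENNReal.ofReal p) q) (hC : 0 ≤ C)
    (hkc : ∀ i, ContinuousOn (k i) (Set.Ioi 0)) (hk : ∀ i r, 0 < r → |k i r| ≤ C * r ^ (-κ))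
    (hf : MemLp f q (volume.restrict (Set.Ioo 0 T))) (ht : t ∈ Set.Icc 0 T) (s s' : Finset ι) :
    ∑ i ∈ s' \ s, conv (k i) (fun τ => inner ℝ (b i) (f τ)) t ^ 2 ≤
      (C * (((1 - κ * p)⁻¹) ^ p⁻¹ * t ^ (1 / p - κ) *
        (eLpNorm (fun τ => tailNorm b s (f τ)) q (volume.restrict (Set.Ioo 0 T))).toReal)) ^ 2 := by
  rcases ht.1.eq_or_lt with h | h
  · subst h
    simp only [conv_zero, zero_pow two_ne_zero, Finset.sum_const_zero]
    exact sq_nonneg _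
  have hg : MemLp (fun τ => tailNorm b s (f τ)) q (volume.restrict (Set.Ioo 0 T)) :=
    hf.mono ((continuous_tailNorm b s).comp_aestronglyMeasurable hf.1) (Eventually.of_forall fun τ => by
      rw [Real.norm_of_nonneg (tailNorm_nonneg _ _ _)]
      exact tailNorm_le b s (f τ))
  obtain ⟨hi, hle⟩ := integrableOn_rpow_mul_and_le hp hκ hpq h ht.2 hg
  have hfm : AEStronglyMeasurable f (volume.restrict (Set.Ioc 0 t)) := by
    rw [← restrict_Ioo_eq_restrict_Ioc]
    exact hf.1.mono_measure (Measure.restrict_mono (Set.Ioo_subset_Ioo_right ht.2) le_rfl)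
  refine (sum_sq_conv_le ht.1 hC hkc hk (fun i => ?_) hi (s' \ s) (fun τ => tailNorm_nonneg b s (f τ))
    fun τ => sum_sdiff_le_tailNorm b s s' (f τ)).trans ?_
  · exact (innerSL ℝ (b i)).continuous.comp_aestronglyMeasurable hfm
  · refine pow_le_pow_left₀ (mul_nonneg hC (integral_nonneg fun τ => abs_nonneg _)) ?_ 2
    gcongr

theorem exists_lp_conv (b : HilbertBasis ι ℝ H) {k : ι → ℝ → ℝ} {f : ℝ → H}
    {C κ p t T : ℝ} {q : ℝ≥0∞} (hp : 1 ≤ p) (hκ : κ * p < 1)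
    (hpq : ENNReal.HolderConjugate (ENNReal.ofReal p) q) (hC : 0 ≤ C)
    (hkc : ∀ i, ContinuousOn (k i) (Set.Ioi 0)) (hk : ∀ i r, 0 < r → |k i r| ≤ C * r ^ (-κ))
    (hf : MemLp f q (volume.restrict (Set.Ioo 0 T))) (ht : t ∈ Set.Icc 0 T) :
    ∃ x : lp (fun _ : ι => ℝ) 2, (∀ i, x i = conv (k i) (fun τ => inner ℝ (b i) (f τ)) t) ∧
      ‖x‖ ≤ C * (((1 - κ * p)⁻¹) ^ p⁻¹ * t ^ (1 / p - κ) *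
        (eLpNorm f q (volume.restrict (Set.Ioo 0 T))).toReal) := by
  classical
  have h2 : (0 : ℝ) < (2 : ℝ≥0∞).toReal := by norm_num
  have key := sum_sq_conv_tail_le b hp hκ hpq hC hkc hk hf ht ∅
  simp_rw [tailNorm_empty, eLpNorm_norm, Finset.sdiff_empty] at key
  have key' : ∀ s : Finset ι, ∑ i ∈ s, ‖conv (k i) (fun τ => inner ℝ (b i) (f τ)) t‖ ^
      (2 : ℝ≥0∞).toReal ≤ (C * (((1 - κ * p)⁻¹) ^ p⁻¹ * t ^ (1 / p - κ) *
        (eLpNorm f q (volume.restrict (Set.Ioo 0 T))).toReal)) ^ (2 : ℝ≥0∞).toReal := fun s => by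
    simpa using key s
  refine ⟨⟨_, memℓp_gen' key'⟩, fun i => rfl, lp.norm_le_of_forall_sum_le h2 ?_ key'⟩
  have : 0 < 1 - κ * p := by linarith
  have := ht.1
  positivity

/-- The sums over finite sets of modes are continuous and converge uniformly on [0, T], by the tail
estimate. -/
theorem continuousOn_lp_conv [Countable ι] (b : HilbertBasis ι ℝ H) {k : ι → ℝ → ℝ} {f : ℝ → H}
    {C κ p T : ℝ} {q : ℝ≥0∞} (hp : 1 ≤ p) (hκ : κ * p < 1) (hκ0 : 0 < κ)
    (hpq : ENNReal.HolderConjugate (ENNReal.ofReal p) q) (hC : 0 ≤ C)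
    (hkc : ∀ i, ContinuousOn (k i) (Set.Ioi 0)) (hk : ∀ i r, 0 < r → |k i r| ≤ C * r ^ (-κ))
    (hf : MemLp f q (volume.restrict (Set.Ioo 0 T))) {x : ℝ → lp (fun _ : ι => ℝ) 2}
    (hx : ∀ t ∈ Set.Icc 0 T, ∀ i, x t i = conv (k i) (fun τ => inner ℝ (b i) (f τ)) t)
    (hcont : ∀ i, ContinuousOn (conv (k i) (fun τ => inner ℝ (b i) (f τ))) (Set.Icc 0 T)) :
    ContinuousOn x (Set.Icc 0 T) := by
  classical
  have h2 : (0 : ℝ) < (2 : ℝ≥0∞).toReal := by norm_num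
  -- For p = 1 the conjugate exponent is ∞, where tails need not vanish. A slightly larger p' still
  -- satisfies κp' < 1 and has a finite conjugate q' ≤ q; f lies in L^{q'} since (0, T) has finite
  -- measure.
  obtain ⟨p', hpp', hp'κ⟩ : ∃ p', p < p' ∧ p' < 1 / κ :=
    exists_between (by rw [lt_div_iff₀ hκ0]; linarith)
  have hκ' : κ * p' < 1 := by rw [lt_div_iff₀ hκ0] at hp'κ; linarith
  have hp1 : 1 < p' := by linarith
  have hconj := (Real.HolderConjugate.conjExponent hp1)
  have hpq' := hconj.ennrealOfReal
  set q' : ℝ≥0∞ := ENNReal.ofReal p'.conjExponent with hq'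
  have hq'0 : q' ≠ 0 := by
    rw [hq']
    simpa using hconj.symm.pos
  have hq'q : q' ≤ q := by
    have h3 : q⁻¹ = 1 - (ENNReal.ofReal p)⁻¹ := (ENNReal.HolderConjugate.one_sub_inv _ _).symm
    have h4 : q'⁻¹ = 1 - (ENNReal.ofReal p')⁻¹ := (ENNReal.HolderConjugate.one_sub_inv _ _).symm
    rw [← ENNReal.inv_le_inv, h3, h4]
    gcongr
  have hf' : MemLp f q' (volume.restrict (Set.Ioo 0 T)) := hf.mono_exponent hq'q
  have hlim := tendsto_eLpNorm_tailNorm b hq'0 ENNReal.ofReal_ne_top hf'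
  have hlim' : Tendsto (fun s => C * (((1 - κ * p')⁻¹) ^ p'⁻¹ * T ^ (1 / p' - κ) *
      (eLpNorm (fun τ => tailNorm b s (f τ)) q' (volume.restrict (Set.Ioo 0 T))).toReal)) atTop
      (𝓝 0) := by
    have h5 := (ENNReal.tendsto_toReal ENNReal.zero_ne_top).comp hlim
    simpa using (h5.const_mul (((1 - κ * p')⁻¹) ^ p'⁻¹ * T ^ (1 / p' - κ))).const_mul C
  refine continuousOn_of_uniform_approx_of_continuousOn fun u hu => ?_
  obtain ⟨ε, hε, hεu⟩ := Metric.mem_uniformity_dist.1 hu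
  obtain ⟨s, hs⟩ := (hlim'.eventually_lt_const hε).exists
  refine ⟨fun t => ∑ i ∈ s, lp.single 2 i (conv (k i) (fun τ => inner ℝ (b i) (f τ)) t), ?_, ?_⟩
  · exact continuousOn_finsetSum _ fun i _ =>
      (lp.isometry_single (p := 2) (E := fun _ : ι => ℝ) i).continuous.comp_continuousOn (hcont i)
  · intro t ht
    refine hεu ?_
    rw [dist_eq_norm]
    have hexp : 0 ≤ 1 / p' - κ := by
      have : κ < 1 / p' := by rw [lt_div_iff₀ (by linarith)]; exact hκ'
      linarith
    have h1κ : 0 < 1 - κ * p' := by linarith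
    have ht0 := ht.1
    have hT0 : 0 ≤ T := ht.1.trans ht.2
    refine lt_of_le_of_lt (lp.norm_le_of_forall_sum_le h2 (C := C * (((1 - κ * p')⁻¹) ^ p'⁻¹ *
      T ^ (1 / p' - κ) * (eLpNorm (fun τ => tailNorm b s (f τ)) q'
        (volume.restrict (Set.Ioo 0 T))).toReal)) (by positivity) fun s' => ?_) hs
    have hcoord : ∀ i, (x t - ∑ j ∈ s, lp.single 2 j (conv (k j)
        (fun τ => inner ℝ (b j) (f τ)) t) : lp (fun _ : ι => ℝ) 2) i =
        if i ∈ s then 0 else conv (k i) (fun τ => inner ℝ (b i) (f τ)) t := fun i => by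
      rw [lp.coeFn_sub, Pi.sub_apply, lp.coeFn_sum, Finset.sum_apply, hx t ht i]
      simp only [lp.coeFn_single]
      rw [Finset.sum_pi_single]
      split_ifs <;> simp
    simp_rw [hcoord]
    have e : ∑ i ∈ s', ‖if i ∈ s then 0 else conv (k i) (fun τ => inner ℝ (b i) (f τ)) t‖ ^
        (2 : ℝ≥0∞).toReal = ∑ i ∈ s' \ s, conv (k i) (fun τ => inner ℝ (b i) (f τ)) t ^ 2 := by
      rw [Finset.sdiff_eq_filter, Finset.sum_filter]
      refine Finset.sum_congr rfl fun i _ => ?_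
      split_ifs with h <;> simp
    rw [e]
    refine (sum_sq_conv_tail_le b hp1.le hκ' hpq' hC hkc hk hf' ht s s').trans ?_
    rw [ENNReal.toReal_ofNat, Real.rpow_two]
    have := ht.2
    gcongr

theorem conv_congr_ae {k g h : ℝ → ℝ} {t T : ℝ} (ht : t ∈ Set.Icc 0 T)
    (hgh : ∀ᵐ τ ∂volume.restrict (Set.Ioo 0 T), g τ = h τ) : conv k g t = conv k h t := by
  rw [conv, conv, intervalIntegral.integral_of_le ht.1, intervalIntegral.integral_of_le ht.1,
    ← restrict_Ioo_eq_restrict_Ioc]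
  refine integral_congr_ae ?_
  have := ae_mono (Measure.restrict_mono (Set.Ioo_subset_Ioo_right ht.2) le_rfl) hgh
  filter_upwards [this] with τ hτ
  rw [hτ]

theorem norm_mulLp_le {ι : Type*} {c : ι → ℝ} {M : ℝ} (hc : ∀ i, |c i| ≤ M) (hM : 0 ≤ M)
    (x : lp (fun _ : ι => ℝ) 2) : ‖mulLp c M hc x‖ ≤ M * ‖x‖ := by
  rw [← norm_smul_of_nonneg hM]
  refine lp.norm_mono (by norm_num) fun i => ?_
  rw [mulLp_apply, lp.coeFn_smul, Pi.smul_apply, smul_eq_mul, norm_mul, norm_mul]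
  gcongr
  exact (hc i).trans (le_abs_self M)

section Modes

variable {ι : Type*} {H : Type*} [NormedAddCommGroup H] [InnerProductSpace ℝ H]

theorem exists_lp_modes (b : HilbertBasis ι ℝ H) {c d : ι → ℝ} {k : ι → ℝ → ℝ} {f : ℝ → H}
    {C κ p t T M N : ℝ} {q : ℝ≥0∞} (hp : 1 ≤ p) (hκ : κ * p < 1)
    (hpq : ENNReal.HolderConjugate (ENNReal.ofReal p) q) (hC : 0 ≤ C)
    (hkc : ∀ i, ContinuousOn (k i) (Set.Ioi 0)) (hk : ∀ i r, 0 < r → |k i r| ≤ C * r ^ (-κ))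
    (hf : MemLp f q (volume.restrict (Set.Ioo 0 T))) (ht : t ∈ Set.Icc 0 T)
    (hM : 0 ≤ M) (hN : 0 ≤ N) (hc : ∀ i, |c i| ≤ M) (hd : ∀ i, |d i| ≤ N)
    (x y : lp (fun _ : ι => ℝ) 2) :
    ∃ z : lp (fun _ : ι => ℝ) 2,
      (∀ i, z i = c i * x i + d i * y i + conv (k i) (fun τ => inner ℝ (b i) (f τ)) t) ∧
      ‖z‖ ≤ M * ‖x‖ + N * ‖y‖ + C * (((1 - κ * p)⁻¹) ^ p⁻¹ * t ^ (1 / p - κ) *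
        (eLpNorm f q (volume.restrict (Set.Ioo 0 T))).toReal) := by
  obtain ⟨w, hw, hwn⟩ := exists_lp_conv b hp hκ hpq hC hkc hk hf ht
  refine ⟨mulLp c M hc x + mulLp d N hd y + w, fun i => ?_, ?_⟩
  · rw [lp.coeFn_add, lp.coeFn_add, Pi.add_apply, Pi.add_apply, mulLp_apply, mulLp_apply, hw]
  · refine (norm_add₃_le).trans ?_
    gcongr
    · exact norm_mulLp_le hc hM x
    · exact norm_mulLp_le hd hN y

theorem continuousOn_lp_mul {c : ι → ℝ → ℝ} {A : Set ℝ} {M : ℝ}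
    (hcc : ∀ i, ContinuousOn (c i) A) (hc : ∀ i, ∀ t ∈ A, |c i t| ≤ M)
    (x : lp (fun _ : ι => ℝ) 2) {z : ℝ → lp (fun _ : ι => ℝ) 2}
    (hz : ∀ t ∈ A, ∀ i, z t i = c i t * x i) : ContinuousOn z A := by
  refine continuousOn_lp_of_dominated (y := M • x) (fun i => ?_) fun t ht i => ?_
  · exact ((hcc i).mul continuousOn_const).congr fun t ht => hz t ht i
  · rw [hz t ht i, lp.coeFn_smul, Pi.smul_apply, smul_eq_mul, abs_mul, abs_mul]
    exact mul_le_mul_of_nonneg_right ((hc i t ht).trans (le_abs_self M)) (abs_nonneg _)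

theorem continuousOn_lp_modes [Countable ι] (b : HilbertBasis ι ℝ H) {c d k : ι → ℝ → ℝ}
    {f : ℝ → H} {C κ p T M N : ℝ} {q : ℝ≥0∞} (hp : 1 ≤ p) (hκ : κ * p < 1) (hκ0 : 0 < κ)
    (hpq : ENNReal.HolderConjugate (ENNReal.ofReal p) q) (hC : 0 ≤ C)
    (hkc : ∀ i, ContinuousOn (k i) (Set.Ioi 0)) (hk : ∀ i r, 0 < r → |k i r| ≤ C * r ^ (-κ))
    (hf : MemLp f q (volume.restrict (Set.Ioo 0 T)))
    (hcont : ∀ i, ContinuousOn (conv (k i) (fun τ => inner ℝ (b i) (f τ))) (Set.Icc 0 T))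
    (hcc : ∀ i, ContinuousOn (c i) (Set.Icc 0 T)) (hdc : ∀ i, ContinuousOn (d i) (Set.Icc 0 T))
    (hc : ∀ i, ∀ t ∈ Set.Icc 0 T, |c i t| ≤ M) (hd : ∀ i, ∀ t ∈ Set.Icc 0 T, |d i t| ≤ N)
    (x y : lp (fun _ : ι => ℝ) 2) {z : ℝ → lp (fun _ : ι => ℝ) 2}
    (hz : ∀ t ∈ Set.Icc 0 T, ∀ i,
      z t i = c i t * x i + d i t * y i + conv (k i) (fun τ => inner ℝ (b i) (f τ)) t) :
    ContinuousOn z (Set.Icc 0 T) := by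
  have h1 : ∀ t, ∃ z₁ : lp (fun _ : ι => ℝ) 2, t ∈ Set.Icc 0 T → ∀ i, z₁ i = c i t * x i :=
    fun t => by
      by_cases ht : t ∈ Set.Icc 0 T
      · exact ⟨mulLp (fun i => c i t) M (fun i => hc i t ht) x, fun _ i => rfl⟩
      · exact ⟨0, fun h => absurd h ht⟩
  have h2 : ∀ t, ∃ z₂ : lp (fun _ : ι => ℝ) 2, t ∈ Set.Icc 0 T → ∀ i, z₂ i = d i t * y i :=
    fun t => by
      by_cases ht : t ∈ Set.Icc 0 T
      · exact ⟨mulLp (fun i => d i t) N (fun i => hd i t ht) y, fun _ i => rfl⟩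
      · exact ⟨0, fun h => absurd h ht⟩
  choose z₁ hz₁ using h1
  choose z₂ hz₂ using h2
  have h3 : ContinuousOn (fun t => z t - z₁ t - z₂ t) (Set.Icc 0 T) := by
    refine continuousOn_lp_conv b hp hκ hκ0 hpq hC hkc hk hf (fun t ht i => ?_) hcont
    rw [lp.coeFn_sub, lp.coeFn_sub, Pi.sub_apply, Pi.sub_apply, hz t ht, hz₁ t ht, hz₂ t ht]
    ring
  have h4 := (h3.add (continuousOn_lp_mul hcc hc x hz₁)).add (continuousOn_lp_mul hdc hd y hz₂)
  refine h4.congr fun t _ => ?_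
  simp only [Pi.add_apply]
  abel

end Modes

/-! ### Uniform bounds for the modes and assembly of the solution -/

/-- All six are `exists_mlKernel_bound` with σ ∈ {0, 1/α, 1 - 1/α}. For γ = 1/α the exponent β-1-ασ
vanishes for λ^γ K_2 and λ^{1-γ} K_α, and equals α-2 for both source kernels λ^γ K_α and K_{α-1}. At
t = 0 the first four are checked by hand. -/
theorem exists_mode_multiplier_bounds {α : ℝ} (hα : 1 < α) (hα2 : α < 2) :
    ∃ C : ℝ, 0 < C ∧ ∀ lam t : ℝ, 0 < lam →
      (0 ≤ t → |mlKernel α lam 1 t| ≤ C) ∧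
      (0 ≤ t → lam ^ (1 / α) * |mlKernel α lam 2 t| ≤ C) ∧
      (0 ≤ t → lam ^ (1 - 1 / α) * |mlKernel α lam α t| ≤ C) ∧
      (0 ≤ t → lam ^ (1 - 1 / α) * |mlKernel α lam 2 t| ≤ C * t ^ (2 - α)) ∧
      (0 < t → lam ^ (1 / α) * |mlKernel α lam α t| ≤ C * t ^ (-(2 - α))) ∧
      (0 < t → |mlKernel α lam (α - 1) t| ≤ C * t ^ (-(2 - α))) := by
  have hα0 : 0 < α := by linarith
  have hγ0 : 0 ≤ 1 / α := by positivity
  have hγ1 : 1 / α ≤ 1 := by rw [div_le_one hα0]; exact hα.le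
  have hαγ : α * (1 / α) = 1 := by field_simp
  obtain ⟨C₁, h1, b1⟩ := exists_mlKernel_bound hα hα2 one_pos (by linarith)
  obtain ⟨C₂, h2, b2⟩ := exists_mlKernel_bound hα hα2 (two_pos (α := ℝ)) (by linarith)
  obtain ⟨C₃, h3, b3⟩ := exists_mlKernel_bound hα hα2 hα0 (by linarith)
  obtain ⟨C₄, h4, b4⟩ := exists_mlKernel_bound (β := α - 1) hα hα2 (by linarith) (by linarith)
  refine ⟨1 + C₁ + C₂ + C₃ + C₄, by positivity, fun lam t hl => ⟨?_, ?_, ?_, ?_, ?_, ?_⟩⟩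
  · intro ht
    rcases ht.eq_or_lt with h | h
    · subst h
      rw [mlKernel_one_at_zero hα0, abs_one]
      linarith
    · have := b1 lam 0 t hl le_rfl zero_le_one h
      simp only [Real.rpow_zero, one_mul, mul_zero, sub_self, mul_one] at this
      linarith
  · intro ht
    rcases ht.eq_or_lt with h | h
    · subst h
      rw [mlKernel_at_zero (by norm_num), abs_zero, mul_zero]
      positivity
    · have := b2 lam (1 / α) t hl hγ0 hγ1 h
      rw [show (2 : ℝ) - 1 - α * (1 / α) = 0 by rw [hαγ]; norm_num, Real.rpow_zero, mul_one] at this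
      linarith
  · intro ht
    rcases ht.eq_or_lt with h | h
    · subst h
      rw [mlKernel_at_zero hα.ne', abs_zero, mul_zero]
      positivity
    · have := b3 lam (1 - 1 / α) t hl (by linarith) (by linarith) h
      rw [show α - 1 - α * (1 - 1 / α) = 0 by rw [mul_sub, hαγ]; ring, Real.rpow_zero,
        mul_one] at this
      linarith
  · intro ht
    rcases ht.eq_or_lt with h | h
    · subst h
      rw [mlKernel_at_zero (by norm_num), abs_zero, mul_zero]
      positivity
    · have := b2 lam (1 - 1 / α) t hl (by linarith) (by linarith) h
      rw [show (2 : ℝ) - 1 - α * (1 - 1 / α) = 2 - α by rw [mul_sub, hαγ]; ring] at this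
      refine this.trans ?_
      gcongr
      linarith
  · intro h
    have := b3 lam (1 / α) t hl hγ0 hγ1 h
    rw [show α - 1 - α * (1 / α) = -(2 - α) by rw [hαγ]; ring] at this
    refine this.trans ?_
    gcongr
    linarith
  · intro h
    have := b4 lam 0 t hl le_rfl zero_le_one h
    rw [Real.rpow_zero, one_mul, mul_zero, show α - 1 - 1 - 0 = -(2 - α) by ring] at this
    refine this.trans ?_
    gcongr
    linarith

theorem conv_const_mul_left (a b : ℝ → ℝ) (c t : ℝ) :
    conv (fun s => c * a s) b t = c * conv a b t := by
  rw [conv_comm, conv_const_mul, conv_comm]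

namespace DirichletForm.EigenSystem

universe u v

variable {X : Type u} [MeasurableSpace X] {m : Measure X} {𝓔 : DirichletForm m} {ι : Type v}
  [hF : Fact (0 < 𝓔.firstEigenvalue)]

/-- The `i`-th component of the solution with data `u₀`, `u₁`, `F`. -/
def mode (S : 𝓔.EigenSystem ι) (α : ℝ) {s : ℝ} (u₀ : S.Space s) (u₁ : L2 m) (F : ℝ → S.Dual s)
    (i : ι) : ℝ → ℝ :=
  modeSol α (S.lam i) (inner ℝ (S.φ i) (S.toL2 u₀)) (inner ℝ (S.φ i) u₁)
    fun t => F t (S.basisVec s i)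

/-- The `i`-th component of the time derivative of the solution with data `u₀`, `u₁`, `F`. -/
def modeVel (S : 𝓔.EigenSystem ι) (α : ℝ) {s : ℝ} (u₀ : S.Space s) (u₁ : L2 m) (F : ℝ → S.Dual s)
    (i : ι) : ℝ → ℝ :=
  modeDeriv α (S.lam i) (inner ℝ (S.φ i) (S.toL2 u₀)) (inner ℝ (S.φ i) u₁)
    fun t => F t (S.basisVec s i)

theorem IsSource.continuousOn_apply {S : 𝓔.EigenSystem ι} {s : ℝ} {hs : 0 ≤ s} {T : ℝ} {q : ℝ≥0∞}
    {F : ℝ → S.Dual s} {f : ℝ → L2 m} (h : S.IsSource hs T q F f) (w : S.Space s) :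
    ContinuousOn (fun t => F t w) (Set.Icc 0 T) :=
  h.continuousOn.clm_apply continuousOn_const

theorem IsSource.ae_eq_inner {S : 𝓔.EigenSystem ι} {s : ℝ} {hs : 0 ≤ s} {T : ℝ} {q : ℝ≥0∞}
    {F : ℝ → S.Dual s} {f : ℝ → L2 m} (h : S.IsSource hs T q F f) (i : ι) :
    ∀ᵐ t ∂volume.restrict (Set.Ioo 0 T), inner ℝ (S.φ i) (f t) = F t (S.basisVec s i) := by
  filter_upwards [h.ae_eq] with t ht
  rw [ht, toDual_apply, toL2_basisVec, real_inner_comm]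

/-- Everything is built in ℓ²: `U` holds the V_γ coordinates of u, `W` the L² coordinates of ∂_t u,
and `y` the V_{-γ} coordinates λ^{1-γ}(u, φ_i) of Au. -/
theorem exists_trajectories [Countable ι] (S : 𝓔.EigenSystem ι) {α : ℝ} (hα : 1 < α) (hα2 : α < 2)
    {p : ℝ} {q : ℝ≥0∞} (hp : 1 ≤ p) (hp2 : p < 1 / (2 - α))
    (hpq : ENNReal.HolderConjugate (ENNReal.ofReal p) q) :
    ∃ C : ℝ, 0 < C ∧ ∀ (T : ℝ) (u₀ : S.Space (1 / α)) (u₁ : L2 m)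
      (F : ℝ → S.Dual (1 / α)) (f : ℝ → L2 m), S.IsSource (order_nonneg hα) T q F f →
    ∃ (u : ℝ → S.Space (1 / α)) (w : ℝ → L2 m) (y : ℝ → lp (fun _ : ι => ℝ) 2),
      ContinuousOn u (Set.Icc 0 T) ∧ ContinuousOn w (Set.Icc 0 T) ∧
      ContinuousOn y (Set.Icc 0 T) ∧
      ∀ t ∈ Set.Icc 0 T,
        (∀ i, inner ℝ (S.φ i) (S.toL2 (u t)) = S.mode α u₀ u₁ F i t) ∧
        (∀ i, inner ℝ (S.φ i) (w t) = S.modeVel α u₀ u₁ F i t) ∧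
        (∀ i, S.lam i ^ (1 / α) * y t i = S.lam i * S.mode α u₀ u₁ F i t) ∧
        (∃ s₁ s₂ s₃ : S.Space (1 / α),
          (∀ i, inner ℝ (S.φ i) (S.toL2 s₁) =
            inner ℝ (S.φ i) (S.toL2 u₀) * mlKernel α (S.lam i) 1 t) ∧
          (∀ i, inner ℝ (S.φ i) (S.toL2 s₂) = inner ℝ (S.φ i) u₁ * mlKernel α (S.lam i) 2 t) ∧
          (∀ i, inner ℝ (S.φ i) (S.toL2 s₃) =
            conv (mlKernel α (S.lam i) α) (fun τ => inner ℝ (S.φ i) (f τ)) t) ∧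
          u t = s₁ + s₂ + s₃) ∧
        ‖u t‖ + ‖w t‖ ≤ C * (‖u₀‖ + ‖u₁‖ + t ^ (1 / p + α - 2) *
          (eLpNorm f q (volume.restrict (Set.Ioo 0 T))).toReal) ∧
        ‖y t‖ ≤ C * (‖u₀‖ + t ^ (2 - α) * ‖u₁‖ + t ^ (1 / p) *
          (eLpNorm f q (volume.restrict (Set.Ioo 0 T))).toReal) := by
  obtain ⟨C, hC, hK⟩ := exists_mode_multiplier_bounds hα hα2
  have hα0 : 0 < α := by linarith
  have hγ : 0 ≤ 1 / α := by positivity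
  have hκ0 : 0 < 2 - α := by linarith
  have hκ : (2 - α) * p < 1 := by rwa [lt_div_iff₀ hκ0, mul_comm] at hp2
  -- As α < 2, 2γ ≥ 1. Hence λ^{1-γ} = λ^{-(2γ-1)} λ^γ is a bounded multiple of λ^γ, and `y`
  -- inherits continuity from `U`.
  have h2γ : 0 ≤ 2 * (1 / α) - 1 := by
    have : α * (1 / α) = 1 := by field_simp
    nlinarith
  set L : ℝ := 𝓔.firstEigenvalue ^ (-(2 * (1 / α) - 1)) with hL
  have hL0 : 0 ≤ L := Real.rpow_nonneg hF.out.le _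
  set D : ℝ := ((1 - (2 - α) * p)⁻¹) ^ p⁻¹ with hD
  have hD0 : 0 ≤ D := Real.rpow_nonneg (inv_nonneg.2 (by linarith)) _
  have hlp := fun i => S.lam_pos i
  have hexp : ∀ i, S.lam i ^ (1 / α) * S.lam i ^ (1 - 1 / α) = S.lam i := fun i => by
    rw [← Real.rpow_add (hlp i), add_sub_cancel, Real.rpow_one]
  have hexp2 : ∀ i, S.lam i ^ (-(2 * (1 / α) - 1)) * S.lam i ^ (1 / α) = S.lam i ^ (1 - 1 / α) :=
    fun i => by
      rw [← Real.rpow_add (hlp i)]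
      congr 1
      ring
  have habs : ∀ (i) (s x : ℝ), |S.lam i ^ s * x| = S.lam i ^ s * |x| := fun i s x => by
    rw [abs_mul, abs_of_nonneg (Real.rpow_nonneg (hlp i).le _)]
  have hkc : ∀ i, ContinuousOn (fun r => S.lam i ^ (1 / α) * mlKernel α (S.lam i) α r)
      (Set.Ioi 0) := fun i => continuousOn_const.mul (continuousOn_mlKernel hα0 hα0 _)
  have hk : ∀ i r, 0 < r → |S.lam i ^ (1 / α) * mlKernel α (S.lam i) α r| ≤
      C * r ^ (-(2 - α)) := fun i r hr => by
    rw [habs]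
    exact (hK (S.lam i) r (hlp i)).2.2.2.2.1 hr
  have hkc' : ∀ i, ContinuousOn (mlKernel α (S.lam i) (α - 1)) (Set.Ioi 0) := fun i =>
    continuousOn_mlKernel hα0 (by linarith) _
  have hk' : ∀ i r, 0 < r → |mlKernel α (S.lam i) (α - 1) r| ≤ C * r ^ (-(2 - α)) := fun i r hr =>
    (hK (S.lam i) r (hlp i)).2.2.2.2.2 hr
  have hkc'' : ∀ i, ContinuousOn (fun r => S.lam i ^ (1 - 1 / α) * mlKernel α (S.lam i) α r)
      (Set.Ioi 0) := fun i => continuousOn_const.mul (continuousOn_mlKernel hα0 hα0 _)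
  have hk'' : ∀ i r, 0 < r → |S.lam i ^ (1 - 1 / α) * mlKernel α (S.lam i) α r| ≤
      C * r ^ (-(0 : ℝ)) := fun i r hr => by
    rw [habs, neg_zero, Real.rpow_zero, mul_one]
    exact (hK (S.lam i) r (hlp i)).2.2.1 hr.le
  have hc1 : ∀ i t, 0 ≤ t → |mlKernel α (S.lam i) 1 t| ≤ C := fun i t ht => (hK _ t (hlp i)).1 ht
  have hc2 : ∀ i t, 0 ≤ t → |S.lam i ^ (1 / α) * mlKernel α (S.lam i) 2 t| ≤ C := fun i t ht => by
    rw [habs]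
    exact (hK _ t (hlp i)).2.1 ht
  have hc3 : ∀ i t, 0 ≤ t → |-(S.lam i ^ (1 - 1 / α) * mlKernel α (S.lam i) α t)| ≤ C :=
    fun i t ht => by
      rw [abs_neg, habs]
      exact (hK _ t (hlp i)).2.2.1 ht
  have hc4 : ∀ i t, 0 ≤ t → |S.lam i ^ (1 - 1 / α) * mlKernel α (S.lam i) 2 t| ≤
      C * t ^ (2 - α) := fun i t ht => by
    rw [habs]
    exact (hK _ t (hlp i)).2.2.2.1 ht
  have hc5 : ∀ i t, 0 ≤ t → |S.lam i ^ (-(2 * (1 / α) - 1)) * mlKernel α (S.lam i) 1 t| ≤ L * C :=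
    fun i t ht => by
      rw [abs_mul]
      exact mul_le_mul (S.abs_rpow_neg_le h2γ i) (hc1 i t ht) (abs_nonneg _) hL0
  -- The first summand serves u and ∂_t u together, with D from Hölder's inequality; the second
  -- serves Au, with L from the embedding of V_γ in V_{1-γ}.
  refine ⟨(1 + D) * (2 * C) + (1 + L) * C, by positivity, fun T u₀ u₁ F f hs => ?_⟩
  set N : ℝ := (eLpNorm f q (volume.restrict (Set.Ioo 0 T))).toReal with hN
  have hN0 : 0 ≤ N := ENNReal.toReal_nonneg
  -- `F` and `f` have almost everywhere the same coefficients: `F` supplies continuity of each mode,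
  -- `f` the L^q estimate.
  have hconv : ∀ (k : ℝ → ℝ) (i) (t), t ∈ Set.Icc 0 T →
      conv k (fun τ => inner ℝ (S.φ i) (f τ)) t = conv k (fun τ => F τ (S.basisVec (1 / α) i)) t :=
    fun k i t ht => conv_congr_ae ht (hs.ae_eq_inner i)
  have hrepr : ∀ i, S.φ.repr u₁ i = inner ℝ (S.φ i) u₁ := fun i => S.φ.repr_apply_apply u₁ i
  -- Stated for every real t so that `choose` gives a total function; off [0, T] the value 0 is
  -- arbitrary.
  have hU : ∀ t, ∃ z : lp (fun _ : ι => ℝ) 2, t ∈ Set.Icc 0 T →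
      (∀ i, z i = mlKernel α (S.lam i) 1 t * S.coord (1 / α) u₀ i +
        S.lam i ^ (1 / α) * mlKernel α (S.lam i) 2 t * S.φ.repr u₁ i +
        conv (fun r => S.lam i ^ (1 / α) * mlKernel α (S.lam i) α r)
          (fun τ => inner ℝ (S.φ i) (f τ)) t) ∧
      ‖z‖ ≤ C * ‖S.coord (1 / α) u₀‖ + C * ‖S.φ.repr u₁‖ +
        C * (D * t ^ (1 / p - (2 - α)) * N) := fun t => by
    by_cases ht : t ∈ Set.Icc 0 T
    · obtain ⟨z, hz⟩ := exists_lp_modes S.φ hp hκ hpq hC.le hkc hk hs.memLp ht hC.le hC.le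
        (fun i => hc1 i t ht.1) (fun i => hc2 i t ht.1) (S.coord (1 / α) u₀) (S.φ.repr u₁)
      exact ⟨z, fun _ => hz⟩
    · exact ⟨0, fun h => absurd h ht⟩
  have hW : ∀ t, ∃ z : lp (fun _ : ι => ℝ) 2, t ∈ Set.Icc 0 T →
      (∀ i, z i = -(S.lam i ^ (1 - 1 / α) * mlKernel α (S.lam i) α t) * S.coord (1 / α) u₀ i +
        mlKernel α (S.lam i) 1 t * S.φ.repr u₁ i +
        conv (mlKernel α (S.lam i) (α - 1)) (fun τ => inner ℝ (S.φ i) (f τ)) t) ∧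
      ‖z‖ ≤ C * ‖S.coord (1 / α) u₀‖ + C * ‖S.φ.repr u₁‖ +
        C * (D * t ^ (1 / p - (2 - α)) * N) := fun t => by
    by_cases ht : t ∈ Set.Icc 0 T
    · obtain ⟨z, hz⟩ := exists_lp_modes S.φ hp hκ hpq hC.le hkc' hk' hs.memLp ht hC.le hC.le
        (fun i => hc3 i t ht.1) (fun i => hc1 i t ht.1) (S.coord (1 / α) u₀) (S.φ.repr u₁)
      exact ⟨z, fun _ => hz⟩
    · exact ⟨0, fun h => absurd h ht⟩
  choose U hU using hU
  choose W hW using hW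
  have hcontα : ∀ i, ContinuousOn (conv (fun r => S.lam i ^ (1 / α) * mlKernel α (S.lam i) α r)
      (fun τ => inner ℝ (S.φ i) (f τ))) (Set.Icc 0 T) := fun i =>
    ((continuousOn_conv_mlKernel hα hα2 (hlp i) hα0 (by linarith)
      (hs.continuousOn_apply (S.basisVec (1 / α) i))).const_mul (S.lam i ^ (1 / α))).congr
        fun t ht => by
          simp only [conv_const_mul_left]
          rw [hconv _ i t ht]
  have hcontα' : ∀ i, ContinuousOn (conv (mlKernel α (S.lam i) (α - 1))
      (fun τ => inner ℝ (S.φ i) (f τ))) (Set.Icc 0 T) := fun i =>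
    (continuousOn_conv_mlKernel hα hα2 (hlp i) (by linarith) (by linarith)
      (hs.continuousOn_apply _)).congr fun t ht => hconv _ i t ht
  have hml1 : ∀ i, ContinuousOn (mlKernel α (S.lam i) 1) (Set.Icc 0 T) := fun i =>
    (continuous_mlKernel hα0 le_rfl _).continuousOn
  have hml2 : ∀ i, ContinuousOn (mlKernel α (S.lam i) 2) (Set.Icc 0 T) := fun i =>
    (continuous_mlKernel hα0 one_le_two _).continuousOn
  have hmlα : ∀ i, ContinuousOn (mlKernel α (S.lam i) α) (Set.Icc 0 T) := fun i =>
    (continuous_mlKernel hα0 hα.le _).continuousOn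
  have hUc : ContinuousOn U (Set.Icc 0 T) :=
    continuousOn_lp_modes S.φ hp hκ hκ0 hpq hC.le hkc hk hs.memLp hcontα hml1
      (fun i => continuousOn_const.mul (hml2 i)) (fun i t ht => hc1 i t ht.1)
      (fun i t ht => hc2 i t ht.1) _ _ fun t ht => (hU t ht).1
  have hWc : ContinuousOn W (Set.Icc 0 T) :=
    continuousOn_lp_modes S.φ hp hκ hκ0 hpq hC.le hkc' hk' hs.memLp hcontα'
      (fun i => (continuousOn_const.mul (hmlα i)).neg) hml1 (fun i t ht => hc3 i t ht.1)
      (fun i t ht => hc1 i t ht.1) _ _ fun t ht => (hW t ht).1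
  have hUi : ∀ t ∈ Set.Icc 0 T, ∀ i, U t i = S.lam i ^ (1 / α) * S.mode α u₀ u₁ F i t := by
    intro t ht i
    rw [(hU t ht).1 i, conv_const_mul_left, hconv _ i t ht, coord_apply, hrepr, mode, modeSol]
    ring
  refine ⟨fun t => S.ofCoord hγ (U t), fun t => S.φ.repr.symm (W t),
    fun t => mulLp (fun i => S.lam i ^ (-(2 * (1 / α) - 1))) _ (S.abs_rpow_neg_le h2γ) (U t),
    (S.continuous_ofCoord hγ).comp_continuousOn hUc,
    S.φ.repr.symm.continuous.comp_continuousOn hWc,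
    (mulLp _ _ _).continuous.comp_continuousOn hUc, fun t ht => ⟨fun i => ?_, fun i => ?_,
      fun i => ?_, ?_, ?_, ?_⟩⟩
  · rw [inner_toL2_ofCoord, hUi t ht, ← mul_assoc, mul_comm (S.lam i ^ (-(1 / α))),
      lam_rpow_mul_rpow_neg, one_mul]
  · rw [inner_repr_symm, (hW t ht).1 i, hconv _ i t ht, coord_apply, hrepr, modeVel, modeDeriv]
    linear_combination (-(mlKernel α (S.lam i) α t * inner ℝ (S.φ i) (S.toL2 u₀))) * hexp i
  · rw [mulLp_apply, hUi t ht, ← mul_assoc (S.lam i ^ (-(2 * (1 / α) - 1))), hexp2, ← mul_assoc,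
      hexp]
  · obtain ⟨z, hz, -⟩ := exists_lp_conv S.φ hp hκ hpq hC.le hkc hk hs.memLp ht
    refine ⟨S.ofCoord hγ (mulLp _ _ (fun i => hc1 i t ht.1) (S.coord (1 / α) u₀)),
      S.ofCoord hγ (mulLp _ _ (fun i => hc2 i t ht.1) (S.φ.repr u₁)), S.ofCoord hγ z,
      fun i => ?_, fun i => ?_, fun i => ?_, ?_⟩
    · rw [inner_toL2_ofCoord, mulLp_apply, coord_apply]
      linear_combination (mlKernel α (S.lam i) 1 t * inner ℝ (S.φ i) (S.toL2 u₀)) *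
        S.lam_rpow_mul_rpow_neg (1 / α) i
    · rw [inner_toL2_ofCoord, mulLp_apply, hrepr]
      linear_combination (mlKernel α (S.lam i) 2 t * inner ℝ (S.φ i) u₁) *
        S.lam_rpow_mul_rpow_neg (1 / α) i
    · rw [inner_toL2_ofCoord, hz, conv_const_mul_left, ← mul_assoc,
        mul_comm (S.lam i ^ (-(1 / α))), lam_rpow_mul_rpow_neg, one_mul]
    · apply S.coord_injective
      rw [map_add, map_add, coord_ofCoord, coord_ofCoord, coord_ofCoord, coord_ofCoord]
      ext i
      rw [(hU t ht).1 i, lp.coeFn_add, lp.coeFn_add, Pi.add_apply, Pi.add_apply, mulLp_apply,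
        mulLp_apply, hz]
  · rw [norm_ofCoord, LinearIsometryEquiv.norm_map]
    have h1 := (hU t ht).2
    have h2 := (hW t ht).2
    rw [← norm_def, LinearIsometryEquiv.norm_map,
      show 1 / p - (2 - α) = 1 / p + α - 2 by ring] at h1 h2
    have ht0 := ht.1
    set R := t ^ (1 / p + α - 2) * N with hR
    have hR0 : 0 ≤ R := by positivity
    have h3 : C * (D * t ^ (1 / p + α - 2) * N) = C * D * R := by rw [hR]; ring
    rw [h3] at h1 h2
    have h4 : 0 ≤ (1 + L) * C * (‖u₀‖ + ‖u₁‖ + R) := by positivity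
    have h5 : 0 ≤ C * D * (‖u₀‖ + ‖u₁‖) := by positivity
    have h6 : 0 ≤ C * R := by positivity
    nlinarith
  -- Estimating `y` through `U` would bring in t^{1/p+α-2}. The kernel λ^{1-γ} K_α is bounded, so κ
  -- = 0 yields the sharper power t^{1/p}.
  · obtain ⟨z, hz, hzn⟩ := exists_lp_modes (κ := 0) S.φ hp (by norm_num) hpq hC.le hkc'' hk''
      hs.memLp ht (mul_nonneg hL0 hC.le) (mul_nonneg hC.le (Real.rpow_nonneg ht.1 _))
      (fun i => hc5 i t ht.1) (fun i => hc4 i t ht.1) (S.coord (1 / α) u₀) (S.φ.repr u₁)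
    have e : mulLp (fun i => S.lam i ^ (-(2 * (1 / α) - 1))) _ (S.abs_rpow_neg_le h2γ) (U t) = z := by
      ext i
      rw [mulLp_apply, hUi t ht, hz, conv_const_mul_left, hconv _ i t ht, coord_apply, hrepr, mode,
        modeSol, ← hexp2]
      ring
    beta_reduce
    rw [e]
    refine hzn.trans ?_
    rw [← norm_def, LinearIsometryEquiv.norm_map, zero_mul, sub_zero, sub_zero, inv_one,
      Real.one_rpow, one_mul]
    have ht0 := ht.1
    set R := t ^ (1 / p) * N with hR
    set Q := t ^ (2 - α) * ‖u₁‖ with hQ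
    have hR0 : 0 ≤ R := by positivity
    have hQ0 : 0 ≤ Q := by positivity
    have h3 : C * t ^ (2 - α) * ‖u₁‖ = C * Q := by rw [hQ]; ring
    rw [h3]
    have h4 : 0 ≤ (1 + D) * (2 * C) * (‖u₀‖ + Q + R) := by positivity
    have h5 : 0 ≤ L * C * (Q + R) := by positivity
    have h6 : 0 ≤ C * ‖u₀‖ := by positivity
    nlinarith

end DirichletForm.EigenSystem

/-! ### Differentiation of integrated identities -/

section Calculus

variable {E : Type*} [NormedAddCommGroup E] [NormedSpace ℝ E] [CompleteSpace E]

theorem contDiffOn_of_eq_add_integral {g g' : ℝ → E} {c : E} {T : ℝ} (hT : 0 < T)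
    (hg' : ContinuousOn g' (Set.Icc 0 T))
    (hg : ∀ t ∈ Set.Icc 0 T, g t = c + ∫ s in (0 : ℝ)..t, g' s) :
    ContDiffOn ℝ 1 g (Set.Icc 0 T) ∧ Set.EqOn (derivWithin g (Set.Icc 0 T)) g' (Set.Icc 0 T) := by
  have hu := uniqueDiffOn_Icc hT
  have hd : ∀ t ∈ Set.Icc 0 T, HasDerivWithinAt g (g' t) (Set.Icc 0 T) t := fun t ht =>
    ((hasDerivWithinAt_integral_Icc hg' ht).const_add c).congr hg (hg t ht)
  have he : Set.EqOn (derivWithin g (Set.Icc 0 T)) g' (Set.Icc 0 T) := fun t ht =>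
    (hd t ht).derivWithin (hu t ht)
  exact ⟨(contDiffOn_one_iff_derivWithin hu).2
    ⟨fun t ht => (hd t ht).differentiableWithinAt, hg'.congr he⟩, he⟩

theorem contDiffOn_two_of_eq_integral {g g'' : ℝ → E} {T : ℝ} (hT : 0 < T)
    (hg'' : ContinuousOn g'' (Set.Icc 0 T))
    (hg : ∀ t ∈ Set.Icc 0 T, g t = ∫ s in (0 : ℝ)..t, ∫ r in (0 : ℝ)..s, g'' r) :
    ContDiffOn ℝ 2 g (Set.Icc 0 T) ∧
      Set.EqOn (iteratedDerivWithin 2 g (Set.Icc 0 T)) g'' (Set.Icc 0 T) := by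
  have hu := uniqueDiffOn_Icc hT
  obtain ⟨h1, e1⟩ := contDiffOn_of_eq_add_integral (c := 0) hT hg'' (fun t _ => (zero_add _).symm)
  obtain ⟨h2, e2⟩ := contDiffOn_of_eq_add_integral (c := 0) hT h1.continuousOn
    (fun t ht => (hg t ht).trans (zero_add _).symm)
  constructor
  · rw [show (2 : WithTop ℕ∞) = 1 + 1 by norm_num, contDiffOn_succ_iff_derivWithin hu]
    exact ⟨h2.differentiableOn one_ne_zero, by simp, h1.congr e2⟩
  · intro t ht
    rw [iteratedDerivWithin_succ, iteratedDerivWithin_one, derivWithin_congr e2 (e2 ht), e1 ht]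

theorem eq_add_integral_of_hasDerivWithinAt {g g' : ℝ → E} {T : ℝ}
    (hg : ∀ t ∈ Set.Icc 0 T, HasDerivWithinAt g (g' t) (Set.Icc 0 T) t)
    (hg' : ContinuousOn g' (Set.Icc 0 T)) {t : ℝ} (ht : t ∈ Set.Icc 0 T) :
    g t = g 0 + ∫ s in (0 : ℝ)..t, g' s := by
  have hsub : Set.Icc 0 t ⊆ Set.Icc 0 T := Set.Icc_subset_Icc_right ht.2
  rw [intervalIntegral.integral_eq_sub_of_hasDerivAt_of_le ht.1
    (fun s hs => (hg s (hsub hs)).continuousWithinAt.mono hsub) (fun s hs =>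
      (hg s ⟨hs.1.le, hs.2.le.trans ht.2⟩).hasDerivAt (Icc_mem_nhds hs.1 (hs.2.trans_le ht.2)))
    ((hg'.mono hsub).intervalIntegrable_of_Icc ht.1)]
  abel

end Calculus

/-- As g is the primitive of g', associativity gives g_δ * g = ∫ g_δ * g', whose integrand is
continuous and vanishes at 0. This supplies the initial condition for the derivative of the Caputo
potential of a weak solution. -/
theorem hasDerivWithinAt_conv_fracKernel_zero {g g' : ℝ → ℝ} {δ T : ℝ} (hδ : 0 < δ) (hT : 0 < T)
    (hg : ∀ t ∈ Set.Icc 0 T, g t = ∫ s in (0 : ℝ)..t, g' s)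
    (hg' : ContinuousOn g' (Set.Icc 0 T)) :
    HasDerivWithinAt (conv (fracKernel δ) g) 0 (Set.Icc 0 T) 0 := by
  have h0 : (0 : ℝ) ∈ Set.Icc 0 T := ⟨le_rfl, hT.le⟩
  obtain ⟨M, hM⟩ := isCompact_Icc.exists_bound_of_continuousOn hg'
  have hk : ContinuousOn (fracKernel δ) (Set.Ioi 0) := by
    unfold fracKernel
    exact ContinuousOn.div_const (fun s hs =>
      (Real.continuousAt_rpow_const s _ (Or.inl (ne_of_gt hs))).continuousWithinAt) _
  have hc : ContinuousOn (conv (fracKernel δ) g') (Set.Icc 0 T) :=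
    continuousOn_conv (C := (Real.Gamma δ)⁻¹) hδ hk (fun r hr => by
      rw [abs_of_nonneg (fracKernel_nonneg hδ hr.le), fracKernel, div_eq_inv_mul]) hg'
  have e : ∀ t ∈ Set.Icc 0 T, conv (fracKernel δ) g t =
      ∫ s in (0 : ℝ)..t, conv (fracKernel δ) g' s := fun t ht => by
    have hsub : Set.Ioc 0 t ⊆ Set.Icc 0 T := fun s hs => ⟨hs.1.le, hs.2.trans ht.2⟩
    have hm := (hg'.mono hsub).aestronglyMeasurable (μ := volume) measurableSet_Ioc
    have hb : ∀ s ∈ Set.Ioc 0 t, |g' s| ≤ M := fun s hs => hM s (hsub hs)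
    have h1 := integrableOn_fracKernel one_pos t
    have h2 := integrableOn_fracKernel hδ t
    rw [← conv_fracKernel_one, conv_assoc ht.1 h1 h2 hm hb,
      show conv (fracKernel 1) (fracKernel δ) = conv (fracKernel δ) (fracKernel 1) from
        funext fun r => conv_comm _ _ r, ← conv_assoc ht.1 h2 h1 hm hb]
    refine conv_congr ht.1 (fun _ _ => rfl) fun s hs => ?_
    rw [conv_fracKernel_one, hg s ⟨hs.1.le, hs.2.le.trans ht.2⟩]
  have := (hasDerivWithinAt_integral_Icc hc h0).congr e (e 0 h0)
  rwa [conv_zero] at this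

/-! ### The assembled trajectory is a weak solution -/

namespace DirichletForm.EigenSystem

universe u v

variable {X : Type u} [MeasurableSpace X] {m : Measure X} {𝓔 : DirichletForm m} {ι : Type v}

theorem inner_caputoPotential (h : L2 m) {α T t : ℝ} (hα2 : α < 2) {w : ℝ → L2 m}
    (hw : ContinuousOn w (Set.Icc 0 T)) (ht : t ∈ Set.Icc 0 T) :
    inner ℝ h (caputoPotential α T w t) = conv (fracKernel (2 - α)) (fun s => inner ℝ h (w s) -
      inner ℝ h (w 0) - s * inner ℝ h (derivWithin w (Set.Icc 0 T) 0)) t := by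
  set w' := derivWithin w (Set.Icc 0 T) 0 with hw'
  have h1 : IntervalIntegrable (fun r : ℝ => r ^ (1 - α)) volume 0 t :=
    intervalIntegral.intervalIntegrable_rpow' (by linarith)
  have h2 := (h1.comp_sub_left t).symm
  simp only [sub_zero, sub_self] at h2
  have h3 : IntervalIntegrable (fun s => (t - s) ^ (1 - α) • (w s - w 0 - s • w')) volume 0 t := by
    refine h2.smul_continuousOn ?_
    rw [Set.uIcc_of_le ht.1]
    have := hw.mono (Set.Icc_subset_Icc_right ht.2)
    fun_prop
  have h4 := (innerSL ℝ h).intervalIntegral_comp_comm h3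
  rw [caputoPotential, real_inner_smul_right, ← innerSL_apply_apply ℝ h, ← h4,
    ← intervalIntegral.integral_const_mul, conv]
  refine intervalIntegral.integral_congr fun s _ => ?_
  simp only [innerSL_apply_apply, real_inner_smul_right, inner_sub_right, fracKernel]
  rw [show 2 - α - 1 = 1 - α by ring]
  ring

variable [hF : Fact (0 < 𝓔.firstEigenvalue)]

theorem toL2_incl (S : 𝓔.EigenSystem ι) {σ s : ℝ} (hσ : σ ≤ s) (h : S.Space s) :
    S.toL2 (S.incl hσ h) = S.toL2 h := by
  unfold incl toL2
  exact congrArg Subtype.val (rfl : Submodule.inclusion (S.V_anti hσ) (show S.V s from h) =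
    ⟨h.1, S.V_anti hσ h.2⟩)

theorem norm_incl_le (S : 𝓔.EigenSystem ι) {σ s : ℝ} (hσ : σ ≤ s) (h : S.Space s) :
    ‖S.incl hσ h‖ ≤ 𝓔.firstEigenvalue ^ (-(s - σ)) * ‖h‖ := by
  have e : S.coord σ (S.incl hσ h) =
      mulLp (fun i => S.lam i ^ (-(s - σ))) _ (S.abs_rpow_neg_le (sub_nonneg.2 hσ))
        (S.coord s h) := by
    ext i
    rw [mulLp_apply, coord_apply, coord_apply, toL2_incl, ← mul_assoc,
      ← Real.rpow_add (S.lam_pos i), show -(s - σ) + s = σ by ring]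
  rw [norm_def, e, norm_def]
  exact norm_mulLp_le _ (Real.rpow_nonneg hF.out.le _) _

/-- The hypothesis says that y lists the V_{-s} coordinates of Ah; the two sides are then the same
series. -/
theorem seqDual_eq_form (S : 𝓔.EigenSystem ι) {s : ℝ} {h w : S.Space s}
    {y : lp (fun _ : ι => ℝ) 2}
    (hy : ∀ i, S.lam i ^ s * y i = S.lam i * inner ℝ (S.φ i) (S.toL2 h))
    (hh : S.toL2 h ∈ 𝓔.dom) (hw : S.toL2 w ∈ 𝓔.dom) :
    S.seqDual s y w = 𝓔.form ⟨S.toL2 h, hh⟩ ⟨S.toL2 w, hw⟩ := by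
  refine (S.hasSum_seqDual y w).unique ((S.hasSum_form _ _).congr_fun fun i => ?_)
  linear_combination inner ℝ (S.φ i) (S.toL2 w) * hy i

section Solution

variable {S : 𝓔.EigenSystem ι} {α T : ℝ} {q : ℝ≥0∞} {u₀ : S.Space (1 / α)} {u₁ : L2 m}
  {F : ℝ → S.Dual (1 / α)} {f : ℝ → L2 m} {u : ℝ → S.Space (1 / α)} {w : ℝ → L2 m}
  {y : ℝ → lp (fun _ : ι => ℝ) 2}

theorem toL2_eq_integral_of_modes (hα : 1 < α) (hα2 : α < 2)
    (hs : S.IsSource (order_nonneg hα) T q F f) (hw : ContinuousOn w (Set.Icc 0 T))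
    (hu : ∀ t ∈ Set.Icc 0 T, ∀ i, inner ℝ (S.φ i) (S.toL2 (u t)) = S.mode α u₀ u₁ F i t)
    (hwm : ∀ t ∈ Set.Icc 0 T, ∀ i, inner ℝ (S.φ i) (w t) = S.modeVel α u₀ u₁ F i t) :
    ∀ t ∈ Set.Icc 0 T, S.toL2 (u t) = S.toL2 u₀ + ∫ s in (0 : ℝ)..t, w s := by
  intro t ht
  have hsub : Set.Icc 0 t ⊆ Set.Icc 0 T := Set.Icc_subset_Icc_right ht.2
  refine S.eq_of_inner fun i => ?_
  have h1 := (innerSL ℝ (S.φ i)).intervalIntegral_comp_comm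
    ((hw.mono hsub).intervalIntegrable_of_Icc (μ := volume) ht.1)
  simp only [innerSL_apply_apply] at h1
  rw [hu t ht, inner_add_right, ← h1, mode, modeSol_eq_integral hα hα2 (S.lam_pos i) _ _
    (hs.continuousOn_apply _) ht]
  congr 1
  refine intervalIntegral.integral_congr fun s hs' => ?_
  rw [Set.uIcc_of_le ht.1] at hs'
  exact (hwm s (hsub hs') i).symm

/-- The equation D^α u = F - Au integrated twice in V_{-γ}. Tested against an eigenfunction it
becomes the scalar identity `conv_caputo_modeSol`. -/
theorem toDual_caputoPotential_of_modes (hα : 1 < α) (hα2 : α < 2)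
    (hs : S.IsSource (order_nonneg hα) T q F f)
    (huc : ContinuousOn (fun t => S.toL2 (u t)) (Set.Icc 0 T)) (hy : ContinuousOn y (Set.Icc 0 T))
    (hu : ∀ t ∈ Set.Icc 0 T, ∀ i, inner ℝ (S.φ i) (S.toL2 (u t)) = S.mode α u₀ u₁ F i t)
    (hym : ∀ t ∈ Set.Icc 0 T, ∀ i, S.lam i ^ (1 / α) * y t i = S.lam i * S.mode α u₀ u₁ F i t)
    (hd : derivWithin (fun t => S.toL2 (u t)) (Set.Icc 0 T) 0 = u₁) :
    ∀ t ∈ Set.Icc 0 T, S.toDual (order_nonneg hα) (caputoPotential α T (fun t => S.toL2 (u t)) t) =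
      ∫ s in (0 : ℝ)..t, ∫ r in (0 : ℝ)..s, (F r - S.seqDual (1 / α) (y r)) := by
  intro t ht
  have h0 : (0 : ℝ) ∈ Set.Icc 0 T := ⟨le_rfl, ht.1.trans ht.2⟩
  set G : ℝ → S.Dual (1 / α) := fun r => F r - S.seqDual (1 / α) (y r) with hG
  have hGc : ContinuousOn G (Set.Icc 0 T) :=
    hs.continuousOn.sub ((S.seqDual (1 / α)).continuous.comp_continuousOn hy)
  have hIc : ContinuousOn (fun s => ∫ r in (0 : ℝ)..s, G r) (Set.Icc 0 T) := fun s hs' =>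
    (hasDerivWithinAt_integral_Icc hGc hs').continuousWithinAt
  refine S.dual_ext fun i => ?_
  have hGi : ∀ r ∈ Set.Icc 0 T, G r (S.basisVec (1 / α) i) =
      F r (S.basisVec (1 / α) i) - S.lam i * S.mode α u₀ u₁ F i r := fun r hr => by
    rw [hG, sub_apply, seqDual_basisVec, hym r hr i]
  have hGic : ContinuousOn (fun r => F r (S.basisVec (1 / α) i) - S.lam i * S.mode α u₀ u₁ F i r)
      (Set.Icc 0 T) := (hGc.clm_apply continuousOn_const).congr fun r hr => (hGi r hr).symm
  have hsub : Set.Icc 0 t ⊆ Set.Icc 0 T := Set.Icc_subset_Icc_right ht.2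
  rw [ContinuousLinearMap.intervalIntegral_apply ((hIc.mono hsub).intervalIntegrable_of_Icc ht.1),
    toDual_apply, toL2_basisVec, real_inner_comm, inner_caputoPotential _ hα2 huc ht, hd]
  have e0 : inner ℝ (S.φ i) (S.toL2 (u 0)) = inner ℝ (S.φ i) (S.toL2 u₀) := by
    rw [hu 0 h0, mode, modeSol_zero (by linarith)]
  rw [e0]
  calc conv (fracKernel (2 - α)) (fun s => inner ℝ (S.φ i) (S.toL2 (u s)) -
        inner ℝ (S.φ i) (S.toL2 u₀) - s * inner ℝ (S.φ i) u₁) t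
      = conv (fracKernel (2 - α)) (fun s => S.mode α u₀ u₁ F i s -
        inner ℝ (S.φ i) (S.toL2 u₀) - s * inner ℝ (S.φ i) u₁) t :=
        conv_congr ht.1 (fun _ _ => rfl) fun s hs' => by
          rw [hu s ⟨hs'.1.le, hs'.2.le.trans ht.2⟩]
    _ = conv (fracKernel 2) (fun s => F s (S.basisVec (1 / α) i) -
        S.lam i * S.mode α u₀ u₁ F i s) t :=
        conv_caputo_modeSol hα hα2 (S.lam_pos i) _ _ (hs.continuousOn_apply _) ht
    _ = _ := by
      rw [conv_fracKernel_two_eq hGic ht]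
      refine intervalIntegral.integral_congr fun s hs' => ?_
      rw [Set.uIcc_of_le ht.1] at hs'
      have hsub' : Set.Icc 0 s ⊆ Set.Icc 0 T := Set.Icc_subset_Icc_right (hs'.2.trans ht.2)
      rw [ContinuousLinearMap.intervalIntegral_apply
        ((hGc.mono hsub').intervalIntegrable_of_Icc hs'.1)]
      refine intervalIntegral.integral_congr fun r hr => ?_
      rw [Set.uIcc_of_le hs'.1] at hr
      exact (hGi r (hsub' hr)).symm

theorem isWeakSolution_of_modes (hα : 1 < α) (hα2 : α < 2) (hT : 0 < T)
    (hs : S.IsSource (order_nonneg hα) T q F f) (huc : ContinuousOn u (Set.Icc 0 T))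
    (hw : ContinuousOn w (Set.Icc 0 T)) (hy : ContinuousOn y (Set.Icc 0 T))
    (hu : ∀ t ∈ Set.Icc 0 T, ∀ i, inner ℝ (S.φ i) (S.toL2 (u t)) = S.mode α u₀ u₁ F i t)
    (hwm : ∀ t ∈ Set.Icc 0 T, ∀ i, inner ℝ (S.φ i) (w t) = S.modeVel α u₀ u₁ F i t)
    (hym : ∀ t ∈ Set.Icc 0 T, ∀ i, S.lam i ^ (1 / α) * y t i = S.lam i * S.mode α u₀ u₁ F i t) :
    S.IsWeakSolution hα T u₀ u₁ f u ∧
      Set.EqOn (derivWithin (fun t => S.toL2 (u t)) (Set.Icc 0 T)) w (Set.Icc 0 T) ∧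
      Set.EqOn (S.caputoDeriv (order_nonneg hα) α T (fun t => S.toL2 (u t)))
        (fun t => F t - S.seqDual (1 / α) (y t)) (Set.Icc 0 T) := by
  have h0 : (0 : ℝ) ∈ Set.Icc 0 T := ⟨le_rfl, hT.le⟩
  have hα0 : 0 < α := by linarith
  have hle : 𝓝[>] (0 : ℝ) ≤ 𝓝[Set.Icc 0 T] 0 := nhdsWithin_le_of_mem (Icc_mem_nhdsGT hT)
  obtain ⟨hC1, hderiv⟩ := contDiffOn_of_eq_add_integral hT hw
    (toL2_eq_integral_of_modes hα hα2 hs hw hu hwm)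
  have hw0 : w 0 = u₁ := S.eq_of_inner fun i => by
    rw [hwm 0 h0, modeVel, modeDeriv_zero hα]
  have hd0 := (hderiv h0).trans hw0
  have hu0 : u 0 = u₀ := S.toL2_injective (S.eq_of_inner fun i => by
    rw [hu 0 h0, mode, modeSol_zero hα0])
  obtain ⟨hC2, hcap⟩ := contDiffOn_two_of_eq_integral hT
    (g'' := fun t => F t - S.seqDual (1 / α) (y t))
    (hs.continuousOn.sub ((S.seqDual (1 / α)).continuous.comp_continuousOn hy))
    (toDual_caputoPotential_of_modes hα hα2 hs hC1.continuousOn hy hu hym hd0)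
  -- Continuity in V_γ and L² is stronger than the two limits require; σ = 0 and β = 1 - 1/α are
  -- merely convenient choices.
  refine ⟨⟨huc, hC1, hC2, hu0, hd0, ⟨0, le_rfl, by positivity, ?_⟩, ⟨1 - 1 / α, ?_, le_rfl, ?_⟩, ?_⟩,
    hderiv, hcap⟩
  · have h1 : Tendsto (fun t => ‖u t - u₀‖) (𝓝[>] 0) (𝓝 0) := by
      rw [← tendsto_iff_norm_sub_tendsto_zero, ← hu0]
      exact (huc 0 h0).mono_left hle
    have h2 := h1.const_mul (𝓔.firstEigenvalue ^ (-(1 / α - 0)))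
    rw [mul_zero] at h2
    exact squeeze_zero (fun t => norm_nonneg _) (fun t => S.norm_incl_le _ _) h2
  · rw [sub_pos, div_lt_one hα0]
    exact hα
  · have h1 : Tendsto (fun t => w t - u₁) (𝓝[>] 0) (𝓝 0) := by
      have := (hw 0 h0).mono_left hle
      rw [hw0] at this
      simpa using this.sub_const u₁
    have h2 := ((S.toDual (s := 1 - 1 / α) (by
      rw [sub_nonneg, div_le_one hα0]
      exact hα.le)).continuous.tendsto 0).comp h1 |>.norm
    rw [map_zero, norm_zero] at h2
    refine h2.congr' ?_
    filter_upwards [Icc_mem_nhdsGT hT] with t ht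
    rw [hderiv ht]
    rfl
  · intro w'
    -- By α < 2, V_γ is contained in V_{1/2}, hence in the form domain.
    have hhalf : 1 / 2 ≤ 1 / α := one_div_le_one_div_of_le hα0 hα2.le
    filter_upwards [hs.ae_eq, self_mem_ae_restrict measurableSet_Ioo] with t ht htm
    have htm' := Set.Ioo_subset_Icc_self htm
    refine ⟨S.toL2_mem_dom hhalf _, S.toL2_mem_dom hhalf _, ?_⟩
    have hc : S.caputoDeriv (order_nonneg hα) α T (fun t => S.toL2 (u t)) t =
        F t - S.seqDual (1 / α) (y t) := hcap htm'
    rw [hc, sub_apply, ht, toDual_apply,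
      S.seqDual_eq_form (h := u t) (fun i => by rw [hu t htm' i, hym t htm' i])
        (S.toL2_mem_dom hhalf _) (S.toL2_mem_dom hhalf _), sub_add_cancel]

end Solution

/-! ### Uniqueness of weak solutions -/

section Uniqueness

variable {S : 𝓔.EigenSystem ι} {α T : ℝ} {q : ℝ≥0∞} {u₀ : S.Space (1 / α)} {u₁ : L2 m}
  {F : ℝ → S.Dual (1 / α)} {f : ℝ → L2 m} {v : ℝ → S.Space (1 / α)}

theorem IsWeakSolution.caputoDeriv_basisVec {hα : 1 < α} (hv : S.IsWeakSolution hα T u₀ u₁ f v)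
    (hs : S.IsSource (order_nonneg hα) T q F f) (i : ι) :
    ∀ᵐ t ∂volume.restrict (Set.Ioo 0 T),
      S.caputoDeriv (order_nonneg hα) α T (fun t => S.toL2 (v t)) t (S.basisVec (1 / α) i) =
        F t (S.basisVec (1 / α) i) - S.lam i * inner ℝ (S.φ i) (S.toL2 (v t)) := by
  filter_upwards [hv.variational (S.basisVec (1 / α) i), hs.ae_eq] with t ⟨hd, hd', h⟩ ht
  have e := S.form_basis_right i ⟨S.toL2 (v t), hd⟩ hd'
  rw [ht, toDual_apply, ← h]
  exact (eq_sub_of_add_eq (congrArg (_ + ·) e.symm))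

/-- The equation tested with φ_i is integrated twice from 0. This needs the potential P and its
first derivative to vanish at 0 on φ_i. -/
theorem IsWeakSolution.conv_caputo_eq {hα : 1 < α} (hα2 : α < 2) (hT : 0 < T)
    (hv : S.IsWeakSolution hα T u₀ u₁ f v) (hs : S.IsSource (order_nonneg hα) T q F f) (i : ι) :
    ∀ t ∈ Set.Icc 0 T, conv (fracKernel (2 - α)) (fun s => inner ℝ (S.φ i) (S.toL2 (v s)) -
        inner ℝ (S.φ i) (S.toL2 u₀) - s * inner ℝ (S.φ i) u₁) t =
      conv (fracKernel 2) (fun s => F s (S.basisVec (1 / α) i) -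
        S.lam i * inner ℝ (S.φ i) (S.toL2 (v s))) t := by
  have h0 : (0 : ℝ) ∈ Set.Icc 0 T := ⟨le_rfl, hT.le⟩
  have hu := uniqueDiffOn_Icc hT
  set I := Set.Icc 0 T with hI
  set e := S.basisVec (1 / α) i with he
  set P : ℝ → S.Dual (1 / α) := fun t => S.toDual (order_nonneg hα)
    (caputoPotential α T (fun t => S.toL2 (v t)) t) with hP
  have hPC : ContDiffOn ℝ 2 P I := hv.caputo
  set g : ℝ → ℝ := fun s => inner ℝ (S.φ i) (S.toL2 (v s)) -
        inner ℝ (S.φ i) (S.toL2 u₀) - s * inner ℝ (S.φ i) u₁ with hg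
  have hPe : ∀ t ∈ I, P t e = conv (fracKernel (2 - α)) g t := fun t ht => by
    rw [hP, toDual_apply, he, toL2_basisVec, real_inner_comm,
      inner_caputoPotential _ hα2 hv.contDiffOn.continuousOn ht, hv.initial_deriv, hv.initial]
  have hvc : ContinuousOn (fun t => inner ℝ (S.φ i) (S.toL2 (v t))) I :=
    (innerSL ℝ (S.φ i)).continuous.comp_continuousOn hv.contDiffOn.continuousOn
  have hvd := (contDiffOn_one_iff_derivWithin hu).1 hv.contDiffOn
  have hgi : ∀ t ∈ I, g t = ∫ s in (0 : ℝ)..t, (inner ℝ (S.φ i)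
      (derivWithin (fun t => S.toL2 (v t)) I s) - inner ℝ (S.φ i) u₁) := by
    intro t ht
    have h1 := eq_add_integral_of_hasDerivWithinAt (g := g) (fun s hs' =>
      ((((innerSL ℝ (S.φ i)).hasFDerivAt.comp_hasDerivWithinAt s
        (hvd.1 s hs').hasDerivWithinAt).sub_const (inner ℝ (S.φ i) (S.toL2 u₀))).sub
          ((hasDerivWithinAt_id s I).mul_const (inner ℝ (S.φ i) u₁))))
      (((innerSL ℝ (S.φ i)).continuous.comp_continuousOn hvd.2).sub continuousOn_const) ht
    rw [h1]
    simp [hg, hv.initial]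
  -- The derivative at 0 vanishes because the coefficient of u is C¹ and its Taylor polynomial of
  -- degree one has been subtracted.
  have hd1 : HasDerivWithinAt (fun t => P t e) 0 I 0 :=
    (hasDerivWithinAt_conv_fracKernel_zero (by linarith) hT hgi
      (((innerSL ℝ (S.φ i)).continuous.comp_continuousOn hvd.2).sub continuousOn_const)).congr
      hPe (hPe 0 h0)
  rw [show (2 : WithTop ℕ∞) = 1 + 1 by norm_num, contDiffOn_succ_iff_derivWithin hu] at hPC
  have hPC' := (contDiffOn_one_iff_derivWithin hu).1 hPC.2.2
  have happ : ∀ {Q : ℝ → S.Dual (1 / α)}, DifferentiableOn ℝ Q I → ∀ t ∈ I,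
      HasDerivWithinAt (fun t => Q t e) (derivWithin Q I t e) I t := fun {Q} hQ t ht => by
    have := ((hQ t ht).hasDerivWithinAt).clm_apply (hasDerivWithinAt_const t I e)
    simpa using this
  have hP' : derivWithin P I 0 e = 0 := (hu 0 h0).eq_deriv _ (happ hPC.1 0 h0) hd1
  have hG : ∀ t, derivWithin (derivWithin P I) I t =
      S.caputoDeriv (order_nonneg hα) α T (fun t => S.toL2 (v t)) t := fun t => by
    rw [caputoDeriv, iteratedDerivWithin_succ, iteratedDerivWithin_one]
  have hFi : ContinuousOn (fun s => F s e - S.lam i * inner ℝ (S.φ i) (S.toL2 (v s))) I :=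
    (hs.continuousOn_apply e).sub (hvc.const_mul _)
  have hPt' : ∀ t ∈ I, derivWithin P I t e =
      ∫ s in (0 : ℝ)..t, (F s e - S.lam i * inner ℝ (S.φ i) (S.toL2 (v s))) := fun t ht => by
    rw [eq_add_integral_of_hasDerivWithinAt (happ hPC'.1) (hPC'.2.clm_apply continuousOn_const) ht,
      hP', zero_add, intervalIntegral.integral_of_le ht.1, intervalIntegral.integral_of_le ht.1,
      ← restrict_Ioo_eq_restrict_Ioc]
    -- The variational equation is known only almost everywhere, which suffices under the integral.
    refine integral_congr_ae ?_
    filter_upwards [ae_mono (Measure.restrict_mono (Set.Ioo_subset_Ioo_right ht.2) le_rfl)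
      (hv.caputoDeriv_basisVec hs i)] with s h
    rw [hG, h]
  intro t ht
  have hP0 : P 0 e = 0 := by rw [hPe 0 h0, conv_zero]
  have hsub : Set.Icc 0 t ⊆ I := Set.Icc_subset_Icc_right ht.2
  rw [← hPe t ht, eq_add_integral_of_hasDerivWithinAt (happ hPC.1)
    (hPC.2.2.continuousOn.clm_apply continuousOn_const) ht, hP0, zero_add,
    conv_fracKernel_two_eq hFi ht]
  refine intervalIntegral.integral_congr fun s hs' => ?_
  rw [Set.uIcc_of_le ht.1] at hs'
  exact hPt' s (hsub hs')

/-- The coefficient and the mode satisfy the same twice integrated equation with the same data, so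
their difference solves the homogeneous one and vanishes. -/
theorem IsWeakSolution.inner_eq_mode {hα : 1 < α} (hα2 : α < 2) (hT : 0 < T)
    (hv : S.IsWeakSolution hα T u₀ u₁ f v) (hs : S.IsSource (order_nonneg hα) T q F f) (i : ι) :
    ∀ t ∈ Set.Icc 0 T, inner ℝ (S.φ i) (S.toL2 (v t)) = S.mode α u₀ u₁ F i t := by
  have hFc := hs.continuousOn_apply (S.basisVec (1 / α) i)
  have hvc : ContinuousOn (fun t => inner ℝ (S.φ i) (S.toL2 (v t))) (Set.Icc 0 T) :=
    (innerSL ℝ (S.φ i)).continuous.comp_continuousOn hv.contDiffOn.continuousOn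
  have huc : ContinuousOn (S.mode α u₀ u₁ F i) (Set.Icc 0 T) :=
    continuousOn_modeSol hα hα2 (S.lam_pos i) _ _ hFc
  have hlin : ∀ x : ℝ → ℝ, ContinuousOn x (Set.Icc 0 T) → ContinuousOn (fun s => x s -
      inner ℝ (S.φ i) (S.toL2 u₀) - s * inner ℝ (S.φ i) u₁) (Set.Icc 0 T) := fun x hx =>
    (hx.sub continuousOn_const).sub (continuousOn_id.mul continuousOn_const)
  have hrhs : ∀ x : ℝ → ℝ, ContinuousOn x (Set.Icc 0 T) → ContinuousOn (fun s =>
      F s (S.basisVec (1 / α) i) - S.lam i * x s) (Set.Icc 0 T) := fun x hx =>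
    hFc.sub (hx.const_mul _)
  intro t ht
  refine sub_eq_zero.1 (eq_zero_of_conv_caputo hα hα2 (S.lam_pos i) hT (hvc.sub huc) ?_ t ht)
  intro r hr
  have hsub : Set.Icc 0 r ⊆ Set.Icc 0 T := Set.Icc_subset_Icc_right hr.2
  have hi : ∀ {δ : ℝ}, 0 < δ → ∀ {x : ℝ → ℝ}, ContinuousOn x (Set.Icc 0 T) →
      IntervalIntegrable (fun s => fracKernel δ (r - s) * x s) volume 0 r := fun hδ _ hx =>
    intervalIntegrable_conv_of_continuousOn hr.1 (integrableOn_fracKernel hδ r) (hx.mono hsub)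
  have h1 := hv.conv_caputo_eq hα2 hT hs i r hr
  have h2 : _ = _ := conv_caputo_modeSol hα hα2 (S.lam_pos i) (inner ℝ (S.φ i) (S.toL2 u₀))
    (inner ℝ (S.φ i) u₁) hFc hr
  have h3 := conv_sub (hi (δ := 2 - α) (by linarith) (hlin _ hvc))
    (hi (δ := 2 - α) (by linarith) (hlin _ huc))
  have h4 := conv_sub (hi two_pos (hrhs _ hvc)) (hi two_pos (hrhs _ huc))
  rw [← conv_const_mul]
  refine Eq.trans ?_ ((h3.trans (congrArg₂ (· - ·) h1 h2)).trans (h4.symm.trans ?_))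
  · refine conv_congr hr.1 (fun _ _ => rfl) fun s _ => ?_
    simp only [Pi.sub_apply]
    ring
  · refine conv_congr hr.1 (fun _ _ => rfl) fun s _ => ?_
    simp only [Pi.sub_apply]
    ring

theorem IsWeakSolution.eqOn_of_modes {hα : 1 < α} (hα2 : α < 2) (hT : 0 < T)
    (hv : S.IsWeakSolution hα T u₀ u₁ f v) (hs : S.IsSource (order_nonneg hα) T q F f)
    {u : ℝ → S.Space (1 / α)}
    (hu : ∀ t ∈ Set.Icc 0 T, ∀ i, inner ℝ (S.φ i) (S.toL2 (u t)) = S.mode α u₀ u₁ F i t) :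
    Set.EqOn v u (Set.Icc 0 T) := fun t ht => S.toL2_injective (S.eq_of_inner fun i => by
  rw [hv.inner_eq_mode hα2 hT hs i t ht, hu t ht i])

end Uniqueness

end DirichletForm.EigenSystem

end FracWave

end

/-! ### The main theorem -/

theorem mainTheorem5 {X : Type*} [MetricSpace X] [MeasurableSpace X] [BorelSpace X]
    (hX : TotallyBounded (Set.univ : Set X))
    (m : MeasureTheory.Measure X) [MeasureTheory.IsFiniteMeasure m] [m.Regular]
    [m.IsOpenPosMeasure]
    (𝓔 : FracWave.DirichletForm m) (hcomp : 𝓔.CompactEmbedding) (hsob : 𝓔.SobolevEmbedding)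
    [Fact (0 < 𝓔.firstEigenvalue)] :
    (∃ ι : Set ℕ, Nonempty (𝓔.EigenSystem ι)) ∧
    ∀ {ι : Type*} (S : 𝓔.EigenSystem ι) (α : ℝ) (hα : 1 < α), α < 2 →
    ∀ (p : ℝ) (q : ENNReal), 1 ≤ p → p < 1 / (2 - α) →
      ENNReal.HolderConjugate (ENNReal.ofReal p) q →
    ∃ C : ℝ, 0 < C ∧
    ∀ (T : ℝ), 0 < T → ∀ (u₀ : S.Space (1 / α)) (u₁ : FracWave.L2 m)
      (F : ℝ → S.Dual (1 / α)) (f : ℝ → FracWave.L2 m),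
      S.IsSource (FracWave.DirichletForm.EigenSystem.order_nonneg hα) T q F f →
    ∃ u : ℝ → S.Space (1 / α),
      S.IsWeakSolution hα T u₀ u₁ f u ∧
      (∀ v : ℝ → S.Space (1 / α), S.IsWeakSolution hα T u₀ u₁ f v →
        Set.EqOn v u (Set.Icc 0 T)) ∧
      (∀ t ∈ Set.Icc 0 T, ∃ s₁ s₂ s₃ : S.Space (1 / α),
        HasSum (fun i => (inner ℝ (S.toL2 u₀) (S.φ i) *
          FracWave.mittagLeffler α 1 (-S.lam i * t ^ α)) • S.basisVec (1 / α) i) s₁ ∧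
        HasSum (fun i => (inner ℝ u₁ (S.φ i) *
          (t * FracWave.mittagLeffler α 2 (-S.lam i * t ^ α))) • S.basisVec (1 / α) i) s₂ ∧
        HasSum (fun i => (∫ τ in (0 : ℝ)..t, inner ℝ (f τ) (S.φ i) * (t - τ) ^ (α - 1) *
          FracWave.mittagLeffler α α (-S.lam i * (t - τ) ^ α)) • S.basisVec (1 / α) i) s₃ ∧
        u t = s₁ + s₂ + s₃) ∧
      (∀ t ∈ Set.Icc 0 T,
        ‖u t‖ + ‖derivWithin (fun r => S.toL2 (u r)) (Set.Icc 0 T) t‖ ≤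
          C * (‖u₀‖ + ‖u₁‖ + t ^ (1 / p + α - 2) *
            (MeasureTheory.eLpNorm f q
              (MeasureTheory.volume.restrict (Set.Ioo 0 T))).toReal)) ∧
      (∀ t ∈ Set.Icc 0 T,
        ‖S.caputoDeriv (FracWave.DirichletForm.EigenSystem.order_nonneg hα) α T
            (fun r => S.toL2 (u r)) t‖ ≤
          C * (‖u₀‖ + t ^ (2 - α) * ‖u₁‖ + t ^ (1 / p) *
            (MeasureTheory.eLpNorm f q
              (MeasureTheory.volume.restrict (Set.Ioo 0 T))).toReal +
            sSup ((fun r => ‖F r‖) '' Set.Icc 0 T))) := by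
  have hsep := FracWave.separableSpace_L2 hX m
  refine ⟨𝓔.exists_eigenSystem hcomp, fun {ι} S α hα hα2 p q hp hp2 hpq => ?_⟩
  -- The index type of the given basis is arbitrary; separability of L² makes it countable, as
  -- dominated convergence over spectral tails requires.
  have : Countable ι := FracWave.countable_of_orthonormal S.φ.orthonormal
  obtain ⟨C, hC, hmain⟩ := S.exists_trajectories hα hα2 hp hp2 hpq
  -- D^α u = F - Au: C bounds Au, and the extra 1 is the coefficient of ‖F‖.
  refine ⟨C + 1, by positivity, fun T hT u₀ u₁ F f hs => ?_⟩
  obtain ⟨u, w, y, huc, hw, hy, h⟩ := hmain T u₀ u₁ F f hs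
  have hum := fun t ht => (h t ht).1
  obtain ⟨hweak, hderiv, hcap⟩ := FracWave.DirichletForm.EigenSystem.isWeakSolution_of_modes hα hα2
    hT hs huc hw hy hum (fun t ht => (h t ht).2.1) fun t ht => (h t ht).2.2.1
  refine ⟨u, hweak, fun v hv => hv.eqOn_of_modes hα2 hT hs hum, fun t ht => ?_, fun t ht => ?_,
    fun t ht => ?_⟩
  · obtain ⟨s₁, s₂, s₃, h1, h2, h3, e⟩ := (h t ht).2.2.2.1
    refine ⟨s₁, s₂, s₃, (S.hasSum_basisVec s₁).congr_fun fun i => ?_,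
      (S.hasSum_basisVec s₂).congr_fun fun i => ?_, (S.hasSum_basisVec s₃).congr_fun fun i => ?_, e⟩
    · rw [h1, FracWave.mlKernel, sub_self, Real.rpow_zero, one_mul, real_inner_comm]
    · rw [h2, FracWave.mlKernel, show (2 : ℝ) - 1 = 1 by norm_num, Real.rpow_one, real_inner_comm]
    · rw [h3, FracWave.conv]
      congr 1
      refine intervalIntegral.integral_congr fun τ _ => ?_
      simp only [FracWave.mlKernel]
      rw [real_inner_comm]
      ring
  · rw [hderiv ht]
    refine ((h t ht).2.2.2.2.1).trans ?_
    have ht0 := ht.1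
    gcongr
    linarith
  · rw [hcap ht]
    have h1 : ‖F t‖ ≤ sSup ((fun r => ‖F r‖) '' Set.Icc 0 T) :=
      le_csSup (isCompact_Icc.image_of_continuousOn hs.continuousOn.norm).bddAbove ⟨t, ht, rfl⟩
    have h2 := (h t ht).2.2.2.2.2
    have h3 := S.norm_seqDual_le (s := 1 / α) (y t)
    refine (norm_sub_le _ _).trans ?_
    have ht0 := ht.1
    set A := ‖u₀‖ + t ^ (2 - α) * ‖u₁‖ + t ^ (1 / p) *
      (MeasureTheory.eLpNorm f q (MeasureTheory.volume.restrict (Set.Ioo 0 T))).toReal with hA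
    have hA0 : 0 ≤ A := by positivity
    have hB0 : 0 ≤ C * sSup ((fun r => ‖F r‖) '' Set.Icc 0 T) :=
      mul_nonneg hC.le ((norm_nonneg _).trans h1)
    linarith
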